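/- **Setting.** The group $PSL(2,\mathbb C)$ of Möbius transformations acts on $\mathbb{CP}^1$. For a smooth immersed curve $X:\mathbb R\to\mathbb{CP}^1$ let $\mathbf t$, $\mathbf n=i\mathbf t$ and $k$ be the unit tangent, unit normal and geodesic curvature with respect to the Fubini–Study metric (normalised so that a unit-speed curve has a horizontal lift $\hat X$ to $S^3\subset\mathbb C^2$ with $|\hat X'|=1$ and $\hat X''=-\hat X+ik\hat X'$), and let a prime denote the derivative with respect to Fubini–Study arc length. The curve is *admissible* if $k'>0$ everywhere. For an admissible curve the inversive length element is $ds=(k')^{1/2}\,d(\text{arc length})$, the inversive normal is $\mathcal N=(k')^{-1/2}\mathbf n$, and the Gauss map $G$ with values in $PSL(2,\mathbb C)$ is $$G=\begin{pmatrix}(k')^{1/4}&0\\ -\frac{k''}{4(k')^{5/4}}+\frac{k}{2(k')^{1/4}}i&(k')^{-1/4}\end{pmatrix}\begin{pmatrix}(\hat X')^*\\ \hat X^*\end{pmatrix}.$$ The fundamental invariant is the real function $Q$ determined by the equation $\partial_sG=\begin{pmatrix}0&-1\\Q+\frac i2&0\end{pmatrix}G$ (for $G$ normalised to determinant one), and $Q^{(p)}=\partial_s^pQ$.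 For $L\in PSL(2,\mathbb C)$, an admissible curve $X$ is *$L$-cocompact* if $L(X(\mathbb R))=X(\mathbb R)$ and $L(X(u))\ne X(u)$ for all $u$. It is parametrised (after replacing $L$ by $L^{-1}$ if necessary) so that $X(u+a)=L(X(u))$ for some $a>0$; integrals $\int\cdot\,ds$ are over one period $[0,a]$, and $\ell(X)=\int ds$. Two $L$-cocompact curves are homotopic if they are joined by a smooth family of $L$-cocompact curves $H_\sigma$, $\sigma\in[0,1]$. The *inversive curve lengthening flow* with initial data $X_0$ is a smooth map $X:\mathbb R\times[0,T)\to\mathbb{CP}^1$, $0<T\le\infty$, such that each $X(\cdot,t)$ is admissible, $X(u+a,t)=L(X(u,t))$, $X(\cdot,0)=X_0$ and $$\partial_tX=-Q_s\,\mathcal N .$$ **Proposition.** Let $p\ge1$ be an integer and let $X_0:\mathbb R\to\mathbb{CP}^1$ be an $L$-cocompact admissible curve. There is a constant $c\ge 1$, depending only on $L$, $p$, the homotopy class of $X_0$ in the space of $L$-cocompact curves, $\ell(X_0)$ and $\int Q^2\,ds\big|_{t=0}$, such that along every inversive curve lengthening flow $X:\mathbb R\times[0,T)\to\mathbb{CP}^1$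 with initial data $X_0$ we have, for all $0<t<T$, $$\int\bigl(Q^{(p)}\bigr)^2ds\le c\,\min\Bigl\{\int\bigl(Q^{(p)}\bigr)^2ds\Big|_{t=0},\ 1+t^{-p/3}\Bigr\}.$$ -/

import Mathlib

open scoped LinearAlgebra.Projectivization Matrix ContDiff

noncomputable section

namespace Inversive

/-- The complex projective line `(ℂ² ∖ {0}) / ℂˣ`. -/
abbrev CP1 : Type := ℙ ℂ (Fin 2 → ℂ)

/-- The group of Möbius transformations `SL(2, ℂ) / {± 1}`, acting on `CP1` (Mathlib's action). -/
abbrev Moebius : Type := Matrix.ProjectiveSpecialLinearGroup (Fin 2) ℂ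

/-- The Hermitian norm on `ℂ²`. -/
def hermNorm (v : Fin 2 → ℂ) : ℝ := Real.sqrt (star v ⬝ᵥ v).re

/-! ### Curves in the projective line -/

/-- `V` is a smooth lift of the curve `X` to `ℂ² ∖ {0}`. -/
def IsSmoothLift (V : ℝ → Fin 2 → ℂ) (X : ℝ → CP1) : Prop :=
  ContDiff ℝ ∞ V ∧ ∀ u, ∃ h : V u ≠ 0, X u = Projectivization.mk ℂ (V u) h

/-- Smoothness of a curve in `CP1`.  As `ℝ` is contractible and `ℂ² ∖ {0} → CP1` is a principal
`ℂˣ`-bundle, a curve is smooth if and only if it has a smooth lift. -/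
def IsSmoothCurve (X : ℝ → CP1) : Prop := ∃ V, IsSmoothLift V X

/-- `W` is a smooth lift of the family of curves `X t`, `t ∈ I`; here `I` is an interval of
positive length, so that `X` is smooth on `I × ℝ` if and only if such a lift exists. -/
def IsSmoothLiftOn (I : Set ℝ) (W : ℝ → ℝ → Fin 2 → ℂ) (X : ℝ → ℝ → CP1) : Prop :=
  ContDiffOn ℝ ∞ (fun q : ℝ × ℝ => W q.1 q.2) (I ×ˢ Set.univ) ∧
    ∀ t ∈ I, ∀ u, ∃ h : W t u ≠ 0, X t u = Projectivization.mk ℂ (W t u) h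

/-- `V` is a horizontal lift of `X` to `S³`: it has length one, and its derivative is Hermitian
orthogonal to the complex line `X u`. -/
def IsHorizontalLift (V : ℝ → Fin 2 → ℂ) (X : ℝ → CP1) : Prop :=
  IsSmoothLift V X ∧ (∀ u, star (V u) ⬝ᵥ V u = 1) ∧ ∀ u, star (V u) ⬝ᵥ deriv V u = 0

open Classical in
/-- A horizontal lift of `X`.  Every smooth curve has one, unique up to a constant factor of
modulus one, on which none of the quantities below depends. -/
def horizontalLift (X : ℝ → CP1) : ℝ → Fin 2 → ℂ :=
  Classical.epsilon fun V => IsHorizontalLift V X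

/-- The speed of `X` in the Fubini-Study metric. -/
def fsSpeed (X : ℝ → CP1) (u : ℝ) : ℝ := hermNorm (deriv (horizontalLift X) u)

/-- The derivative of a real function along `X` with respect to Fubini-Study arc length. -/
def fsDeriv (X : ℝ → CP1) (f : ℝ → ℝ) (u : ℝ) : ℝ := deriv f u / fsSpeed X u

/-- The unit tangent vector, as a horizontal vector at `horizontalLift X u`. -/
def unitTangent (X : ℝ → CP1) (u : ℝ) : Fin 2 → ℂ :=
  (fsSpeed X u)⁻¹ • deriv (horizontalLift X) u

/-- The geodesic curvature `k` of `X` in the Fubini-Study metric: if `V` is the horizontal lift,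
`e` the unit tangent and `'` the arc length derivative, then `e' = - V + i k e`. -/
def geodCurv (X : ℝ → CP1) (u : ℝ) : ℝ :=
  (star (unitTangent X u) ⬝ᵥ ((fsSpeed X u)⁻¹ • deriv (unitTangent X) u)).im

/-- An admissible curve: a smooth immersion whose geodesic curvature is increasing, with positive
derivative. -/
def IsAdmissible (X : ℝ → CP1) : Prop :=
  IsSmoothCurve X ∧ (∀ u, 0 < fsSpeed X u) ∧ ∀ u, 0 < fsDeriv X (geodCurv X) u

/-! ### Inversive invariants -/

/-- The density `ρ` of the inversive length element `ds = (k')^{1/2} d(arc length) = ρ du`. -/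
def invDensity (X : ℝ → CP1) (u : ℝ) : ℝ :=
  Real.sqrt (fsDeriv X (geodCurv X) u) * fsSpeed X u

/-- The derivative `∂_s` with respect to the inversive parameter. -/
def invDeriv (X : ℝ → CP1) (f : ℝ → ℝ) (u : ℝ) : ℝ := deriv f u / invDensity X u

/-- The unitary factor of the Gauss map, taking the point to `[0 : 1]` and the unit tangent to the
positive real direction.  Its determinant has modulus one. -/
def gaussUnitary (X : ℝ → CP1) (u : ℝ) : Matrix (Fin 2) (Fin 2) ℂ :=
  Matrix.of ![star (unitTangent X u), star (horizontalLift X u)]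

/-- The triangular factor of the Gauss map. -/
def gaussTriangular (X : ℝ → CP1) (u : ℝ) : Matrix (Fin 2) (Fin 2) ℂ :=
  let k : ℝ := geodCurv X u
  let k' : ℝ := fsDeriv X (geodCurv X) u
  let k'' : ℝ := fsDeriv X (fsDeriv X (geodCurv X)) u
  !![((k' ^ (1 / 4 : ℝ) : ℝ) : ℂ), 0;
     ((-k'' / (4 * k' ^ (5 / 4 : ℝ)) : ℝ) : ℂ) + ((k / (2 * k' ^ (1 / 4 : ℝ)) : ℝ) : ℂ) * Complex.I,
     ((k' ^ (-1 / 4 : ℝ) : ℝ) : ℂ)]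

/-- The inversive Gauss map, as a matrix representing a Möbius transformation, and so defined up to
a scalar factor: `G u` takes `X` into the normal form at `u`. -/
def gaussMap (X : ℝ → CP1) (u : ℝ) : Matrix (Fin 2) (Fin 2) ℂ :=
  gaussTriangular X u * gaussUnitary X u

/-- The fundamental invariant `Q`, defined by the Serret-Frenet equation
`(∂_s G) G⁻¹ = !![0, -1; Q + i / 2, 0]` for the Gauss map normalized to determinant one.  For an
unnormalized representative the left side changes by a multiple of the identity matrix only, so
that `Q` is the real part of the lower left entry in either case. -/
def fundInv (X : ℝ → CP1) (u : ℝ) : ℝ :=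
  (((Matrix.of fun i j => deriv (fun v => gaussMap X v i j) u / (invDensity X u : ℂ)) *
    (gaussMap X u)⁻¹) 1 0).re

/-- `Q^{(p)} = ∂_s^p Q`. -/
def fundInvDeriv (X : ℝ → CP1) (p : ℕ) : ℝ → ℝ := (invDeriv X)^[p] (fundInv X)

/-- The inversive length of the part of `X` between the parameters `0` and `a`. -/
def invLength (X : ℝ → CP1) (a : ℝ) : ℝ := ∫ u in (0 : ℝ)..a, invDensity X u

/-- `∫ (Q^{(p)})² ds` over the part of `X` between the parameters `0` and `a`. -/
def energy (X : ℝ → CP1) (a : ℝ) (p : ℕ) : ℝ :=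
  ∫ u in (0 : ℝ)..a, fundInvDeriv X p u ^ 2 * invDensity X u

/-- The inversive normal vector `𝒩 = (k')^{-1/2} n = (k')^{-1/2} i t`, with `t` and `n` the unit
tangent and normal, in terms of any smooth lift `W` of `X`: the vector in `ℂ²` below is taken to
`𝒩 u` by the (complex linear) differential at `W u` of the projection `ℂ² ∖ {0} → CP1`. -/
def invNormalLift (X : ℝ → CP1) (W : ℝ → Fin 2 → ℂ) (u : ℝ) : Fin 2 → ℂ :=
  fsDeriv X (geodCurv X) u ^ (-1 / 2 : ℝ) • (Complex.I • ((fsSpeed X u)⁻¹ • deriv W u))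

/-! ### Cocompact curves, homotopies, and the flow -/

/-- `L`-cocompact curves: admissible, with image invariant under `L`, and no point of it fixed. -/
def IsCocompact (L : Moebius) (X : ℝ → CP1) : Prop :=
  IsAdmissible X ∧ (fun x : CP1 => L • x) '' Set.range X = Set.range X ∧ ∀ u, L • X u ≠ X u

/-- `X` and `Y` are homotopic in the space of `L`-cocompact curves. -/
def Homotopic (L : Moebius) (X Y : ℝ → CP1) : Prop :=
  ∃ H : ℝ → ℝ → CP1, (∃ W, IsSmoothLiftOn (Set.Icc 0 1) W H) ∧
    (∀ σ ∈ Set.Icc (0 : ℝ) 1, IsCocompact L (H σ)) ∧ H 0 = X ∧ H 1 = Y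

/-- The time interval `[0, T)`, where `T = ∞` is allowed. -/
def timeInterval (T : EReal) : Set ℝ := {t | 0 ≤ t ∧ (t : EReal) < T}

/-- The inversive curve lengthening flow `∂_t X = - Q_s 𝒩` on `ℝ × [0, T)`: a smooth family of
admissible curves `X t`, with `X t (u + a) = L (X t u)`.  The equation holds between tangent vectors
of `CP1`; these are written as vectors in `ℂ²` at the point `W t u` of a lift, modulo the kernel
`ℂ • W t u` of the differential of the projection. -/
structure IsInversiveFlow (L : Moebius) (a : ℝ) (T : EReal) (X : ℝ → ℝ → CP1) : Prop where
  admissible : ∀ t ∈ timeInterval T, IsAdmissible (X t)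
  equivariant : ∀ t ∈ timeInterval T, ∀ u, X t (u + a) = L • X t u
  evolution : ∃ W, IsSmoothLiftOn (timeInterval T) W X ∧
    ∀ t ∈ timeInterval T, ∀ u, ∃ μ : ℂ,
      derivWithin (fun τ => W τ u) (timeInterval T) t =
        (-(invDeriv (X t) (fundInv (X t)) u)) • invNormalLift (X t) (W t) u + μ • W t u

end Inversive

end

/-! The estimate uses only the length element ρ du and the invariant Q. Write `'` for ∂_s and P =
Q'''' + 4QQ'' + 2Q'². The flow becomes ∂_t ρ = -½Pρ, ∂_t Q = Q'' + ¼P'' + QP, a parabolic equation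
of order six with leading term ¼Q^{(6)}.

This system comes from the Schwarzian derivative. If a lift W satisfies W_uu = A W + B W_u, then S =
-A + B_u/2 - B²/4 depends neither on the lift nor on a Möbius transformation of the curve. In the
inversive parameter it equals Q + i/2, so that ρ² = 2 Im S in any parameter. If ∂_t W = f W_u modulo
W, then ∂_t S = f_uuu/2 + 2S f_u + S_u f (`hasDerivAt_halfSchwarzian`), and the flow is f = -iQ_s/ρ.

Let E_i = ∫(Q^{(i)})² ds, let K and ℓ₀ be the initial values of E_0 and of the length, and let V be
the variance of Q. The length has derivative E_1 ≥ 0, and E_0 has derivative -D, where D is the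
integral of a sum of squares and D ≥ 2E_1. Hence E_0 ≤ K and length ≥ ℓ₀ for all time; an upper
bound of the length is used only at time zero.

Higher energies: ∂_t E_p = -2E_{p+1} - ½E_{p+3} plus integrals of cubic terms with 2p+4 derivatives
and quartic terms with 2p+2. The E_i are log-convex, so one frequency S controls them: the error
terms are O(E_1(1+S)^{2p+3}), while E_{p+3} ≥ E_1 S^{2p+4}. Absorption gives ∂_t E_p ≤ -¼E_{p+3} + A
E_1 (`exists_integral_densityRate_le`). Keeping the factor E_1 in the error, instead of a constant,
is what makes a bound linear in E_p(0) possible.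

Bound by the initial value: `Profile.variance_rate_le` gives ∂_t V ≤ -E_1 + B V D, and since ∂_t E_0
= -D, the function exp(B E_0) V has derivative at most -E_1. Hence E_p + A exp(B E_0) V is
nonincreasing, and V(0) ≤ ℓ₀^{2p} E_p(0) by the Poincaré inequality.

Smoothing: on a time window of length h = min(1, t) ending at t, with θ the time since its start,
θ^{p+1}E_p is differentiated and E_p is interpolated between E_0 and E_{p+3} at scale θ^{1/3}. This
gives E_p(t) ≤ c₁h^{-p/3} + c₂. -/

noncomputable section

/-! ### Analysis on a single closed curve: integration by parts, Agmon, Poincaré, interpolation. -/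

namespace Inversive

/-! ### Differential polynomials -/

open MvPolynomial in
/-- The total derivative of differential polynomials: `X i` stands for the `i`-th derivative. -/
def totalDeriv : Derivation ℝ (MvPolynomial ℕ ℝ) (MvPolynomial ℕ ℝ) :=
  mkDerivation ℝ fun i => X (i + 1)

open MvPolynomial in
@[simp] lemma totalDeriv_X (i : ℕ) : totalDeriv (X i) = X (i + 1) := by
  simp [totalDeriv]

open MvPolynomial in
@[simp] lemma totalDeriv_C (r : ℝ) : totalDeriv (C r) = 0 := by
  simp [totalDeriv]

/-- Differentiation with respect to the length element `ρ du`. -/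
def arcDeriv (ρ f : ℝ → ℝ) : ℝ → ℝ := fun u => deriv f u / ρ u

/-- A smooth periodic function `Q` on the line with a smooth periodic length element `ρ du`. -/
structure Profile where
  a : ℝ
  ρ : ℝ → ℝ
  Q : ℝ → ℝ
  a_pos : 0 < a
  ρ_smooth : ContDiff ℝ ∞ ρ
  Q_smooth : ContDiff ℝ ∞ Q
  ρ_pos : ∀ u, 0 < ρ u
  ρ_periodic : Function.Periodic ρ a
  Q_periodic : Function.Periodic Q a

lemma contDiff_arcDeriv {ρ f : ℝ → ℝ} (hρ : ContDiff ℝ ∞ ρ) (h0 : ∀ u, 0 < ρ u)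
    (hf : ContDiff ℝ ∞ f) : ContDiff ℝ ∞ (arcDeriv ρ f) :=
  ((contDiff_infty_iff_deriv.1 hf).2).div hρ fun u => (h0 u).ne'

lemma periodic_deriv {f : ℝ → ℝ} {a : ℝ} (hf : Function.Periodic f a) :
    Function.Periodic (deriv f) a := by
  intro u
  rw [← deriv_comp_add_const, hf.funext]

lemma periodic_arcDeriv {ρ f : ℝ → ℝ} {a : ℝ} (hρ : Function.Periodic ρ a)
    (hf : Function.Periodic f a) : Function.Periodic (arcDeriv ρ f) a := by
  intro u
  simp only [arcDeriv, hρ u, periodic_deriv hf u]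

namespace Profile

variable (Λ : Profile)

/-- The `i`-th derivative of `Q`. -/
def jet (i : ℕ) : ℝ → ℝ := (arcDeriv Λ.ρ)^[i] Λ.Q

lemma jet_succ (i : ℕ) : Λ.jet (i + 1) = arcDeriv Λ.ρ (Λ.jet i) := by
  simp only [jet, Function.iterate_succ_apply']

lemma contDiff_jet (i : ℕ) : ContDiff ℝ ∞ (Λ.jet i) := by
  induction i with
  | zero => exact Λ.Q_smooth
  | succ i ih => rw [jet_succ]; exact contDiff_arcDeriv Λ.ρ_smooth Λ.ρ_pos ih

lemma periodic_jet (i : ℕ) : Function.Periodic (Λ.jet i) Λ.a := by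
  induction i with
  | zero => exact Λ.Q_periodic
  | succ i ih => rw [jet_succ]; exact periodic_arcDeriv Λ.ρ_periodic ih

/-- The value of a differential polynomial at a point. -/
def eval (u : ℝ) : MvPolynomial ℕ ℝ →ₐ[ℝ] ℝ := MvPolynomial.aeval fun i => Λ.jet i u

@[simp] lemma eval_X (u : ℝ) (i : ℕ) : Λ.eval u (MvPolynomial.X i) = Λ.jet i u := by
  simp [eval]

@[simp] lemma eval_C (u r : ℝ) : Λ.eval u (MvPolynomial.C r) = r := by
  simp [eval]

lemma hasDerivAt_eval (F : MvPolynomial ℕ ℝ) (u : ℝ) :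
    HasDerivAt (fun v => Λ.eval v F) (Λ.ρ u * Λ.eval u (totalDeriv F)) u := by
  induction F using MvPolynomial.induction_on with
  | C r => simpa using hasDerivAt_const u r
  | add F G hF hG =>
    simp only [map_add, mul_add]
    exact hF.add hG
  | mul_X F i hF =>
    have hi : HasDerivAt (Λ.jet i) (Λ.ρ u * Λ.jet (i + 1) u) u := by
      have := ((Λ.contDiff_jet i).differentiable (by simp) u).hasDerivAt
      rw [jet_succ, arcDeriv, mul_div_cancel₀ _ (Λ.ρ_pos u).ne']
      exact this
    simp only [map_mul, eval_X, Derivation.leibniz, smul_eq_mul, totalDeriv_X, map_add]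
    refine (hF.mul hi).congr_deriv ?_
    ring

lemma continuous_eval (F : MvPolynomial ℕ ℝ) : Continuous fun u => Λ.eval u F :=
  continuous_iff_continuousAt.2 fun u => (Λ.hasDerivAt_eval F u).continuousAt

lemma periodic_eval (F : MvPolynomial ℕ ℝ) : Function.Periodic (fun u => Λ.eval u F) Λ.a := by
  intro u
  simp only [eval]
  congr 2
  funext i
  exact Λ.periodic_jet i u

lemma continuous_ρ : Continuous Λ.ρ := Λ.ρ_smooth.continuous

/-- The integral of a differential polynomial over one period. -/
def integral : MvPolynomial ℕ ℝ →ₗ[ℝ] ℝ where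
  toFun F := ∫ u in (0 : ℝ)..Λ.a, Λ.eval u F * Λ.ρ u
  map_add' F G := by
    rw [← intervalIntegral.integral_add]
    · simp [add_mul]
    · exact ((Λ.continuous_eval F).mul Λ.continuous_ρ).intervalIntegrable _ _
    · exact ((Λ.continuous_eval G).mul Λ.continuous_ρ).intervalIntegrable _ _
  map_smul' r F := by
    simp [mul_assoc]

lemma integral_apply (F : MvPolynomial ℕ ℝ) :
    Λ.integral F = ∫ u in (0 : ℝ)..Λ.a, Λ.eval u F * Λ.ρ u := rfl

lemma integral_congr {F G : MvPolynomial ℕ ℝ} (h : ∀ u, Λ.eval u F = Λ.eval u G) :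
    Λ.integral F = Λ.integral G := by
  simp only [integral_apply, h]

-- Periodicity kills the boundary terms. Every integration by parts below consists in exhibiting a
-- total derivative and applying this.
@[simp] lemma integral_totalDeriv (F : MvPolynomial ℕ ℝ) : Λ.integral (totalDeriv F) = 0 := by
  rw [integral_apply, intervalIntegral.integral_eq_sub_of_hasDerivAt (f := fun v => Λ.eval v F)]
  · simpa using (sub_eq_zero.2 (Λ.periodic_eval F 0))
  · intro u _
    simpa [mul_comm] using Λ.hasDerivAt_eval F u
  · exact ((Λ.continuous_eval _).mul Λ.continuous_ρ).intervalIntegrable _ _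

lemma integral_mono {F G : MvPolynomial ℕ ℝ}
    (h : ∀ u ∈ Set.Icc 0 Λ.a, Λ.eval u F ≤ Λ.eval u G) :
    Λ.integral F ≤ Λ.integral G := by
  simp only [integral_apply]
  refine intervalIntegral.integral_mono_on Λ.a_pos.le ?_ ?_ fun u hu =>
    mul_le_mul_of_nonneg_right (h u hu) (Λ.ρ_pos u).le
  · exact ((Λ.continuous_eval _).mul Λ.continuous_ρ).intervalIntegrable _ _
  · exact ((Λ.continuous_eval _).mul Λ.continuous_ρ).intervalIntegrable _ _

lemma integral_nonneg {F : MvPolynomial ℕ ℝ} (h : ∀ u, 0 ≤ Λ.eval u F) : 0 ≤ Λ.integral F := by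
  simpa using Λ.integral_mono (F := 0) (G := F) fun u _ => by simpa using h u

lemma integral_sq_nonneg (F : MvPolynomial ℕ ℝ) : 0 ≤ Λ.integral (F ^ 2) :=
  Λ.integral_nonneg fun u => by rw [map_pow]; positivity

/-- The length of a period. -/
def length : ℝ := Λ.integral 1

lemma length_pos : 0 < Λ.length := by
  simp only [length, integral_apply, map_one, one_mul]
  exact intervalIntegral.intervalIntegral_pos_of_pos (Λ.continuous_ρ.intervalIntegrable _ _)
    Λ.ρ_pos Λ.a_pos

/-- The weighted Cauchy-Schwarz inequality for continuous functions. -/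
lemma cauchy_schwarz {f g : ℝ → ℝ} (hf : Continuous f) (hg : Continuous g) :
    (∫ u in (0 : ℝ)..Λ.a, f u * g u * Λ.ρ u) ^ 2 ≤
      (∫ u in (0 : ℝ)..Λ.a, f u ^ 2 * Λ.ρ u) * ∫ u in (0 : ℝ)..Λ.a, g u ^ 2 * Λ.ρ u := by
  have hρ := Λ.continuous_ρ
  -- The quadratic in x is ∫(x f + g)² ρ du; nonnegativity bounds its discriminant.
  have key : ∀ x : ℝ, 0 ≤ (∫ u in (0 : ℝ)..Λ.a, f u ^ 2 * Λ.ρ u) * (x * x) +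
      (2 * ∫ u in (0 : ℝ)..Λ.a, f u * g u * Λ.ρ u) * x +
        ∫ u in (0 : ℝ)..Λ.a, g u ^ 2 * Λ.ρ u := by
    intro x
    have h0 : 0 ≤ ∫ u in (0 : ℝ)..Λ.a, (f u * x + g u) ^ 2 * Λ.ρ u :=
      intervalIntegral.integral_nonneg Λ.a_pos.le fun u _ =>
        mul_nonneg (sq_nonneg _) (Λ.ρ_pos u).le
    have h1 : (∫ u in (0 : ℝ)..Λ.a, (f u * x + g u) ^ 2 * Λ.ρ u) =
        ∫ u in (0 : ℝ)..Λ.a, ((x * x) * (f u ^ 2 * Λ.ρ u) + (2 * x) * (f u * g u * Λ.ρ u)) +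
          g u ^ 2 * Λ.ρ u := by
      congr 1
      funext u
      ring
    rw [h1, intervalIntegral.integral_add, intervalIntegral.integral_add,
      intervalIntegral.integral_const_mul, intervalIntegral.integral_const_mul] at h0
    · linarith
    all_goals exact Continuous.intervalIntegrable (by fun_prop) _ _
  have := discrim_le_zero key
  rw [discrim] at this
  nlinarith

lemma integral_mul_sq_le (F G : MvPolynomial ℕ ℝ) :
    Λ.integral (F * G) ^ 2 ≤ Λ.integral (F ^ 2) * Λ.integral (G ^ 2) := by
  simpa only [integral_apply, map_mul, map_pow] using
    Λ.cauchy_schwarz (Λ.continuous_eval F) (Λ.continuous_eval G)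

/-- `∫ |F G| ds`. -/
lemma integral_abs_mul_le (F G : MvPolynomial ℕ ℝ) :
    (∫ u in (0 : ℝ)..Λ.a, |Λ.eval u F * Λ.eval u G| * Λ.ρ u) ≤
      √(Λ.integral (F ^ 2)) * √(Λ.integral (G ^ 2)) := by
  rw [← Real.sqrt_mul (Λ.integral_sq_nonneg F)]
  apply Real.le_sqrt_of_sq_le
  simpa only [integral_apply, map_pow, abs_mul, sq_abs] using
    Λ.cauchy_schwarz (Λ.continuous_eval F).abs (Λ.continuous_eval G).abs

lemma abs_integral_le (F : MvPolynomial ℕ ℝ) {x y : ℝ} (hx : x ∈ Set.Icc 0 Λ.a)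
    (hy : y ∈ Set.Icc 0 Λ.a) :
    |Λ.eval x F - Λ.eval y F| ≤ ∫ u in (0 : ℝ)..Λ.a, |Λ.eval u (totalDeriv F)| * Λ.ρ u := by
  have hc : Continuous fun u => Λ.eval u (totalDeriv F) * Λ.ρ u :=
    (Λ.continuous_eval _).mul Λ.continuous_ρ
  have h1 : Λ.eval x F - Λ.eval y F = ∫ u in y..x, Λ.eval u (totalDeriv F) * Λ.ρ u := by
    rw [intervalIntegral.integral_eq_sub_of_hasDerivAt (f := fun v => Λ.eval v F)]
    · intro u _
      simpa [mul_comm] using Λ.hasDerivAt_eval F u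
    · exact hc.intervalIntegrable _ _
  have h2 : ∀ u, |Λ.eval u (totalDeriv F) * Λ.ρ u| = |Λ.eval u (totalDeriv F)| * Λ.ρ u :=
    fun u => by rw [abs_mul, abs_of_pos (Λ.ρ_pos u)]
  have hn : ∀ u, 0 ≤ |Λ.eval u (totalDeriv F)| * Λ.ρ u := fun u =>
    mul_nonneg (abs_nonneg _) (Λ.ρ_pos u).le
  have hci : ∀ x y, IntervalIntegrable (fun u => |Λ.eval u (totalDeriv F)| * Λ.ρ u)
      MeasureTheory.volume x y := fun x y =>
    ((Λ.continuous_eval _).abs.mul Λ.continuous_ρ).intervalIntegrable _ _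
  rw [h1]
  rcases le_total y x with h | h
  · refine (intervalIntegral.abs_integral_le_integral_abs h).trans ?_
    simp only [h2]
    exact intervalIntegral.integral_mono_interval hy.1 h hx.2
      (Filter.Eventually.of_forall hn) (hci _ _)
  · rw [intervalIntegral.integral_symm, abs_neg]
    refine (intervalIntegral.abs_integral_le_integral_abs h).trans ?_
    simp only [h2]
    exact intervalIntegral.integral_mono_interval hx.1 h hy.2
      (Filter.Eventually.of_forall hn) (hci _ _)

/-- The Agmon inequality on a closed curve. -/
lemma eval_sq_le (F : MvPolynomial ℕ ℝ) {x : ℝ} (hx : x ∈ Set.Icc 0 Λ.a) :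
    Λ.eval x F ^ 2 ≤ Λ.integral (F ^ 2) / Λ.length +
      2 * (√(Λ.integral (F ^ 2)) * √(Λ.integral (totalDeriv F ^ 2))) := by
  set B := 2 * (√(Λ.integral (F ^ 2)) * √(Λ.integral (totalDeriv F ^ 2))) with hB
  -- The oscillation of F² is at most ∫|(F²)'| ds = 2∫|F F'| ds.
  have h1 : ∀ y ∈ Set.Icc 0 Λ.a, Λ.eval x F ^ 2 ≤ Λ.eval y F ^ 2 + B := by
    intro y hy
    have h := Λ.abs_integral_le (F ^ 2) hx hy
    have h2 : (∫ u in (0 : ℝ)..Λ.a, |Λ.eval u (totalDeriv (F ^ 2))| * Λ.ρ u) ≤ B := by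
      rw [hB]
      refine le_trans (le_of_eq ?_)
        (mul_le_mul_of_nonneg_left (Λ.integral_abs_mul_le F (totalDeriv F)) zero_le_two)
      rw [← intervalIntegral.integral_const_mul]
      congr 1
      funext u
      simp [abs_mul, Derivation.leibniz_pow, map_ofNat]
      ring
    have := (le_abs_self _).trans (h.trans h2)
    simp only [map_pow] at this
    linarith
  -- Averaging over y replaces the unknown value at y by ∫F² ds divided by the length.
  have h3 : Λ.eval x F ^ 2 * Λ.length ≤ Λ.integral (F ^ 2) + B * Λ.length := by
    have e : ∀ r : ℝ, r * Λ.length = ∫ u in (0 : ℝ)..Λ.a, r * Λ.ρ u := by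
      intro r
      simp [length, integral_apply]
    rw [e, e, integral_apply, ← intervalIntegral.integral_add]
    · refine intervalIntegral.integral_mono_on Λ.a_pos.le ?_ ?_ fun u hu => ?_
      · exact (continuous_const.mul Λ.continuous_ρ).intervalIntegrable _ _
      · exact (((Λ.continuous_eval _).mul Λ.continuous_ρ).add
          (continuous_const.mul Λ.continuous_ρ)).intervalIntegrable _ _
      · rw [← add_mul, map_pow]
        exact mul_le_mul_of_nonneg_right (h1 u hu) (Λ.ρ_pos u).le
    · exact ((Λ.continuous_eval _).mul Λ.continuous_ρ).intervalIntegrable _ _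
    · exact (continuous_const.mul Λ.continuous_ρ).intervalIntegrable _ _
  have hl := Λ.length_pos
  rw [div_add' _ _ _ hl.ne', le_div_iff₀ hl]
  exact h3

/-- The Poincaré inequality on a closed curve. -/
lemma integral_sq_le_of_integral_eq_zero {F : MvPolynomial ℕ ℝ} (hF : Λ.integral F = 0) :
    Λ.integral (F ^ 2) ≤ Λ.length ^ 2 * Λ.integral (totalDeriv F ^ 2) := by
  have hl := Λ.length_pos
  set B := √Λ.length * √(Λ.integral (totalDeriv F ^ 2)) with hB
  have hBsq : B ^ 2 = Λ.length * Λ.integral (totalDeriv F ^ 2) := by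
    rw [hB, mul_pow, Real.sq_sqrt hl.le, Real.sq_sqrt (Λ.integral_sq_nonneg _)]
  have h1 : ∀ x ∈ Set.Icc 0 Λ.a, ∀ y ∈ Set.Icc 0 Λ.a, Λ.eval x F - Λ.eval y F ≤ B := by
    intro x hx y hy
    refine (le_abs_self _).trans ((Λ.abs_integral_le F hx hy).trans ?_)
    have := Λ.integral_abs_mul_le 1 (totalDeriv F)
    simpa [length, hB] using this
  -- As F has mean zero, averaging the oscillation bound over y turns it into a bound for F itself.
  have h2 : ∀ x ∈ Set.Icc 0 Λ.a, Λ.eval x F ≤ B ∧ -B ≤ Λ.eval x F := by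
    intro x hx
    have m1 : Λ.integral (MvPolynomial.C (Λ.eval x F - B)) ≤ Λ.integral F := by
      simp only [integral_apply, eval_C]
      refine intervalIntegral.integral_mono_on Λ.a_pos.le ?_ ?_ fun u hu =>
        mul_le_mul_of_nonneg_right (by linarith [h1 x hx u hu]) (Λ.ρ_pos u).le
      · exact (continuous_const.mul Λ.continuous_ρ).intervalIntegrable _ _
      · exact ((Λ.continuous_eval _).mul Λ.continuous_ρ).intervalIntegrable _ _
    have m2 : Λ.integral F ≤ Λ.integral (MvPolynomial.C (Λ.eval x F + B)) := by
      simp only [integral_apply, eval_C]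
      refine intervalIntegral.integral_mono_on Λ.a_pos.le ?_ ?_ fun u hu =>
        mul_le_mul_of_nonneg_right (by linarith [h1 u hu x hx]) (Λ.ρ_pos u).le
      · exact ((Λ.continuous_eval _).mul Λ.continuous_ρ).intervalIntegrable _ _
      · exact (continuous_const.mul Λ.continuous_ρ).intervalIntegrable _ _
    have e : ∀ r : ℝ, Λ.integral (MvPolynomial.C r) = r * Λ.length := by
      intro r
      simp [length, integral_apply]
    rw [e, hF] at m1 m2
    constructor
    · by_contra! hcon
      nlinarith [mul_pos (sub_pos.2 hcon) hl]
    · by_contra! hcon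
      nlinarith [mul_pos (sub_pos.2 hcon) hl]
  have h3 : Λ.integral (F ^ 2) ≤ Λ.integral (MvPolynomial.C (B ^ 2)) := by
    simp only [integral_apply, eval_C, map_pow]
    refine intervalIntegral.integral_mono_on Λ.a_pos.le ?_ ?_ fun u hu =>
      mul_le_mul_of_nonneg_right (sq_le_sq' (h2 u hu).2 (h2 u hu).1) (Λ.ρ_pos u).le
    · exact (((Λ.continuous_eval _).pow 2).mul Λ.continuous_ρ).intervalIntegrable _ _
    · exact (continuous_const.mul Λ.continuous_ρ).intervalIntegrable _ _
  have e : Λ.integral (MvPolynomial.C (B ^ 2)) = B ^ 2 * Λ.length := by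
    simp [length, integral_apply]
  rw [e, hBsq] at h3
  linarith

/-- `∫ (Q^{(i)})² ds`. -/
def sobolev (i : ℕ) : ℝ := Λ.integral (MvPolynomial.X i ^ 2)

lemma sobolev_nonneg (i : ℕ) : 0 ≤ Λ.sobolev i := Λ.integral_sq_nonneg _

/-- One integration by parts and Cauchy-Schwarz. All interpolation between the energies rests on
this log-convexity. -/
lemma sobolev_logConvex (i : ℕ) :
    Λ.sobolev (i + 1) ^ 2 ≤ Λ.sobolev i * Λ.sobolev (i + 2) := by
  have h := Λ.integral_totalDeriv (MvPolynomial.X i * MvPolynomial.X (i + 1))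
  have e : totalDeriv (MvPolynomial.X i * MvPolynomial.X (i + 1)) =
      MvPolynomial.X i * MvPolynomial.X (i + 2) + MvPolynomial.X (i + 1) ^ 2 := by
    simp [Derivation.leibniz, pow_two]
  rw [e, map_add] at h
  have : Λ.sobolev (i + 1) = -Λ.integral (MvPolynomial.X i * MvPolynomial.X (i + 2)) := by
    rw [sobolev]; linarith
  rw [this, neg_sq]
  exact Λ.integral_mul_sq_le _ _

/-- For i ≥ 1 the function Q^{(i)} is a derivative and has mean zero, so the Poincaré inequality
applies. -/
lemma sobolev_le_succ {i : ℕ} (hi : 1 ≤ i) :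
    Λ.sobolev i ≤ Λ.length ^ 2 * Λ.sobolev (i + 1) := by
  obtain ⟨j, rfl⟩ := Nat.exists_eq_add_of_le' hi
  have h : Λ.integral (MvPolynomial.X (j + 1)) = 0 := by
    rw [← totalDeriv_X, integral_totalDeriv]
  simpa [sobolev] using Λ.integral_sq_le_of_integral_eq_zero h

end Profile

/-! ### Log-convex sequences -/

/-- A log-convex sequence has no interior peak: once it increases strictly, it increases strictly
ever after. Zero terms are allowed, hence the argument avoids logarithms. -/
lemma logConvex_le_max {g : ℕ → ℝ} (h0 : ∀ i, 0 ≤ g i)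
    (hg : ∀ i, g (i + 1) ^ 2 ≤ g i * g (i + 2)) {i N : ℕ} (hi : i ≤ N) :
    g i ≤ max (g 0) (g N) := by
  have step : ∀ j, g j < g (j + 1) → g (j + 1) < g (j + 2) := by
    intro j hj
    have h1 : 0 < g (j + 1) := (h0 j).trans_lt hj
    by_contra! hcon
    have : g j * g (j + 2) ≤ g j * g (j + 1) := mul_le_mul_of_nonneg_left hcon (h0 j)
    nlinarith [hg j, mul_pos (sub_pos.2 hj) h1]
  have up : ∀ j, g j < g (j + 1) → ∀ k, g (j + k) < g (j + k + 1) := by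
    intro j hj k
    induction k with
    | zero => exact hj
    | succ k ih => exact step _ ih
  by_contra! hcon
  obtain ⟨h1, h2⟩ := max_lt_iff.1 hcon
  have : ∃ j < i, g j < g (j + 1) := by
    by_contra! hno
    have : ∀ k ≤ i, g k ≤ g 0 := by
      intro k hk
      induction k with
      | zero => exact le_rfl
      | succ k ih => exact (hno k hk).trans (ih (by omega))
    exact absurd (this i le_rfl) (not_le.2 h1)
  obtain ⟨j, hji, hj⟩ := this
  have mono : ∀ k, g i ≤ g (i + k) := by
    intro k
    induction k with
    | zero => exact le_rfl
    | succ k ih =>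
      have := up j hj (i + k - j)
      rw [show j + (i + k - j) = i + k by omega] at this
      exact ih.trans this.le
  have := mono (N - i)
  rw [Nat.add_sub_cancel' hi] at this
  exact absurd this (not_le.2 h2)

/-- Interpolation between the ends of a log-convex sequence. -/
lemma logConvex_interpolation {e : ℕ → ℝ} (h0 : ∀ i, 0 ≤ e i)
    (he : ∀ i, e (i + 1) ^ 2 ≤ e i * e (i + 2)) {i N : ℕ} (hi : i ≤ N) {y : ℝ} (hy : 0 < y) :
    e i ≤ y ^ (N - i) * e N + (y ^ i)⁻¹ * e 0 := by
  -- Multiplication by y^i preserves log-convexity; y sets the scale of the interpolation.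
  have h := logConvex_le_max (g := fun i => y ^ i * e i) (fun i => mul_nonneg (by positivity) (h0 i))
    (fun i => by
      have := mul_le_mul_of_nonneg_left (he i) (by positivity : 0 ≤ (y ^ (i + 1)) ^ 2)
      calc _ = (y ^ (i + 1)) ^ 2 * e (i + 1) ^ 2 := by ring
        _ ≤ _ := this
        _ = _ := by ring) hi
  have h2 : y ^ i * e i ≤ e 0 + y ^ N * e N := by
    refine h.trans (max_le ?_ ?_)
    · have := mul_nonneg (pow_nonneg hy.le N) (h0 N)
      simpa using this
    · have := h0 0
      simpa using this
  have hyi : 0 < y ^ i := by positivity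
  calc e i = (y ^ i)⁻¹ * (y ^ i * e i) := by field_simp
    _ ≤ (y ^ i)⁻¹ * (e 0 + y ^ N * e N) := by gcongr
    _ = _ := by
      rw [← Nat.sub_add_cancel hi, pow_add]
      simp only [Nat.add_sub_cancel]
      field_simp
      ring

/-- A log-convex sequence is dominated by the geometric sequence through two of its terms. -/
lemma logConvex_exists_ratio {e : ℕ → ℝ} (h0 : ∀ i, 0 ≤ e i)
    (he : ∀ i, e (i + 1) ^ 2 ≤ e i * e (i + 2)) {N : ℕ} (hN : 2 ≤ N) :
    ∃ S : ℝ, 0 ≤ S ∧ (∀ i ≤ N, e i ≤ e 0 * S ^ (2 * i)) ∧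
      (∀ i, 1 ≤ i → i ≤ N → e i ≤ e 1 * S ^ (2 * (i - 1))) ∧ e 1 * S ^ (2 * (N - 1)) ≤ e N := by
  -- If the term of index 1 vanishes, log-convexity makes all later terms vanish, and S = 0 serves
  -- with the convention 0^0 = 1.
  rcases (h0 1).eq_or_lt with h1 | h1
  · have hz : ∀ i, e (i + 1) = 0 := by
      intro i
      induction i with
      | zero => exact h1.symm
      | succ i ih =>
        have := he (i + 1)
        rw [ih, zero_mul] at this
        exact pow_eq_zero_iff two_ne_zero |>.1 (le_antisymm this (sq_nonneg _))
    refine ⟨0, le_rfl, ?_, ?_, ?_⟩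
    · rintro (_ | i) _
      · simp
      · rw [hz]; simp
    · rintro (_ | i) hi _
      · omega
      · rw [hz, ← h1]; simp
    · rw [← h1]; simpa using h0 N
  · obtain ⟨M, rfl⟩ := Nat.exists_eq_add_of_le' (show 1 ≤ N by omega)
    have hM : M ≠ 0 := by omega
    -- S² is the ratio of the geometric sequence through the terms of index 1 and N = M + 1.
    set S : ℝ := √((e (M + 1) / e 1) ^ ((M : ℝ)⁻¹)) with hS
    have hx : 0 ≤ e (M + 1) / e 1 := div_nonneg (h0 _) h1.le
    have hSM : S ^ (2 * M) = e (M + 1) / e 1 := by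
      rw [pow_mul, hS, Real.sq_sqrt (Real.rpow_nonneg hx _), Real.rpow_inv_natCast_pow hx hM]
    have hend : e 1 * S ^ (2 * M) = e (M + 1) := by
      rw [hSM, mul_div_cancel₀ _ h1.ne']
    have hS0 : 0 < S := by
      have hpos : ∀ i, 0 < e (i + 1) := by
        intro i
        induction i with
        | zero => exact h1
        | succ i ih =>
          have := he i
          by_contra! hcon
          have h3 := he (i + 1)
          have h4 : e (i + 2) = 0 := le_antisymm hcon (h0 _)
          rw [h4] at this
          nlinarith [pow_pos ih 2]
      rw [hS]
      exact Real.sqrt_pos.2 (Real.rpow_pos_of_pos (div_pos (hpos M) h1) _)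
    have hmid : ∀ i, 1 ≤ i → i ≤ M + 1 → e i ≤ e 1 * S ^ (2 * (i - 1)) := by
      intro i hi hiM
      obtain ⟨j, rfl⟩ := Nat.exists_eq_add_of_le' hi
      -- Divided by this geometric sequence, the terms from index 1 on stay log-convex and have
      -- equal end values, so nothing between exceeds them.
      have h := logConvex_le_max (g := fun i => e (i + 1) * (S ^ (2 * i))⁻¹) (i := j) (N := M)
        (fun i => mul_nonneg (h0 _) (by positivity))
        (fun i => by
          have := mul_le_mul_of_nonneg_left (he (i + 1))
            (by positivity : 0 ≤ ((S ^ (2 * (i + 1)))⁻¹) ^ 2)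
          calc _ = ((S ^ (2 * (i + 1)))⁻¹) ^ 2 * e (i + 1 + 1) ^ 2 := by ring
            _ ≤ _ := this
            _ = _ := by
              field_simp
              ring) (by omega)
      have hg : e (M + 1) * (S ^ (2 * M))⁻¹ = e 1 := by
        rw [← hend]; field_simp
      simp only [hg, zero_add, mul_zero, pow_zero, inv_one, mul_one, max_self] at h
      have hp : 0 < S ^ (2 * j) := by positivity
      rwa [← div_eq_mul_inv, div_le_iff₀ hp] at h
    refine ⟨S, hS0.le, ?_, hmid, hend.le⟩
    -- From e₁² ≤ e₀e₂ ≤ e₀e₁S²; it brings the term of index 0 into the comparison.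
    have h01 : e 1 ≤ e 0 * S ^ 2 := by
      have h2 := hmid 2 (by omega) (by omega)
      have h3 : e 1 ^ 2 ≤ e 0 * (e 1 * S ^ 2) := (he 0).trans
        (mul_le_mul_of_nonneg_left (by simpa using h2) (h0 0))
      nlinarith
    rintro (_ | i) hi
    · simp
    · refine (hmid (i + 1) (by omega) hi).trans ?_
      rw [show 2 * (i + 1) = 2 + 2 * i by ring, pow_add, ← mul_assoc, Nat.add_sub_cancel]
      exact mul_le_mul_of_nonneg_right h01 (by positivity)

end Inversive

end

/-! ### The energy inequality for ∫(Q^{(p)})² ds: structure of the error terms and their absorption.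
-/

noncomputable section

namespace Inversive

/-! ### Graded pieces of the ring of differential polynomials -/

open MvPolynomial (X C)

/-- The span of the monomials of degree `d` with `n` derivatives in total. -/
def homog (d n : ℕ) : Submodule ℝ (MvPolynomial ℕ ℝ) :=
  Submodule.span ℝ {F | ∃ s : Multiset ℕ, s.card = d ∧ s.sum = n ∧ F = (s.map X).prod}

lemma X_mem_homog (i : ℕ) : (X i : MvPolynomial ℕ ℝ) ∈ homog 1 i :=
  Submodule.subset_span ⟨{i}, by simp⟩

lemma mul_mem_homog {d d' n n' e m : ℕ} {F G : MvPolynomial ℕ ℝ} (hF : F ∈ homog d n)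
    (hG : G ∈ homog d' n') (he : d + d' = e) (hm : n + n' = m) : F * G ∈ homog e m := by
  subst he hm
  have h := Submodule.mul_mem_mul hF hG
  rw [homog, homog, Submodule.span_mul_span] at h
  refine Submodule.span_mono ?_ h
  rintro _ ⟨_, ⟨s, hs, hs', rfl⟩, _, ⟨t, ht, ht', rfl⟩, rfl⟩
  exact ⟨s + t, by simp [hs, ht], by simp [hs', ht'], by simp⟩

lemma C_mul_mem {M : Submodule ℝ (MvPolynomial ℕ ℝ)} (r : ℝ) {F : MvPolynomial ℕ ℝ}
    (hF : F ∈ M) : C r * F ∈ M := by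
  rw [← MvPolynomial.smul_eq_C_mul]
  exact M.smul_mem r hF

lemma totalDeriv_mem_homog {d n : ℕ} {F : MvPolynomial ℕ ℝ} (hF : F ∈ homog d n) :
    totalDeriv F ∈ homog d (n + 1) := by
  induction hF using Submodule.span_induction with
  | zero => simp
  | add F G _ _ hF hG => rw [map_add]; exact add_mem hF hG
  | smul r F _ hF => rw [Derivation.map_smul]; exact Submodule.smul_mem _ r hF
  | mem F h =>
    obtain ⟨s, rfl, rfl, rfl⟩ := h
    induction s using Multiset.induction_on with
    | empty => simp
    | cons i s ih =>
      simp only [Multiset.map_cons, Multiset.prod_cons, Derivation.leibniz, smul_eq_mul,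
        totalDeriv_X]
      refine add_mem ?_ ?_
      · exact mul_mem_homog (X_mem_homog i) ih (by simp [add_comm]) (by simp [add_assoc])
      · refine Submodule.subset_span ⟨(i + 1) ::ₘ s, by simp, by simp; ring, ?_⟩
        simp [mul_comm]

lemma homog_three_le {M : Submodule ℝ (MvPolynomial ℕ ℝ)} {n : ℕ}
    (h : ∀ i j k, i + j + k = n → (X i * X j * X k : MvPolynomial ℕ ℝ) ∈ M) : homog 3 n ≤ M := by
  refine Submodule.span_le.2 ?_
  rintro _ ⟨s, hs, hs', rfl⟩
  obtain ⟨i, j, k, rfl⟩ := Multiset.card_eq_three.1 hs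
  simpa [mul_assoc] using h i j k (by simpa [add_assoc] using hs')

lemma homog_four_le {M : Submodule ℝ (MvPolynomial ℕ ℝ)} {n : ℕ}
    (h : ∀ i j k l, i + j + k + l = n → (X i * X j * X k * X l : MvPolynomial ℕ ℝ) ∈ M) :
    homog 4 n ≤ M := by
  refine Submodule.span_le.2 ?_
  rintro _ ⟨s, hs, hs', rfl⟩
  obtain ⟨i, j, k, l, rfl⟩ := Multiset.card_eq_four.1 hs
  simpa [mul_assoc] using h i j k l (by simpa [add_assoc] using hs')

/-! ### The evolution equations as differential polynomials -/

/-- Along the flow the length element satisfies `∂_t ρ = - (lengthRate / 2) ρ`. -/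
def lengthRate : MvPolynomial ℕ ℝ := X 4 + (C 4 * (X 0 * X 2) + C 2 * (X 1 * X 1))

/-- The time derivative of the `p`-th derivative of the fundamental invariant. -/
def jetRate : ℕ → MvPolynomial ℕ ℝ
  | 0 => X 2 + C (1 / 4) * totalDeriv (totalDeriv lengthRate) + X 0 * lengthRate
  | p + 1 => totalDeriv (jetRate p) + C (1 / 2) * (lengthRate * X (p + 1))

/-- The time derivative of a differential polynomial. -/
def timeDeriv : Derivation ℝ (MvPolynomial ℕ ℝ) (MvPolynomial ℕ ℝ) :=
  MvPolynomial.mkDerivation ℝ jetRate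

@[simp] lemma timeDeriv_X (i : ℕ) : timeDeriv (X i) = jetRate i := by
  simp [timeDeriv]

/-- The density of the time derivative of the integral of a differential polynomial. -/
def densityRate (F : MvPolynomial ℕ ℝ) : MvPolynomial ℕ ℝ :=
  timeDeriv F - C (1 / 2) * (lengthRate * F)

lemma lengthRate_sub_mem : lengthRate - X 4 ∈ homog 2 2 := by
  rw [lengthRate, add_sub_cancel_left]
  exact add_mem (C_mul_mem _ (mul_mem_homog (X_mem_homog 0) (X_mem_homog 2) rfl rfl))
    (C_mul_mem _ (mul_mem_homog (X_mem_homog 1) (X_mem_homog 1) rfl rfl))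

/-- Count weight 2 for Q and 1 for each ∂_s. Then P has weight 6, and all terms of ∂_t Q^{(p)} have
weight p+8, except Q^{(p+2)}, which comes from the constant i/2. A quadratic term thus carries p+4
derivatives and a cubic one p+2. -/
lemma jetRate_sub_mem (p : ℕ) :
    jetRate p - (X (p + 2) + C (1 / 4) * X (p + 6)) ∈ homog 2 (p + 4) ⊔ homog 3 (p + 2) := by
  have hL := lengthRate_sub_mem
  induction p with
  | zero =>
    have e : jetRate 0 - (X (0 + 2) + C (1 / 4) * X (0 + 6)) =
        (C (1 / 4) * totalDeriv (totalDeriv (lengthRate - X 4)) + X 0 * X 4) +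
          X 0 * (lengthRate - X 4) := by
      simp [jetRate]
      ring
    rw [e]
    refine add_mem (Submodule.mem_sup_left (add_mem (C_mul_mem _ ?_) ?_))
      (Submodule.mem_sup_right ?_)
    · exact totalDeriv_mem_homog (totalDeriv_mem_homog hL)
    · exact mul_mem_homog (X_mem_homog 0) (X_mem_homog 4) rfl rfl
    · exact mul_mem_homog (X_mem_homog 0) hL rfl rfl
  | succ p ih =>
    have e : jetRate (p + 1) - (X (p + 1 + 2) + C (1 / 4) * X (p + 1 + 6)) =
        totalDeriv (jetRate p - (X (p + 2) + C (1 / 4) * X (p + 6))) +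
          (C (1 / 2) * (X 4 * X (p + 1)) + C (1 / 2) * ((lengthRate - X 4) * X (p + 1))) := by
      simp [jetRate]
      ring
    rw [e]
    refine add_mem ?_ (add_mem (Submodule.mem_sup_left (C_mul_mem _ ?_))
      (Submodule.mem_sup_right (C_mul_mem _ ?_)))
    · obtain ⟨F, hF, G, hG, h⟩ := Submodule.mem_sup.1 ih
      rw [← h, map_add]
      exact Submodule.add_mem_sup (totalDeriv_mem_homog hF) (totalDeriv_mem_homog hG)
    · exact mul_mem_homog (X_mem_homog 4) (X_mem_homog _) rfl (by omega)
    · exact mul_mem_homog hL (X_mem_homog _) rfl (by omega)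

/-- The factor 2Q^{(p)} raises each degree by one and adds p derivatives; the change -½P of the
length element contributes terms of the same two types. -/
lemma densityRate_sub_mem (p : ℕ) :
    densityRate (X p ^ 2) - (C 2 * (X p * X (p + 2)) + C (1 / 2) * (X p * X (p + 6))) ∈
      homog 3 (2 * p + 4) ⊔ homog 4 (2 * p + 2) := by
  have hL := lengthRate_sub_mem
  obtain ⟨F, hF, G, hG, h⟩ := Submodule.mem_sup.1 (jetRate_sub_mem p)
  have hh : jetRate p = X (p + 2) + C (1 / 4) * X (p + 6) + (F + G) := by
    rw [h]; ring
  have e : densityRate (X p ^ 2) -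
      (C 2 * (X p * X (p + 2)) + C (1 / 2) * (X p * X (p + 6))) =
      (C 2 * (X p * F) + C (-1 / 2) * (X 4 * (X p * X p))) +
        (C 2 * (X p * G) + C (-1 / 2) * ((lengthRate - X 4) * (X p * X p))) := by
    rw [densityRate, pow_two, Derivation.leibniz, timeDeriv_X, hh]
    simp only [smul_eq_mul, show (-1 / 2 : ℝ) = -(1 / 2) by norm_num, map_neg,
      show (C 2 : MvPolynomial ℕ ℝ) = 2 by exact map_ofNat C 2,
      show (C (1 / 2) : MvPolynomial ℕ ℝ) = 2 * C (1 / 4) by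
        rw [← map_ofNat (C : ℝ →+* MvPolynomial ℕ ℝ) 2, ← map_mul]; norm_num]
    ring
  rw [e]
  have h1 : (X p * X p : MvPolynomial ℕ ℝ) ∈ homog 2 (p + p) :=
    mul_mem_homog (X_mem_homog p) (X_mem_homog p) rfl rfl
  refine Submodule.add_mem_sup (add_mem (C_mul_mem _ ?_) (C_mul_mem _ ?_))
    (add_mem (C_mul_mem _ ?_) (C_mul_mem _ ?_))
  · exact mul_mem_homog (X_mem_homog p) hF rfl (by omega)
  · exact mul_mem_homog (X_mem_homog 4) h1 rfl (by omega)
  · exact mul_mem_homog (X_mem_homog p) hG rfl (by omega)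
  · exact mul_mem_homog hL h1 rfl (by omega)

/-! ### Estimates for integrals of differential polynomials -/

/-- The derivatives of `Q` up to order `N` are controlled by powers of the frequency `S`. -/
structure Profile.Scaled (Λ : Profile) (N : ℕ) (K ℓ₀ S : ℝ) : Prop where
  nonneg : 0 ≤ S
  length_ge : ℓ₀ ≤ Λ.length
  le_zero : ∀ i ≤ N, Λ.sobolev i ≤ K * S ^ (2 * i)
  le_one : ∀ i, 1 ≤ i → i ≤ N → Λ.sobolev i ≤ Λ.sobolev 1 * S ^ (2 * (i - 1))

/-- Agmon's inequality between E_i and E_{i+1} gives the order S^{i+1/2} at high frequency; the half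
power is rounded up to a factor 1 + S, which the later absorption can afford. -/
lemma Profile.Scaled.abs_jet_le {Λ : Profile} {N : ℕ} {K ℓ₀ S : ℝ} (h : Λ.Scaled N K ℓ₀ S)
    (hℓ : 0 < ℓ₀) (hK : 0 ≤ K) {i : ℕ} (hi : i + 1 ≤ N) {u : ℝ} (hu : u ∈ Set.Icc 0 Λ.a) :
    |Λ.jet i u| ≤ √(K / ℓ₀ + 2 * K) * (S ^ i * (1 + S)) := by
  have hS := h.nonneg
  have h1 := Λ.eval_sq_le (X i) hu
  rw [Λ.eval_X, totalDeriv_X] at h1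
  change _ ≤ Λ.sobolev i / _ + 2 * (√(Λ.sobolev i) * √(Λ.sobolev (i + 1))) at h1
  have h2 : √(Λ.sobolev i) ≤ √K * S ^ i := by
    apply Real.sqrt_le_iff.2 ⟨by positivity, ?_⟩
    rw [mul_pow, Real.sq_sqrt hK, ← pow_mul, mul_comm i]
    exact h.le_zero i (by omega)
  have h3 : √(Λ.sobolev (i + 1)) ≤ √K * S ^ (i + 1) := by
    apply Real.sqrt_le_iff.2 ⟨by positivity, ?_⟩
    rw [mul_pow, Real.sq_sqrt hK, ← pow_mul, mul_comm (i + 1)]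
    exact h.le_zero (i + 1) hi
  -- The lower bound of the length is used only for the first term of Agmon's inequality.
  have h4 : Λ.sobolev i / Λ.length ≤ K * S ^ (2 * i) / ℓ₀ :=
    div_le_div₀ (by positivity) (h.le_zero i (by omega)) hℓ h.length_ge
  have h5 : √(Λ.sobolev i) * √(Λ.sobolev (i + 1)) ≤ (√K * S ^ i) * (√K * S ^ (i + 1)) :=
    mul_le_mul h2 h3 (Real.sqrt_nonneg _) (by positivity)
  have h6 : (√K * S ^ i) * (√K * S ^ (i + 1)) = K * (S ^ (2 * i) * S) := by
    calc _ = √K ^ 2 * (S ^ (2 * i) * S) := by ring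
      _ = _ := by rw [Real.sq_sqrt hK]
  rw [h6] at h5
  apply abs_le_of_sq_le_sq _ (by positivity)
  have hp : 0 ≤ S ^ (2 * i) := by positivity
  have hKl : 0 ≤ K / ℓ₀ := by positivity
  calc Λ.jet i u ^ 2 ≤ K * S ^ (2 * i) / ℓ₀ + 2 * (K * (S ^ (2 * i) * S)) := by linarith
    _ = (K / ℓ₀ + 2 * K * S) * S ^ (2 * i) := by ring
    _ ≤ ((K / ℓ₀ + 2 * K) * (1 + S) ^ 2) * S ^ (2 * i) := by
      refine mul_le_mul_of_nonneg_right ?_ hp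
      nlinarith [mul_nonneg hKl hS, mul_nonneg hK hS, mul_nonneg hKl (sq_nonneg S),
        mul_nonneg hK (sq_nonneg S)]
    _ = _ := by
      rw [mul_pow, Real.sq_sqrt (by positivity)]
      ring

lemma Profile.abs_integral_mul_le (Λ : Profile) {A : MvPolynomial ℕ ℝ} {B : ℝ} (hB : 0 ≤ B)
    (hA : ∀ u ∈ Set.Icc 0 Λ.a, |Λ.eval u A| ≤ B) (j k : ℕ) :
    |Λ.integral (A * X j * X k)| ≤ B * (√(Λ.sobolev j) * √(Λ.sobolev k)) := by
  refine le_trans ?_ (mul_le_mul_of_nonneg_left (Λ.integral_abs_mul_le (X j) (X k)) hB)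
  rw [Λ.integral_apply]
  refine (intervalIntegral.abs_integral_le_integral_abs Λ.a_pos.le).trans ?_
  rw [← intervalIntegral.integral_const_mul]
  refine intervalIntegral.integral_mono_on Λ.a_pos.le ?_ ?_ fun u hu => ?_
  · exact ((Λ.continuous_eval _).mul Λ.continuous_ρ).abs.intervalIntegrable _ _
  · exact (continuous_const.mul (((Λ.continuous_eval _).mul
      (Λ.continuous_eval _)).abs.mul Λ.continuous_ρ)).intervalIntegrable _ _
  · rw [map_mul, map_mul, abs_mul, abs_of_pos (Λ.ρ_pos u), ← mul_assoc, mul_assoc (Λ.eval u A),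
      abs_mul]
    exact mul_le_mul_of_nonneg_right (mul_le_mul_of_nonneg_right (hA u hu) (abs_nonneg _))
      (Λ.ρ_pos u).le

lemma Profile.Scaled.sqrt_mul_sqrt_le {Λ : Profile} {N : ℕ} {K ℓ₀ S : ℝ}
    (h : Λ.Scaled N K ℓ₀ S) {j k : ℕ} (hj : 1 ≤ j) (hjN : j ≤ N) (hk : 1 ≤ k) (hkN : k ≤ N) :
    √(Λ.sobolev j) * √(Λ.sobolev k) ≤ Λ.sobolev 1 * S ^ (j + k - 2) := by
  have hS := h.nonneg
  have aux : ∀ i, 1 ≤ i → i ≤ N → √(Λ.sobolev i) ≤ √(Λ.sobolev 1) * S ^ (i - 1) := by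
    intro i hi hiN
    apply Real.sqrt_le_iff.2 ⟨by positivity, ?_⟩
    rw [mul_pow, Real.sq_sqrt (Λ.sobolev_nonneg 1), ← pow_mul, mul_comm (i - 1)]
    exact h.le_one i hi hiN
  calc _ ≤ (√(Λ.sobolev 1) * S ^ (j - 1)) * (√(Λ.sobolev 1) * S ^ (k - 1)) :=
        mul_le_mul (aux j hj hjN) (aux k hk hkN) (Real.sqrt_nonneg _) (by positivity)
    _ = √(Λ.sobolev 1) ^ 2 * (S ^ (j - 1) * S ^ (k - 1)) := by ring
    _ = _ := by
      rw [Real.sq_sqrt (Λ.sobolev_nonneg 1), ← pow_add]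
      congr 2
      omega

/-- Differential polynomials whose integral is bounded by `∫ Q_s² ds` times the `n`-th power of the
frequency, uniformly in the curve. -/
def tame (N : ℕ) (K ℓ₀ : ℝ) (n : ℕ) : Submodule ℝ (MvPolynomial ℕ ℝ) where
  carrier := {F | ∃ c : ℝ, 0 ≤ c ∧ ∀ (Λ : Profile) (S : ℝ), Λ.Scaled N K ℓ₀ S →
    |Λ.integral F| ≤ c * (Λ.sobolev 1 * (1 + S) ^ n)}
  zero_mem' := ⟨0, le_rfl, by simp⟩
  add_mem' := by
    rintro F G ⟨c, hc, hF⟩ ⟨d, hd, hG⟩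
    refine ⟨c + d, add_nonneg hc hd, fun Λ S h => ?_⟩
    rw [map_add, add_mul]
    exact (abs_add_le _ _).trans (add_le_add (hF Λ S h) (hG Λ S h))
  smul_mem' := by
    rintro r F ⟨c, hc, hF⟩
    refine ⟨|r| * c, by positivity, fun Λ S h => ?_⟩
    rw [map_smul, smul_eq_mul, abs_mul, mul_assoc]
    exact mul_le_mul_of_nonneg_left (hF Λ S h) (abs_nonneg r)

section Tame

variable {N n : ℕ} {K ℓ₀ : ℝ}

/-- With this, derivatives may be moved between factors without leaving the tame polynomials. -/
lemma totalDeriv_mem_tame (F : MvPolynomial ℕ ℝ) : totalDeriv F ∈ tame N K ℓ₀ n :=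
  ⟨0, le_rfl, fun Λ S _ => by simp⟩

/-- The first factor is taken in the supremum norm at cost i + 1 powers of frequency, the other two
in L². Since j, k ≥ 1, these two yield E_1 and only j + k - 2 further powers. -/
lemma cubic_mem_tame_of_le (hℓ : 0 < ℓ₀) (hK : 0 ≤ K) {i j k : ℕ} (hi : i + 1 ≤ N) (hj : 1 ≤ j)
    (hjN : j ≤ N) (hk : 1 ≤ k) (hkN : k ≤ N) (hn : i + j + k ≤ n + 1) :
    (X i * X j * X k : MvPolynomial ℕ ℝ) ∈ tame N K ℓ₀ n := by
  refine ⟨√(K / ℓ₀ + 2 * K), Real.sqrt_nonneg _, fun Λ S h => ?_⟩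
  have hS := h.nonneg
  have hE := Λ.sobolev_nonneg 1
  refine (Λ.abs_integral_mul_le (B := √(K / ℓ₀ + 2 * K) * (S ^ i * (1 + S))) (by positivity)
    (fun u hu => ?_) j k).trans ?_
  · rw [Λ.eval_X]
    exact h.abs_jet_le hℓ hK hi hu
  · rw [mul_assoc]
    refine mul_le_mul_of_nonneg_left ?_ (Real.sqrt_nonneg _)
    calc _ ≤ ((1 + S) ^ i * (1 + S)) * (Λ.sobolev 1 * (1 + S) ^ (j + k - 2)) := by
          refine mul_le_mul ?_ ((h.sqrt_mul_sqrt_le hj hjN hk hkN).trans ?_) (by positivity)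
            (by positivity)
          · gcongr; linarith
          · gcongr; linarith
      _ = Λ.sobolev 1 * (1 + S) ^ (i + 1 + (j + k - 2)) := by ring
      _ ≤ _ := by
        gcongr
        · linarith
        · omega

/-- Two factors in the supremum norm and two in L²; the cost is (i+1) + (l+1) + (j+k-2) powers. -/
lemma quartic_mem_tame_of_le (hℓ : 0 < ℓ₀) (hK : 0 ≤ K) {i l j k : ℕ} (hi : i + 1 ≤ N)
    (hl : l + 1 ≤ N) (hj : 1 ≤ j) (hjN : j ≤ N) (hk : 1 ≤ k) (hkN : k ≤ N)
    (hn : i + l + j + k ≤ n) : (X i * X l * X j * X k : MvPolynomial ℕ ℝ) ∈ tame N K ℓ₀ n := by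
  refine ⟨√(K / ℓ₀ + 2 * K) ^ 2, by positivity, fun Λ S h => ?_⟩
  have hS := h.nonneg
  have hE := Λ.sobolev_nonneg 1
  refine (Λ.abs_integral_mul_le (B := √(K / ℓ₀ + 2 * K) ^ 2 * ((S ^ i * (1 + S)) *
    (S ^ l * (1 + S)))) (by positivity) (fun u hu => ?_) j k).trans ?_
  · rw [map_mul, abs_mul, Λ.eval_X, Λ.eval_X]
    refine (mul_le_mul (h.abs_jet_le hℓ hK hi hu) (h.abs_jet_le hℓ hK hl hu) (abs_nonneg _)
      (by positivity)).trans (le_of_eq (by ring))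
  · rw [mul_assoc]
    refine mul_le_mul_of_nonneg_left ?_ (by positivity)
    calc _ ≤ (((1 + S) ^ i * (1 + S)) * ((1 + S) ^ l * (1 + S))) *
          (Λ.sobolev 1 * (1 + S) ^ (j + k - 2)) := by
          refine mul_le_mul ?_ ((h.sqrt_mul_sqrt_le hj hjN hk hkN).trans ?_) (by positivity)
            (by positivity)
          · gcongr <;> linarith
          · gcongr; linarith
      _ = Λ.sobolev 1 * (1 + S) ^ (i + l + 2 + (j + k - 2)) := by ring
      _ ≤ _ := by
        gcongr
        · linarith
        · omega

/-- While the last factor has order above p+2, one derivative is integrated by parts onto the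
others. These have total order at most p+1 at that moment, so they stay within the bound p+2 and the
induction continues. -/
lemma cubic_mem_tame_of_le_of_le (hℓ : 0 < ℓ₀) (hK : 0 ≤ K) (p k i j : ℕ)
    (h : i + j + k = 2 * p + 4) (hi : i ≤ p + 2) (hj : j ≤ p + 2) :
    (X i * X j * X k : MvPolynomial ℕ ℝ) ∈ tame (p + 3) K ℓ₀ (2 * p + 3) := by
  induction k generalizing i j with
  | zero =>
    rw [show (X i * X j * X 0 : MvPolynomial ℕ ℝ) = X 0 * X i * X j by ring]
    exact cubic_mem_tame_of_le hℓ hK (by omega) (by omega) (by omega) (by omega) (by omega)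
      (by omega)
  | succ k ih =>
    by_cases hk : k + 1 ≤ p + 2
    · by_cases hj0 : 1 ≤ j
      -- The two factors put in L² must be differentiated; if j = 0, that factor goes into the
      -- supremum norm and its place is taken by i.
      · exact cubic_mem_tame_of_le hℓ hK (by omega) (by omega) (by omega) (by omega) (by omega)
          (by omega)
      · rw [mul_comm (X i)]
        exact cubic_mem_tame_of_le hℓ hK (by omega) (by omega) (by omega) (by omega) (by omega)
          (by omega)
    · have e : (X i * X j * X (k + 1) : MvPolynomial ℕ ℝ) = totalDeriv (X i * X j * X k) -
          (X (i + 1) * X j * X k + X i * X (j + 1) * X k) := by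
        simp
        ring
      rw [e]
      exact sub_mem (totalDeriv_mem_tame _) (add_mem (ih _ _ (by omega) (by omega) (by omega))
        (ih _ _ (by omega) (by omega) (by omega)))

lemma homog_three_le_tame (hℓ : 0 < ℓ₀) (hK : 0 ≤ K) (p : ℕ) :
    homog 3 (2 * p + 4) ≤ tame (p + 3) K ℓ₀ (2 * p + 3) := by
  refine homog_three_le fun i j k h => ?_
  by_cases hi : i ≤ p + 2
  · by_cases hj : j ≤ p + 2
    · exact cubic_mem_tame_of_le_of_le hℓ hK p k i j h hi hj
    · rw [show (X i * X j * X k : MvPolynomial ℕ ℝ) = X i * X k * X j by ring]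
      exact cubic_mem_tame_of_le_of_le hℓ hK p j i k (by omega) hi (by omega)
  · rw [show (X i * X j * X k : MvPolynomial ℕ ℝ) = X j * X k * X i by ring]
    exact cubic_mem_tame_of_le_of_le hℓ hK p i j k (by omega) (by omega) (by omega)

/-- Same descent as in the cubic case. Once all orders are at most p+2, two factors must be
differentiated: a single one would carry all 2p+2 > p+2 derivatives. This is where p ≥ 1 enters. -/
lemma quartic_mem_tame_of_le_of_le (hℓ : 0 < ℓ₀) (hK : 0 ≤ K) {p : ℕ} (hp : 1 ≤ p)
    (k i j l : ℕ) (h : i + j + l + k = 2 * p + 2) (hi : i ≤ p + 2) (hj : j ≤ p + 2)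
    (hl : l ≤ p + 2) :
    (X i * X j * X l * X k : MvPolynomial ℕ ℝ) ∈ tame (p + 3) K ℓ₀ (2 * p + 3) := by
  have ordered : ∀ i j l k, i + j + l + k = 2 * p + 2 → i ≤ p + 2 → j ≤ p + 2 → 1 ≤ l →
      l ≤ p + 2 → 1 ≤ k → k ≤ p + 2 →
      (X i * X j * X l * X k : MvPolynomial ℕ ℝ) ∈ tame (p + 3) K ℓ₀ (2 * p + 3) :=
    fun i j l k _ _ _ _ _ _ _ => quartic_mem_tame_of_le hℓ hK (by omega) (by omega) (by omega)
      (by omega) (by omega) (by omega) (by omega)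
  have e1 : ∀ a b c d : MvPolynomial ℕ ℝ, a * b * c * d = a * c * b * d := fun _ _ _ _ => by ring
  have e2 : ∀ a b c d : MvPolynomial ℕ ℝ, a * b * c * d = c * b * a * d := fun _ _ _ _ => by ring
  have e3 : ∀ a b c d : MvPolynomial ℕ ℝ, a * b * c * d = a * d * c * b := fun _ _ _ _ => by ring
  have e4 : ∀ a b c d : MvPolynomial ℕ ℝ, a * b * c * d = d * c * b * a := fun _ _ _ _ => by ring
  induction k generalizing i j l with
  | zero =>
    by_cases hl0 : 1 ≤ l
    · by_cases hj0 : 1 ≤ j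
      · rw [e3]; exact ordered _ _ _ _ (by omega) (by omega) (by omega) (by omega) (by omega)
          (by omega) (by omega)
      · rw [e4, e1]; exact ordered _ _ _ _ (by omega) (by omega) (by omega) (by omega) (by omega)
          (by omega) (by omega)
    · rw [e4]; exact ordered _ _ _ _ (by omega) (by omega) (by omega) (by omega) (by omega)
        (by omega) (by omega)
  | succ k ih =>
    by_cases hk : k + 1 ≤ p + 2
    · by_cases hl0 : 1 ≤ l
      · exact ordered _ _ _ _ (by omega) (by omega) (by omega) (by omega) (by omega)
          (by omega) (by omega)
      · by_cases hj0 : 1 ≤ j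
        · rw [e1]; exact ordered _ _ _ _ (by omega) (by omega) (by omega) (by omega) (by omega)
            (by omega) (by omega)
        · rw [e2]; exact ordered _ _ _ _ (by omega) (by omega) (by omega) (by omega) (by omega)
            (by omega) (by omega)
    · have e : (X i * X j * X l * X (k + 1) : MvPolynomial ℕ ℝ) =
          totalDeriv (X i * X j * X l * X k) - (X (i + 1) * X j * X l * X k +
            X i * X (j + 1) * X l * X k + X i * X j * X (l + 1) * X k) := by
        simp
        ring
      rw [e]
      exact sub_mem (totalDeriv_mem_tame _) (add_mem (add_mem
        (ih _ _ _ (by omega) (by omega) (by omega) (by omega))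
        (ih _ _ _ (by omega) (by omega) (by omega) (by omega)))
        (ih _ _ _ (by omega) (by omega) (by omega) (by omega)))

lemma homog_four_le_tame (hℓ : 0 < ℓ₀) (hK : 0 ≤ K) {p : ℕ} (hp : 1 ≤ p) :
    homog 4 (2 * p + 2) ≤ tame (p + 3) K ℓ₀ (2 * p + 3) := by
  refine homog_four_le fun i j k l h => ?_
  by_cases hi : i ≤ p + 2
  · by_cases hj : j ≤ p + 2
    · by_cases hk : k ≤ p + 2
      · exact quartic_mem_tame_of_le_of_le hℓ hK hp l i j k h hi hj hk
      · rw [show (X i * X j * X k * X l : MvPolynomial ℕ ℝ) = X i * X j * X l * X k by ring]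
        exact quartic_mem_tame_of_le_of_le hℓ hK hp k i j l (by omega) hi hj (by omega)
    · rw [show (X i * X j * X k * X l : MvPolynomial ℕ ℝ) = X i * X k * X l * X j by ring]
      exact quartic_mem_tame_of_le_of_le hℓ hK hp j i k l (by omega) hi (by omega) (by omega)
  · rw [show (X i * X j * X k * X l : MvPolynomial ℕ ℝ) = X j * X k * X l * X i by ring]
    exact quartic_mem_tame_of_le_of_le hℓ hK hp i j k l (by omega) (by omega) (by omega)
      (by omega)

end Tame

lemma exists_mul_one_add_pow_le (c : ℝ) (hc : 0 ≤ c) {n m : ℕ} (hnm : n < m) :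
    ∃ c' : ℝ, 0 ≤ c' ∧ ∀ S : ℝ, 0 ≤ S → c * (1 + S) ^ n ≤ 1 / 4 * S ^ m + c' := by
  -- Above R ≥ 1 one has (1+S)^n ≤ 2^n S^n and 4c·2^n ≤ S, so one spare power of S absorbs the
  -- constant; below R everything is bounded.
  set R : ℝ := 1 + 4 * c * 2 ^ n with hR
  have hR1 : 1 ≤ R := by rw [hR]; have : 0 ≤ 4 * c * 2 ^ n := by positivity
                         linarith
  refine ⟨c * (1 + R) ^ n, by positivity, fun S hS => ?_⟩
  rcases le_total S R with h | h
  · have : c * (1 + S) ^ n ≤ c * (1 + R) ^ n := by gcongr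
    have : 0 ≤ S ^ m := by positivity
    linarith
  · have hS1 : 1 ≤ S := hR1.trans h
    have h1 : c * (1 + S) ^ n ≤ c * 2 ^ n * S ^ n := by
      rw [mul_assoc, ← mul_pow]
      gcongr
      linarith
    have h2 : c * 2 ^ n * S ^ n ≤ 1 / 4 * S ^ (n + 1) := by
      rw [pow_succ']
      have : 0 ≤ S ^ n := by positivity
      nlinarith
    have h3 : S ^ (n + 1) ≤ S ^ m := pow_le_pow_right₀ hS1 hnm
    have : 0 ≤ c * (1 + R) ^ n := by positivity
    linarith

/-- The higher energy inequality. -/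
lemma exists_integral_densityRate_le (p : ℕ) (hp : 1 ≤ p) {K ℓ₀ : ℝ} (hK : 0 ≤ K)
    (hℓ : 0 < ℓ₀) :
    ∃ c : ℝ, 0 ≤ c ∧ ∀ Λ : Profile, Λ.sobolev 0 ≤ K → ℓ₀ ≤ Λ.length →
      Λ.integral (densityRate (X p ^ 2)) ≤ -(1 / 4) * Λ.sobolev (p + 3) + c * Λ.sobolev 1 := by
  have hmem : densityRate (X p ^ 2) - (C 2 * (X p * X (p + 2)) + C (1 / 2) * (X p * X (p + 6))) ∈
      tame (p + 3) K ℓ₀ (2 * p + 3) :=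
    (sup_le (homog_three_le_tame hℓ hK p) (homog_four_le_tame hℓ hK hp)) (densityRate_sub_mem p)
  obtain ⟨c, hc, hb⟩ := hmem
  obtain ⟨c', hc', hpow⟩ := exists_mul_one_add_pow_le c hc (show 2 * p + 3 < 2 * p + 4 by omega)
  refine ⟨c', hc', fun Λ hΛ hlen => ?_⟩
  obtain ⟨S, hS, hS0, hS1, hSN⟩ := logConvex_exists_ratio Λ.sobolev_nonneg Λ.sobolev_logConvex
    (show 2 ≤ p + 3 by omega)
  have hsc : Λ.Scaled (p + 3) K ℓ₀ S :=
    ⟨hS, hlen, fun i hi => (hS0 i hi).trans (by gcongr), hS1⟩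
  have h1 := (le_abs_self _).trans (hb Λ S hsc)
  rw [map_sub, map_add, ← MvPolynomial.smul_eq_C_mul, ← MvPolynomial.smul_eq_C_mul, map_smul,
    map_smul, smul_eq_mul, smul_eq_mul] at h1
  -- The quadratic part integrates to -2E_{p+1} - ½E_{p+3}: one and three integrations by parts.
  have h2 : Λ.integral (X p * X (p + 2)) = -Λ.sobolev (p + 1) := by
    have h := Λ.integral_totalDeriv (X p * X (p + 1))
    have e : totalDeriv (X p * X (p + 1)) = X p * X (p + 2) + X (p + 1) ^ 2 := by
      simp [pow_two]
    rw [e, map_add] at h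
    rw [Profile.sobolev]; linarith
  have h3 : Λ.integral (X p * X (p + 6)) = -Λ.sobolev (p + 3) := by
    have h := Λ.integral_totalDeriv (X p * X (p + 5) - X (p + 1) * X (p + 4) +
      X (p + 2) * X (p + 3))
    have e : totalDeriv (X p * X (p + 5) - X (p + 1) * X (p + 4) + X (p + 2) * X (p + 3)) =
        X p * X (p + 6) + X (p + 3) ^ 2 := by
      simp
      ring
    rw [e, map_add] at h
    rw [Profile.sobolev]; linarith
  -- The choice of S gives E_1 S^{2p+4} ≤ E_{p+3}, one power more than the error has; half of the
  -- good term ½E_{p+3} is spent here.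
  have h4 : c * (Λ.sobolev 1 * (1 + S) ^ (2 * p + 3)) ≤
      1 / 4 * Λ.sobolev (p + 3) + c' * Λ.sobolev 1 := by
    have := mul_le_mul_of_nonneg_left (hpow S hS) (Λ.sobolev_nonneg 1)
    have e : 2 * (p + 3 - 1) = 2 * p + 4 := by omega
    rw [e] at hSN
    nlinarith
  have := Λ.sobolev_nonneg (p + 1)
  linarith

end Inversive

end

noncomputable section

namespace Inversive

/-! ### Smooth families of functions on the line -/

section Families

open Set Filter Topology

variable {E : Type*} [NormedAddCommGroup E] [NormedSpace ℝ E]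

/-- The family `f t`, `t ∈ I`, of functions on the line is smooth. -/
def SmoothFamily (I : Set ℝ) (f : ℝ → ℝ → E) : Prop :=
  ContDiffOn ℝ ∞ (fun z : ℝ × ℝ => f z.1 z.2) (I ×ˢ univ)

variable {I : Set ℝ} {f g : ℝ → ℝ → E}

lemma SmoothFamily.mono {J : Set ℝ} (hf : SmoothFamily I f) (h : J ⊆ I) : SmoothFamily J f :=
  ContDiffOn.mono hf (prod_mono h le_rfl)

lemma SmoothFamily.contDiff (hf : SmoothFamily I f) {t : ℝ} (ht : t ∈ I) :
    ContDiff ℝ ∞ (f t) := by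
  rw [← contDiffOn_univ]
  exact ContDiffOn.comp hf (s := univ) (f := fun u : ℝ => (t, u))
    (contDiff_const.prodMk contDiff_id).contDiffOn fun u _ => ⟨ht, mem_univ u⟩

lemma SmoothFamily.congr (hf : SmoothFamily I f) (h : ∀ t ∈ I, ∀ u, g t u = f t u) :
    SmoothFamily I g :=
  ContDiffOn.congr hf fun z hz => h z.1 hz.1 z.2

/-- At an endpoint of a closed time interval the u-derivative is still read off from the derivative
within the strip, because the line {t} × ℝ stays in it. -/
lemma SmoothFamily.deriv_right (hI : UniqueDiffOn ℝ I) (hf : SmoothFamily I f) :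
    SmoothFamily I fun t u => deriv (f t) u := by
  have h1 : ContDiffOn ℝ ∞ (fderivWithin ℝ (fun z : ℝ × ℝ => f z.1 z.2) (I ×ˢ univ))
      (I ×ˢ univ) := ContDiffOn.fderivWithin hf (hI.prod uniqueDiffOn_univ) (by simp)
  have h2 : ContDiffOn ℝ ∞ (fun z => fderivWithin ℝ (fun z : ℝ × ℝ => f z.1 z.2) (I ×ˢ univ) z
      ((0, 1) : ℝ × ℝ)) (I ×ˢ univ) := h1.clm_apply contDiffOn_const
  refine h2.congr ?_
  rintro ⟨t, u⟩ hz
  have h3 : HasFDerivWithinAt (fun z : ℝ × ℝ => f z.1 z.2) _ (I ×ˢ univ) (t, u) :=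
    (ContDiffOn.differentiableOn hf (by simp) (t, u) hz).hasFDerivWithinAt
  have h4 : HasDerivAt (fun v : ℝ => ((t, v) : ℝ × ℝ)) (0, 1) u :=
    (hasDerivAt_const u t).prodMk (hasDerivAt_id u)
  exact (h3.comp_hasDerivAt (f := fun v : ℝ => ((t, v) : ℝ × ℝ)) u h4
    (Eventually.of_forall fun v => ⟨hz.1, mem_univ v⟩)).deriv

lemma SmoothFamily.contDiffAt (hI : IsOpen I) (hf : SmoothFamily I f) {t : ℝ} (ht : t ∈ I)
    (u : ℝ) : ContDiffAt ℝ ∞ (fun z : ℝ × ℝ => f z.1 z.2) (t, u) :=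
  ContDiffOn.contDiffAt hf ((hI.prod isOpen_univ).mem_nhds ⟨ht, mem_univ u⟩)

lemma hasDerivAt_left_of_contDiffAt {t u : ℝ}
    (hf : ContDiffAt ℝ ∞ (fun z : ℝ × ℝ => f z.1 z.2) (t, u)) :
    HasDerivAt (fun s => f s u) (fderiv ℝ (fun z : ℝ × ℝ => f z.1 z.2) (t, u) (1, 0)) t := by
  have h4 : HasDerivAt (fun s : ℝ => ((s, u) : ℝ × ℝ)) (1, 0) t :=
    (hasDerivAt_id t).prodMk (hasDerivAt_const t u)
  exact HasFDerivAt.comp_hasDerivAt (f := fun s : ℝ => ((s, u) : ℝ × ℝ)) t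
    (hf.differentiableAt (by simp)).hasFDerivAt h4

lemma hasDerivAt_right_of_contDiffAt {t u : ℝ}
    (hf : ContDiffAt ℝ ∞ (fun z : ℝ × ℝ => f z.1 z.2) (t, u)) :
    HasDerivAt (f t) (fderiv ℝ (fun z : ℝ × ℝ => f z.1 z.2) (t, u) (0, 1)) u := by
  have h4 : HasDerivAt (fun v : ℝ => ((t, v) : ℝ × ℝ)) (0, 1) u :=
    (hasDerivAt_const u t).prodMk (hasDerivAt_id u)
  exact HasFDerivAt.comp_hasDerivAt (f := fun v : ℝ => ((t, v) : ℝ × ℝ)) u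
    (hf.differentiableAt (by simp)).hasFDerivAt h4

lemma SmoothFamily.hasDerivAt_left (hI : IsOpen I) (hf : SmoothFamily I f) {t : ℝ} (ht : t ∈ I)
    (u : ℝ) : HasDerivAt (fun s => f s u) (deriv (fun s => f s u) t) t :=
  (hasDerivAt_left_of_contDiffAt (hf.contDiffAt hI ht u)).differentiableAt.hasDerivAt

lemma SmoothFamily.deriv_left (hI : IsOpen I) (hf : SmoothFamily I f) :
    SmoothFamily I fun t u => deriv (fun s => f s u) t := by
  have h1 : ContDiffOn ℝ ∞ (fderiv ℝ (fun z : ℝ × ℝ => f z.1 z.2)) (I ×ˢ univ) :=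
    ContDiffOn.fderiv_of_isOpen hf (hI.prod isOpen_univ) (by simp)
  have h2 : ContDiffOn ℝ ∞ (fun z => fderiv ℝ (fun z : ℝ × ℝ => f z.1 z.2) z
      ((1, 0) : ℝ × ℝ)) (I ×ˢ univ) := h1.clm_apply contDiffOn_const
  refine h2.congr ?_
  rintro ⟨t, u⟩ hz
  exact (hasDerivAt_left_of_contDiffAt (hf.contDiffAt hI hz.1 u)).deriv

/-- The mixed partial derivatives commute. -/
lemma SmoothFamily.hasDerivAt_deriv_right (hI : IsOpen I) (hf : SmoothFamily I f) {t : ℝ}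
    (ht : t ∈ I) (u : ℝ) : HasDerivAt (fun s => deriv (f s) u)
      (deriv (fun v => deriv (fun s => f s v) t) u) t := by
  set F : ℝ × ℝ → E := fun z => f z.1 z.2 with hF
  have hat := hf.contDiffAt hI ht u
  have hd : HasFDerivAt (fderiv ℝ F) (fderiv ℝ (fderiv ℝ F) (t, u)) (t, u) :=
    ((hat.fderiv_right (m := ∞) (by simp)).differentiableAt (by simp)).hasFDerivAt
  have hsymm : fderiv ℝ (fderiv ℝ F) (t, u) (1, 0) (0, 1) =
      fderiv ℝ (fderiv ℝ F) (t, u) (0, 1) (1, 0) :=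
    (hat.isSymmSndFDerivAt (by
      rw [minSmoothness_of_isRCLikeNormedField]; exact WithTop.coe_le_coe.2 (le_top : (2 : ℕ∞) ≤ ⊤))) _ _
  have l1 : HasDerivAt (fun s : ℝ => ((s, u) : ℝ × ℝ)) (1, 0) t :=
    (hasDerivAt_id t).prodMk (hasDerivAt_const t u)
  have l2 : HasDerivAt (fun v : ℝ => ((t, v) : ℝ × ℝ)) (0, 1) u :=
    (hasDerivAt_const u t).prodMk (hasDerivAt_id u)
  have h1 : HasDerivAt (fun s => fderiv ℝ F (s, u) (0, 1))
      (fderiv ℝ (fderiv ℝ F) (t, u) (1, 0) (0, 1)) t := by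
    have := (HasFDerivAt.comp_hasDerivAt (f := fun s : ℝ => ((s, u) : ℝ × ℝ)) t hd l1).clm_apply
      (hasDerivAt_const t ((0, 1) : ℝ × ℝ))
    simpa using this
  have h2 : HasDerivAt (fun v => fderiv ℝ F (t, v) (1, 0))
      (fderiv ℝ (fderiv ℝ F) (t, u) (0, 1) (1, 0)) u := by
    have := (HasFDerivAt.comp_hasDerivAt (f := fun v : ℝ => ((t, v) : ℝ × ℝ)) u hd l2).clm_apply
      (hasDerivAt_const u ((1, 0) : ℝ × ℝ))
    simpa using this
  have e2 : deriv (fun v => deriv (fun s => f s v) t) u =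
      fderiv ℝ (fderiv ℝ F) (t, u) (0, 1) (1, 0) := by
    rw [← h2.deriv]
    congr 1
    funext v
    exact (hasDerivAt_left_of_contDiffAt (hf.contDiffAt hI ht v)).deriv
  rw [e2, ← hsymm]
  refine h1.congr_of_eventuallyEq ?_
  filter_upwards [hI.mem_nhds ht] with s hs
  exact (hasDerivAt_right_of_contDiffAt (hf.contDiffAt hI hs u)).deriv

/-- Differentiation under the integral sign. -/
lemma SmoothFamily.hasDerivAt_integral {f : ℝ → ℝ → ℝ} (hI : IsOpen I) (hf : SmoothFamily I f)
    {t : ℝ} (ht : t ∈ I) (a : ℝ) : HasDerivAt (fun s => ∫ u in (0 : ℝ)..a, f s u)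
      (∫ u in (0 : ℝ)..a, deriv (fun s => f s u) t) t := by
  have hd := (hf.deriv_left hI)
  -- The dominating function is a constant: the time derivative is bounded on a compact rectangle.
  obtain ⟨ε, hε, hball⟩ := Metric.nhds_basis_closedBall.mem_iff.1 (hI.mem_nhds ht)
  have hcomp : IsCompact (Metric.closedBall t ε ×ˢ uIcc 0 a) :=
    (isCompact_closedBall t ε).prod isCompact_uIcc
  obtain ⟨M, hM⟩ := hcomp.exists_bound_of_continuousOn
    ((ContDiffOn.continuousOn hd).mono (prod_mono hball (subset_univ _)))
  refine (intervalIntegral.hasDerivAt_integral_of_dominated_loc_of_deriv_le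
    (F := f) (F' := fun t u => deriv (fun s => f s u) t) (bound := fun _ => M)
    (Metric.closedBall_mem_nhds t hε) ?_ ?_ ?_ ?_ ?_ ?_).2
  · filter_upwards [hI.mem_nhds ht] with s hs
    exact (hf.contDiff hs).continuous.aestronglyMeasurable
  · exact (hf.contDiff ht).continuous.intervalIntegrable _ _
  · exact (hd.contDiff ht).continuous.aestronglyMeasurable
  · refine Eventually.of_forall fun u hu s hs => hM (s, u) ⟨hs, uIoc_subset_uIcc hu⟩
  · exact intervalIntegrable_const
  · exact Eventually.of_forall fun u _ s hs => hf.hasDerivAt_left hI (hball hs) u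

lemma SmoothFamily.continuousOn_integral {f : ℝ → ℝ → ℝ} (hf : SmoothFamily I f) (a : ℝ) :
    ContinuousOn (fun s => ∫ u in (0 : ℝ)..a, f s u) I := by
  rw [continuousOn_iff_continuous_domRestrict]
  refine intervalIntegral.continuous_parametric_intervalIntegral_of_continuous'
    (f := fun (s : I) u => f s u) ?_ 0 a
  exact (ContDiffOn.continuousOn hf).comp_continuous
    ((continuous_subtype_val.comp continuous_fst).prodMk continuous_snd)
    fun z => ⟨z.1.2, mem_univ _⟩

end Families

end Inversive

end

/-! ### Monotone quantities: length, ∫Q² ds and the variance of Q. -/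

noncomputable section

namespace Inversive

open MvPolynomial (X C)

/-! ### Integral identities at a fixed time -/

namespace Profile

variable (Λ : Profile)

lemma mul_integral (r : ℝ) (F : MvPolynomial ℕ ℝ) : r * Λ.integral F = Λ.integral (r • F) := by
  rw [map_smul, smul_eq_mul]

lemma integral_densityRate_one : Λ.integral (densityRate 1) = Λ.sobolev 1 := by
  rw [← sub_eq_zero, sobolev, ← map_sub]
  -- The rate of the length is -½∫P ds; this primitive moves one derivative in QQ''.
  rw [← Λ.integral_totalDeriv (C (-1 / 2) * X 3 - C 2 * (X 0 * X 1))]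
  refine Λ.integral_congr fun u => ?_
  simp [densityRate, lengthRate]
  ring

/-- The dissipation of `∫ Q² ds`. -/
def dissipation : ℝ :=
  Λ.integral (C (1 / 2) * (X 3 + C 5 * (X 0 * X 1)) ^ 2 + C (5 / 2) * (X 0 * X 1) ^ 2 +
    C 2 * X 1 ^ 2)

/-- The time derivative of `∫ (Q - q)² ds`, for constant `q`. -/
lemma integral_densityRate_sub_sq (q : ℝ) :
    Λ.integral (densityRate (X 0 ^ 2)) - 2 * q * Λ.integral (densityRate (X 0)) +
      q ^ 2 * Λ.integral (densityRate 1) =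
    -Λ.integral (C (1 / 2) * (X 3 + C (4 * q) * X 1 + C 5 * ((X 0 - C q) * X 1)) ^ 2 +
      C 2 * X 1 ^ 2 + C (4 * q) * ((X 0 - C q) * X 1 ^ 2) +
        C (5 / 2) * ((X 0 - C q) * X 1) ^ 2) := by
  rw [← sub_eq_zero, sub_neg_eq_add, mul_integral, mul_integral, ← map_sub, ← map_add, ← map_add]
  -- This explicit primitive collects all the integrations by parts, so that only a pointwise
  -- polynomial identity in the jets remains. The right side is arranged as squares plus the single
  -- indefinite term 4q(Q - q)Q'².
  rw [← Λ.integral_totalDeriv (C (1 / 2) * ((X 0 - C q) * totalDeriv lengthRate) -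
    C (1 / 2) * (X 1 * lengthRate) + C 2 * ((X 0 - C q) * X 1) + C (1 / 2) * (X 2 * X 3) -
    C (1 / 3) * X 1 ^ 3 + C (3 / 2) * ((X 0 - C q) ^ 2 * X 3) -
    C 3 * ((X 0 - C q) * (X 1 * X 2)) + C (2 * q) * ((X 0 - C q) * X 3) -
    C (2 * q) * (X 1 * X 2) + C 6 * ((X 0 - C q) ^ 3 * X 1) +
    C (14 * q) * ((X 0 - C q) ^ 2 * X 1) + C (8 * q ^ 2) * ((X 0 - C q) * X 1) +
    C (4 * q) * (X 1 * X 2) + C 5 * ((X 0 - C q) * (X 1 * X 2)))]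
  refine Λ.integral_congr fun u => ?_
  simp [densityRate, jetRate, lengthRate, Derivation.leibniz_pow]
  simp only [map_ofNat]
  ring

/-- The case q = 0, in which the indefinite term disappears and a sum of squares is left. -/
lemma integral_densityRate_sq : Λ.integral (densityRate (X 0 ^ 2)) = -Λ.dissipation := by
  have h := Λ.integral_densityRate_sub_sq 0
  simp only [mul_zero, zero_mul, sub_zero, add_zero, ne_eq, OfNat.ofNat_ne_zero,
    not_false_eq_true, zero_pow, map_zero] at h
  rw [h, dissipation]
  congr 2
  ring

lemma sobolev_one_le_dissipation : 2 * Λ.sobolev 1 ≤ Λ.dissipation := by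
  rw [sobolev, dissipation, mul_integral]
  refine Λ.integral_mono fun u _ => ?_
  simp
  positivity

lemma sobolev_three_le_dissipation : Λ.sobolev 3 ≤ 20 * Λ.dissipation := by
  rw [sobolev, dissipation, mul_integral]
  refine Λ.integral_mono fun u _ => ?_
  simp
  nlinarith [sq_nonneg (Λ.jet 3 u + 10 * (Λ.jet 0 u * Λ.jet 1 u)), sq_nonneg (Λ.jet 1 u)]

lemma dissipation_nonneg : 0 ≤ Λ.dissipation :=
  (mul_nonneg zero_le_two (Λ.sobolev_nonneg 1)).trans Λ.sobolev_one_le_dissipation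

/-- The mean value of `Q`. -/
def mean : ℝ := Λ.integral (X 0) / Λ.length

/-- `∫ (Q - q)² ds`, with `q` the mean value. -/
def variance : ℝ := Λ.sobolev 0 - Λ.integral (X 0) ^ 2 / Λ.length

lemma integral_C (r : ℝ) : Λ.integral (C r) = r * Λ.length := by
  simp [length, integral_apply]

lemma integral_sub_mean : Λ.integral (X 0 - C Λ.mean) = 0 := by
  rw [map_sub, integral_C, mean, div_mul_cancel₀ _ Λ.length_pos.ne', sub_self]

lemma variance_eq : Λ.variance = Λ.integral ((X 0 - C Λ.mean) ^ 2) := by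
  have hl := Λ.length_pos.ne'
  have e : (X 0 - C Λ.mean : MvPolynomial ℕ ℝ) ^ 2 =
      X 0 ^ 2 - (2 * Λ.mean) • X 0 + C (Λ.mean ^ 2) := by
    rw [MvPolynomial.smul_eq_C_mul, map_mul, map_pow, show (C 2 : MvPolynomial ℕ ℝ) = 2 from
      map_ofNat C 2]
    ring
  rw [e, map_add, map_sub, map_smul, integral_C, variance, sobolev, mean, smul_eq_mul]
  field_simp
  ring

lemma variance_nonneg : 0 ≤ Λ.variance := by
  rw [variance_eq]; exact Λ.integral_sq_nonneg _

lemma mean_sq_le : Λ.mean ^ 2 ≤ Λ.sobolev 0 / Λ.length := by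
  have hl := Λ.length_pos
  have := Λ.variance_nonneg
  rw [variance] at this
  rw [mean, div_pow, pow_two Λ.length, ← div_div]
  gcongr
  linarith

lemma variance_le_sobolev_one : Λ.variance ≤ Λ.length ^ 2 * Λ.sobolev 1 := by
  rw [variance_eq]
  simpa [sobolev] using Λ.integral_sq_le_of_integral_eq_zero Λ.integral_sub_mean

lemma variance_le_sobolev {p : ℕ} (hp : 1 ≤ p) :
    Λ.variance ≤ (Λ.length ^ 2) ^ p * Λ.sobolev p := by
  induction p, hp using Nat.le_induction with
  | base => simpa using Λ.variance_le_sobolev_one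
  | succ p hp ih =>
    refine ih.trans ?_
    rw [pow_succ _ p, mul_assoc]
    exact mul_le_mul_of_nonneg_left (Λ.sobolev_le_succ hp) (by positivity)

/-- The first log-convexity inequality applied to Q minus its mean, which has the same derivatives
as Q. -/
lemma sobolev_one_sq_le_variance : Λ.sobolev 1 ^ 2 ≤ Λ.variance * Λ.sobolev 2 := by
  have h := Λ.integral_totalDeriv ((X 0 - C Λ.mean) * X 1)
  have e : totalDeriv ((X 0 - C Λ.mean) * X 1) = (X 0 - C Λ.mean) * X 2 + X 1 ^ 2 := by
    simp [pow_two]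
  rw [e, map_add] at h
  have : Λ.sobolev 1 = -Λ.integral ((X 0 - C Λ.mean) * X 2) := by
    rw [sobolev]; linarith
  rw [this, neg_sq, variance_eq]
  exact Λ.integral_mul_sq_le _ _

/-- The variance inequality. -/
lemma variance_rate_le {K ℓ₀ : ℝ} (hℓ : 0 < ℓ₀) (hK : Λ.sobolev 0 ≤ K) (hlen : ℓ₀ ≤ Λ.length) :
    Λ.integral (densityRate (X 0 ^ 2)) - 2 * Λ.mean * Λ.integral (densityRate (X 0)) +
      Λ.mean ^ 2 * Λ.integral (densityRate 1) ≤
    -Λ.sobolev 1 + 4 * (K / ℓ₀) * (1 / ℓ₀ + 11) * Λ.variance * Λ.dissipation := by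
  set q := Λ.mean with hq
  set V := Λ.variance with hV
  have hV0 : 0 ≤ V := Λ.variance_nonneg
  have hK0 : 0 ≤ K := (Λ.sobolev_nonneg 0).trans hK
  have h1 := Λ.sobolev_nonneg 1
  have h2 := Λ.sobolev_nonneg 2
  have hD := Λ.dissipation_nonneg
  set B := V / Λ.length + 2 * (√V * √(Λ.sobolev 1)) with hB
  -- Agmon's inequality for Q minus its mean: the bound B is small when the variance is.
  have hsup : ∀ u ∈ Set.Icc 0 Λ.a, (Λ.jet 0 u - q) ^ 2 ≤ B := by
    intro u hu
    have := Λ.eval_sq_le (X 0 - C q) hu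
    rw [hq, ← variance_eq, map_sub totalDeriv, totalDeriv_X, totalDeriv_C, sub_zero, ← hV, ← hq] at this
    simpa [hB, sobolev] using this
  have hqK : q ^ 2 ≤ K / ℓ₀ :=
    Λ.mean_sq_le.trans (div_le_div₀ hK0 hK hℓ hlen)
  rw [integral_densityRate_sub_sq]
  have step : -Λ.integral (C (1 / 2) * (X 3 + C (4 * q) * X 1 + C 5 * ((X 0 - C q) * X 1)) ^ 2 +
      C 2 * X 1 ^ 2 + C (4 * q) * ((X 0 - C q) * X 1 ^ 2) +
        C (5 / 2) * ((X 0 - C q) * X 1) ^ 2) ≤ (-1 + 4 * q ^ 2 * B) * Λ.sobolev 1 := by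
    rw [sobolev, mul_integral, ← map_neg]
    refine Λ.integral_mono fun u hu => ?_
    have hs := hsup u hu
    simp
    have h3 : 0 ≤ Λ.jet 1 u ^ 2 := sq_nonneg _
    -- The square (1 + 2q(Q - q))² tames the indefinite term; it uses up one of the two copies of
    -- Q'².
    have h4 : -(4 * q * (Λ.jet 0 u - q)) ≤ 1 + 4 * q ^ 2 * B := by
      nlinarith [sq_nonneg (1 + 2 * q * (Λ.jet 0 u - q)),
        mul_le_mul_of_nonneg_left hs (sq_nonneg q)]
    nlinarith [mul_le_mul_of_nonneg_right h4 h3, sq_nonneg (Λ.jet 3 u + 4 * q * Λ.jet 1 u +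
      5 * ((Λ.jet 0 u - q) * Λ.jet 1 u)), sq_nonneg ((Λ.jet 0 u - q) * Λ.jet 1 u)]
  -- Trading one E_1 for √(V E_2) makes the error linear in V with a coefficient controlled by the
  -- dissipation, as the exponential weight in `exists_sobolev_le_initial` requires.
  have hE : Λ.sobolev 1 ≤ √V * √(Λ.sobolev 2) := by
    rw [← Real.sqrt_mul hV0]
    exact Real.le_sqrt_of_sq_le Λ.sobolev_one_sq_le_variance
  have hE2 : 2 * Λ.sobolev 2 ≤ Λ.sobolev 1 + Λ.sobolev 3 := by
    have := Λ.sobolev_logConvex 1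
    nlinarith [sq_nonneg (Λ.sobolev 1 - Λ.sobolev 3), Λ.sobolev_nonneg 3,
      sq_nonneg (Λ.sobolev 1 + Λ.sobolev 3 - 2 * Λ.sobolev 2)]
  have hBE : B * Λ.sobolev 1 ≤ (1 / ℓ₀ + 11) * V * Λ.dissipation := by
    have s1 : V / Λ.length ≤ V * (1 / ℓ₀) := by
      rw [mul_one_div]
      exact div_le_div_of_nonneg_left hV0 hℓ hlen
    have s2 : 2 * (√V * √(Λ.sobolev 1)) * Λ.sobolev 1 ≤ V * (Λ.sobolev 1 + Λ.sobolev 2) := by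
      calc 2 * (√V * √(Λ.sobolev 1)) * Λ.sobolev 1
          ≤ 2 * (√V * √(Λ.sobolev 1)) * (√V * √(Λ.sobolev 2)) := by gcongr
        _ = √V ^ 2 * (2 * √(Λ.sobolev 1) * √(Λ.sobolev 2)) := by ring
        _ ≤ √V ^ 2 * (√(Λ.sobolev 1) ^ 2 + √(Λ.sobolev 2) ^ 2) := by
          gcongr
          exact two_mul_le_add_sq _ _
        _ = _ := by rw [Real.sq_sqrt hV0, Real.sq_sqrt h1, Real.sq_sqrt h2]
    have d1 := Λ.sobolev_one_le_dissipation
    have d3 := Λ.sobolev_three_le_dissipation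
    -- E_1 + E_2 ≤ (3/2)E_1 + ½E_3 ≤ (3/4 + 10)D.
    have s3 : Λ.sobolev 1 + Λ.sobolev 2 ≤ 11 * Λ.dissipation := by linarith
    calc B * Λ.sobolev 1 = V / Λ.length * Λ.sobolev 1 +
          2 * (√V * √(Λ.sobolev 1)) * Λ.sobolev 1 := by rw [hB]; ring
      _ ≤ V * (1 / ℓ₀) * Λ.dissipation + V * (11 * Λ.dissipation) := by
        refine add_le_add (mul_le_mul s1 (by linarith) h1 (by positivity))
          (s2.trans (mul_le_mul_of_nonneg_left s3 hV0))
      _ = _ := by ring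
  refine step.trans ?_
  have hB0 : 0 ≤ B * Λ.sobolev 1 :=
    mul_nonneg (add_nonneg (div_nonneg hV0 Λ.length_pos.le) (by positivity)) h1
  have : q ^ 2 * (B * Λ.sobolev 1) ≤ K / ℓ₀ * ((1 / ℓ₀ + 11) * V * Λ.dissipation) :=
    mul_le_mul hqK hBE hB0 (by positivity)
  linarith

end Profile

end Inversive

end

/-! ### Estimates along the flow of the pair (ρ, Q). -/

noncomputable section

namespace Inversive

open MvPolynomial (X C)
open Set

/-! ### The flow in terms of the length element and the fundamental invariant -/

/-- The evolution of the length element `ρ du` and of the fundamental invariant `Q` under the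
inversive curve lengthening flow, on the time interval `[0, τ]`. -/
structure LengtheningFlow where
  a : ℝ
  τ : ℝ
  ρ : ℝ → ℝ → ℝ
  Q : ℝ → ℝ → ℝ
  a_pos : 0 < a
  τ_pos : 0 < τ
  ρ_smooth : SmoothFamily (Icc 0 τ) ρ
  Q_smooth : SmoothFamily (Icc 0 τ) Q
  ρ_pos : ∀ t ∈ Icc 0 τ, ∀ u, 0 < ρ t u
  ρ_periodic : ∀ t ∈ Icc 0 τ, Function.Periodic (ρ t) a
  Q_periodic : ∀ t ∈ Icc 0 τ, Function.Periodic (Q t) a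
  ρ_evolution : ∀ t ∈ Ioo 0 τ, ∀ u, HasDerivAt (fun s => ρ s u)
    (-(1 / 2) * MvPolynomial.aeval (fun i => (arcDeriv (ρ t))^[i] (Q t) u) lengthRate * ρ t u) t
  Q_evolution : ∀ t ∈ Ioo 0 τ, ∀ u, HasDerivAt (fun s => Q s u)
    (MvPolynomial.aeval (fun i => (arcDeriv (ρ t))^[i] (Q t) u) (jetRate 0)) t

namespace LengtheningFlow

variable (M : LengtheningFlow)

/-- The curve at time `t`. -/
def profile {t : ℝ} (ht : t ∈ Icc 0 M.τ) : Profile where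
  a := M.a
  ρ := M.ρ t
  Q := M.Q t
  a_pos := M.a_pos
  ρ_smooth := M.ρ_smooth.contDiff ht
  Q_smooth := M.Q_smooth.contDiff ht
  ρ_pos := M.ρ_pos t ht
  ρ_periodic := M.ρ_periodic t ht
  Q_periodic := M.Q_periodic t ht

/-- The `i`-th derivative of `Q` at time `t`. -/
def jet (i : ℕ) (t u : ℝ) : ℝ := (arcDeriv (M.ρ t))^[i] (M.Q t) u

/-- The value of a differential polynomial at time `t`. -/
def eval (F : MvPolynomial ℕ ℝ) (t u : ℝ) : ℝ := MvPolynomial.aeval (fun i => M.jet i t u) F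

/-- The integral of a differential polynomial at time `t`. -/
def integral (F : MvPolynomial ℕ ℝ) (t : ℝ) : ℝ :=
  ∫ u in (0 : ℝ)..M.a, M.eval F t u * M.ρ t u

lemma profile_integral {t : ℝ} (ht : t ∈ Icc 0 M.τ) (F : MvPolynomial ℕ ℝ) :
    (M.profile ht).integral F = M.integral F t := rfl

lemma uniqueDiffOn : UniqueDiffOn ℝ (Icc 0 M.τ) := uniqueDiffOn_Icc M.τ_pos

lemma jet_succ (i : ℕ) (t u : ℝ) : M.jet (i + 1) t u = deriv (M.jet i t) u / M.ρ t u := by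
  simp only [jet, Function.iterate_succ_apply']
  rfl

lemma smooth_jet (i : ℕ) : SmoothFamily (Icc 0 M.τ) (M.jet i) := by
  induction i with
  | zero => exact M.Q_smooth
  | succ i ih =>
    have h : SmoothFamily (Icc 0 M.τ) fun t u => deriv (M.jet i t) u / M.ρ t u :=
      ContDiffOn.div (ih.deriv_right M.uniqueDiffOn) M.ρ_smooth
        fun z hz => (M.ρ_pos z.1 hz.1 z.2).ne'
    exact h.congr fun t _ u => M.jet_succ i t u

lemma smooth_eval (F : MvPolynomial ℕ ℝ) : SmoothFamily (Icc 0 M.τ) (M.eval F) := by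
  induction F using MvPolynomial.induction_on with
  | C r =>
    have h : SmoothFamily (Icc 0 M.τ) fun _ _ => r := contDiffOn_const
    exact h.congr fun t _ u => by simp [eval]
  | add F G hF hG =>
    exact SmoothFamily.congr (f := fun t u => M.eval F t u + M.eval G t u)
      (ContDiffOn.add hF hG) fun t _ u => by simp [eval]
  | mul_X F i hF =>
    exact SmoothFamily.congr (f := fun t u => M.eval F t u * M.jet i t u)
      (ContDiffOn.mul hF (M.smooth_jet i)) fun t _ u => by simp [eval]

lemma smooth_integrand (F : MvPolynomial ℕ ℝ) :
    SmoothFamily (Icc 0 M.τ) fun t u => M.eval F t u * M.ρ t u :=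
  ContDiffOn.mul (M.smooth_eval F) M.ρ_smooth

/-- As ∂_s = ρ⁻¹∂_u and ∂_t ρ = -½Pρ, the commutator of ∂_t and ∂_s is ½P∂_s; this is the recursion
that defines `jetRate`. -/
lemma hasDerivAt_jet (i : ℕ) {t : ℝ} (ht : t ∈ Ioo 0 M.τ) (u : ℝ) :
    HasDerivAt (fun s => M.jet i s u) (M.eval (jetRate i) t u) t := by
  induction i generalizing u with
  | zero => exact M.Q_evolution t ht u
  | succ i ih =>
    have htc := Ioo_subset_Icc_self ht
    have hρ := (M.ρ_pos t htc u).ne'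
    have h1 := ((M.smooth_jet i).mono Ioo_subset_Icc_self).hasDerivAt_deriv_right isOpen_Ioo ht u
    have e1 : (fun v => deriv (fun s => M.jet i s v) t) = fun v => M.eval (jetRate i) t v :=
      funext fun v => (ih v).deriv
    have e2 : deriv (fun v => M.eval (jetRate i) t v) u =
        M.ρ t u * M.eval (totalDeriv (jetRate i)) t u :=
      ((M.profile htc).hasDerivAt_eval (jetRate i) u).deriv
    rw [e1, e2] at h1
    have h2 := h1.div (M.ρ_evolution t ht u) hρ
    have e3 : (fun s => M.jet (i + 1) s u) = (fun s => deriv (M.jet i s) u) / fun s => M.ρ s u :=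
      funext fun s => M.jet_succ i s u
    rw [e3]
    refine h2.congr_deriv ?_
    have e4 : deriv (M.jet i t) u = M.jet (i + 1) t u * M.ρ t u := by
      rw [M.jet_succ, div_mul_cancel₀ _ hρ]
    have e5 : M.eval (jetRate (i + 1)) t u = M.eval (totalDeriv (jetRate i)) t u +
        1 / 2 * (M.eval lengthRate t u * M.jet (i + 1) t u) := by
      simp [eval, jetRate]
    rw [e4, e5]
    change (_ - _ * (-(1 / 2) * M.eval lengthRate t u * M.ρ t u)) / _ = _
    field_simp
    ring

lemma hasDerivAt_eval (F : MvPolynomial ℕ ℝ) {t : ℝ} (ht : t ∈ Ioo 0 M.τ) (u : ℝ) :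
    HasDerivAt (fun s => M.eval F s u) (M.eval (timeDeriv F) t u) t := by
  induction F using MvPolynomial.induction_on with
  | C r => simpa [eval] using hasDerivAt_const t r
  | add F G hF hG =>
    have e : (fun s => M.eval (F + G) s u) = (fun s => M.eval F s u) + fun s => M.eval G s u := by
      funext s; simp [eval]
    rw [e]
    refine (hF.add hG).congr_deriv ?_
    simp [eval]
  | mul_X F i hF =>
    have e : (fun s => M.eval (F * X i) s u) = (fun s => M.eval F s u) * fun s => M.jet i s u := by
      funext s; simp [eval]
    rw [e]
    refine (hF.mul (M.hasDerivAt_jet i ht u)).congr_deriv ?_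
    simp [eval, Derivation.leibniz]
    ring

lemma hasDerivAt_integral (F : MvPolynomial ℕ ℝ) {t : ℝ} (ht : t ∈ Ioo 0 M.τ) :
    HasDerivAt (M.integral F) (M.integral (densityRate F) t) t := by
  have h := ((M.smooth_integrand F).mono Ioo_subset_Icc_self).hasDerivAt_integral isOpen_Ioo ht M.a
  have e : ∀ u, deriv (fun s => M.eval F s u * M.ρ s u) t =
      M.eval (densityRate F) t u * M.ρ t u := by
    intro u
    refine (((M.hasDerivAt_eval F ht u).mul (M.ρ_evolution t ht u)).congr_deriv ?_).deriv
    change _ + _ * (-(1 / 2) * M.eval lengthRate t u * M.ρ t u) = _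
    simp [eval, densityRate]
    ring
  simp only [e] at h
  exact h

lemma continuousOn_integral (F : MvPolynomial ℕ ℝ) :
    ContinuousOn (M.integral F) (Icc 0 M.τ) :=
  (M.smooth_integrand F).continuousOn_integral M.a

/-! ### A priori estimates -/

lemma zero_mem : (0 : ℝ) ∈ Icc 0 M.τ := ⟨le_rfl, M.τ_pos.le⟩

/-- `∫ (Q^{(p)})² ds` at time `t`. -/
def sobolev (p : ℕ) (t : ℝ) : ℝ := M.integral (X p ^ 2) t

/-- The length at time `t`. -/
def length (t : ℝ) : ℝ := M.integral 1 t

/-- The variance at time `t`. -/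
def variance (t : ℝ) : ℝ := M.sobolev 0 t - M.integral (X 0) t ^ 2 / M.length t

/-- Only continuity is needed at the endpoints: the evolution equations are available in the open
interval, while the estimates start from the initial curve. -/
lemma _root_.Inversive.le_of_hasDerivAt_nonpos {f f' : ℝ → ℝ} {s t : ℝ} (hst : s ≤ t)
    (hc : ContinuousOn f (Icc s t)) (hd : ∀ x ∈ Ioo s t, HasDerivAt f (f' x) x)
    (hf : ∀ x ∈ Ioo s t, f' x ≤ 0) : f t ≤ f s := by
  refine antitoneOn_of_deriv_nonpos (convex_Icc s t) hc ?_ ?_ (left_mem_Icc.2 hst)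
    (right_mem_Icc.2 hst) hst
  · rw [interior_Icc]
    exact fun x hx => (hd x hx).differentiableAt.differentiableWithinAt
  · rw [interior_Icc]
    exact fun x hx => (hd x hx).deriv.trans_le (hf x hx)

/-- The length has rate E_1 ≥ 0, so the initial length is a lower bound for all time. -/
lemma length_zero_le {t : ℝ} (ht : t ∈ Icc 0 M.τ) : M.length 0 ≤ M.length t := by
  have h := le_of_hasDerivAt_nonpos (f := fun s => -M.length s)
    (f' := fun s => -M.integral (densityRate 1) s) ht.1
    ((M.continuousOn_integral 1).mono (Icc_subset_Icc_right ht.2)).neg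
    (fun x hx => (M.hasDerivAt_integral 1 ⟨hx.1, hx.2.trans_le ht.2⟩).neg) fun x hx => by
      have hx' : x ∈ Icc 0 M.τ := ⟨hx.1.le, hx.2.le.trans ht.2⟩
      rw [← M.profile_integral hx', (M.profile hx').integral_densityRate_one]
      exact neg_nonpos.2 ((M.profile hx').sobolev_nonneg 1)
  linarith

/-- The rate of ∫Q² ds is minus the dissipation. -/
lemma sobolev_zero_le {t : ℝ} (ht : t ∈ Icc 0 M.τ) : M.sobolev 0 t ≤ M.sobolev 0 0 :=
  le_of_hasDerivAt_nonpos (f := M.sobolev 0) ht.1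
    ((M.continuousOn_integral _).mono (Icc_subset_Icc_right ht.2))
    (fun x hx => M.hasDerivAt_integral _ ⟨hx.1, hx.2.trans_le ht.2⟩) fun x hx => by
      have hx' : x ∈ Icc 0 M.τ := ⟨hx.1.le, hx.2.le.trans ht.2⟩
      rw [← M.profile_integral hx', (M.profile hx').integral_densityRate_sq]
      exact neg_nonpos.2 (M.profile hx').dissipation_nonneg

/-- The mean minimizes q ↦ ∫(Q - q)² ds, so the variation of the mean drops out: the rate is that of
∫(Q - q)² ds with q frozen at the mean. -/
lemma hasDerivAt_variance {t : ℝ} (ht : t ∈ Ioo 0 M.τ) :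
    HasDerivAt M.variance (M.integral (densityRate (X 0 ^ 2)) t -
      2 * (M.integral (X 0) t / M.length t) * M.integral (densityRate (X 0)) t +
      (M.integral (X 0) t / M.length t) ^ 2 * M.integral (densityRate 1) t) t := by
  have hl : M.length t ≠ 0 := (M.profile (Ioo_subset_Icc_self ht)).length_pos.ne'
  refine ((M.hasDerivAt_integral (X 0 ^ 2) ht).sub
    (((M.hasDerivAt_integral (X 0) ht).pow 2).div (M.hasDerivAt_integral 1 ht) hl)).congr_deriv ?_
  change _ - (_ * M.length t - _) / M.length t ^ 2 = _
  field_simp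
  simp
  ring

lemma continuousOn_variance : ContinuousOn M.variance (Icc 0 M.τ) :=
  (M.continuousOn_integral _).sub (((M.continuousOn_integral _).pow 2).div
    (M.continuousOn_integral _) fun _ ht => (M.profile ht).length_pos.ne')

/-- The bound of the higher energies by their initial values. -/
lemma _root_.Inversive.exists_sobolev_le_initial (p : ℕ) (hp : 1 ≤ p) {K ℓ₀ : ℝ} (hK : 0 ≤ K)
    (hℓ : 0 < ℓ₀) : ∃ c : ℝ, ∀ M : LengtheningFlow, M.sobolev 0 0 = K → M.length 0 = ℓ₀ →
      ∀ t ∈ Icc 0 M.τ, M.sobolev p t ≤ c * M.sobolev p 0 := by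
  obtain ⟨A, hA, hE⟩ := exists_integral_densityRate_le p hp hK hℓ
  set B : ℝ := 4 * (K / ℓ₀) * (1 / ℓ₀ + 11) with hB
  have hB0 : 0 ≤ B := by positivity
  refine ⟨1 + A * Real.exp (B * K) * (ℓ₀ ^ 2) ^ p, fun M hMK hMℓ t ht => ?_⟩
  -- The Lyapunov function is E_p + A exp(B E_0) V. As ∂_t E_0 = -D, the exponential weight
  -- contributes -B V D times itself and cancels the bad term of the variance inequality.
  have h := le_of_hasDerivAt_nonpos
    (f := fun s => M.sobolev p s + A * (Real.exp (B * M.sobolev 0 s) * M.variance s)) ht.1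
    (((M.continuousOn_integral _).add (continuousOn_const.mul
      ((Real.continuous_exp.comp_continuousOn
        (continuousOn_const.mul (M.continuousOn_integral _))).mul M.continuousOn_variance))).mono
          (Icc_subset_Icc_right ht.2))
    (fun x hx => (M.hasDerivAt_integral (X p ^ 2) ⟨hx.1, hx.2.trans_le ht.2⟩).add
      ((((M.hasDerivAt_integral (X 0 ^ 2) ⟨hx.1, hx.2.trans_le ht.2⟩).const_mul B).exp.mul
        (M.hasDerivAt_variance ⟨hx.1, hx.2.trans_le ht.2⟩)).const_mul A)) ?_
  · set Λ := M.profile M.zero_mem with hΛ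
    -- Iterated Poincaré inequality at time zero, where the length is exactly ℓ₀.
    have hv : M.variance 0 ≤ (ℓ₀ ^ 2) ^ p * M.sobolev p 0 := by
      rw [← hMℓ]
      exact Λ.variance_le_sobolev hp
    have hv' : 0 ≤ M.variance t := (M.profile ht).variance_nonneg
    have : A * (Real.exp (B * K) * M.variance 0) ≤
        A * (Real.exp (B * K) * ((ℓ₀ ^ 2) ^ p * M.sobolev p 0)) := by gcongr
    have h0 : 0 ≤ A * (Real.exp (B * M.sobolev 0 t) * M.variance t) := by positivity
    simp only [hMK] at h
    linarith
  · intro x hx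
    have hx' : x ∈ Icc 0 M.τ := ⟨hx.1.le, hx.2.le.trans ht.2⟩
    set Λ := M.profile hx' with hΛ
    have hΛK : Λ.sobolev 0 ≤ K := hMK ▸ M.sobolev_zero_le hx'
    have hΛℓ : ℓ₀ ≤ Λ.length := hMℓ ▸ M.length_zero_le hx'
    have h1 : M.integral (densityRate (X p ^ 2)) x ≤
      -(1 / 4) * Λ.sobolev (p + 3) + A * Λ.sobolev 1 := hE Λ hΛK hΛℓ
    have h2 := Λ.variance_rate_le hℓ hΛK hΛℓ
    rw [← hB] at h2
    have h3 : M.integral (densityRate (X 0 ^ 2)) x = -Λ.dissipation := Λ.integral_densityRate_sq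
    change _ + A * (Real.exp (B * Λ.sobolev 0) * (B * M.integral (densityRate (X 0 ^ 2)) x) *
      Λ.variance + Real.exp (B * Λ.sobolev 0) * (Λ.integral (densityRate (X 0 ^ 2)) -
        2 * Λ.mean * Λ.integral (densityRate (X 0)) +
          Λ.mean ^ 2 * Λ.integral (densityRate 1))) ≤ 0
    rw [h3]
    set e := Real.exp (B * Λ.sobolev 0) with he
    have he1 : 1 ≤ e := Real.one_le_exp (mul_nonneg hB0 (Λ.sobolev_nonneg 0))
    have h4 := mul_le_mul_of_nonneg_left h2 (zero_le_one.trans he1)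
    -- After the cancellation -e E_1 is left, and e ≥ 1 because E_0 ≥ 0; this pays for the error A
    -- E_1 in the rate of E_p.
    have h5 : e * (B * -Λ.dissipation) * Λ.variance + e * (Λ.integral (densityRate (X 0 ^ 2)) -
        2 * Λ.mean * Λ.integral (densityRate (X 0)) +
          Λ.mean ^ 2 * Λ.integral (densityRate 1)) ≤ -Λ.sobolev 1 := by
      nlinarith [mul_le_mul_of_nonneg_right he1 (Λ.sobolev_nonneg 1)]
    have h6 := mul_le_mul_of_nonneg_left h5 hA
    have h7 := Λ.sobolev_nonneg (p + 3)
    linarith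

/-- The smoothing estimate. -/
lemma _root_.Inversive.exists_sobolev_le_smoothing (p : ℕ) (hp : 1 ≤ p) {K ℓ₀ : ℝ} (hK : 0 ≤ K)
    (hℓ : 0 < ℓ₀) : ∃ c : ℝ, 0 ≤ c ∧ ∀ M : LengtheningFlow, M.sobolev 0 0 = K →
      M.length 0 = ℓ₀ → ∀ t ∈ Icc 0 M.τ, 0 < t →
        M.sobolev p t ≤ c * (1 + t ^ (-(p : ℝ) / 3)) := by
  obtain ⟨A, hA, hE⟩ := exists_integral_densityRate_le p hp hK hℓ
  -- Chosen so that (p+1)/κ = 1/8 in the interpolation of E_p.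
  set κ : ℝ := 8 * (p + 1) with hκ
  have hκ1 : 1 ≤ κ := by
    rw [hκ]; have : (0 : ℝ) ≤ p := Nat.cast_nonneg p
    linarith
  set c₁ : ℝ := (p + 1) * κ ^ p * K with hc₁
  set c₂ : ℝ := A * ((8 * A + 1) * K) with hc₂
  have hc₁0 : 0 ≤ c₁ := by positivity
  have hc₂0 : 0 ≤ c₂ := by positivity
  refine ⟨c₁ + c₂, by positivity, fun M hMK hMℓ t ht ht0 => ?_⟩
  -- The argument runs on the window [t - h, t]; capping its length at 1 keeps the bound uniform for
  -- large t.
  set h : ℝ := min 1 t with hh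
  have hh0 : 0 < h := lt_min one_pos ht0
  have hh1 : h ≤ 1 := min_le_left _ _
  have hht : h ≤ t := min_le_right _ _
  set ζ : ℝ := h ^ (1 / 3 : ℝ) with hζ
  have hζ0 : 0 < ζ := Real.rpow_pos_of_pos hh0 _
  have cube : ∀ x : ℝ, 0 ≤ x → (x ^ (1 / 3 : ℝ)) ^ 3 = x := fun x hx => by
    rw [← Real.rpow_natCast, ← Real.rpow_mul hx]; norm_num
  have hζ3 : ζ ^ 3 = h := cube h hh0.le
  -- With θ = x - (t - h), this bounds the derivative of θ^{p+1}E_p by a constant. The weight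
  -- vanishes at the start of the window, so no initial value of E_p enters.
  have hE' : ∀ x ∈ Ioo (t - h) t,
      (↑(p + 1) * (x - (t - h)) ^ (p + 1 - 1) * 1) * M.sobolev p x +
        (x - (t - h)) ^ (p + 1) * M.integral (densityRate (X p ^ 2)) x -
          (c₁ * ζ ^ (2 * p) + c₂ * h ^ (p + 1)) * 1 ≤ 0 := by
    intro x hx
    have hx' : x ∈ Icc 0 M.τ := ⟨by linarith [hx.1], hx.2.le.trans ht.2⟩
    set θ : ℝ := x - (t - h) with hθ
    have hθ0 : 0 < θ := sub_pos.2 hx.1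
    have hθh : θ ≤ h := by rw [hθ]; linarith [hx.2]
    set Λ := M.profile hx' with hΛ
    have hΛK : Λ.sobolev 0 ≤ K := hMK ▸ M.sobolev_zero_le hx'
    have hΛℓ : ℓ₀ ≤ Λ.length := hMℓ ▸ M.length_zero_le hx'
    have h1 : M.integral (densityRate (X p ^ 2)) x ≤
      -(1 / 4) * Λ.sobolev (p + 3) + A * Λ.sobolev 1 := hE Λ hΛK hΛℓ
    have hM0 := Λ.sobolev_nonneg (p + 3)
    set η : ℝ := θ ^ (1 / 3 : ℝ) with hη
    have hη0 : 0 < η := Real.rpow_pos_of_pos hθ0 _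
    have hη3 : η ^ 3 = θ := cube θ hθ0.le
    have hηζ : η ≤ ζ := Real.rpow_le_rpow hθ0.le hθh (by norm_num)
    -- At scale y = θ^{1/3}/κ the cube y³ is at most θ/κ, so the top-order part of (p+1)θ^p E_p is
    -- at most ⅛θ^{p+1}E_{p+3}; the rest is of order θ^{p - p/3} = θ^{2p/3}.
    have i1 := logConvex_interpolation Λ.sobolev_nonneg Λ.sobolev_logConvex
      (show p ≤ p + 3 by omega) (y := η / κ) (by positivity)
    rw [show p + 3 - p = 3 by omega] at i1
    -- This fixed scale makes A y^{p+2} ≤ 1/8. The two eighths together use up the good term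
    -- ¼E_{p+3}.
    have i2 := logConvex_interpolation Λ.sobolev_nonneg Λ.sobolev_logConvex
      (show 1 ≤ p + 3 by omega) (y := (8 * A + 1)⁻¹) (by positivity)
    have j1 : (p + 1) * θ ^ p * Λ.sobolev p ≤
        1 / 8 * θ ^ (p + 1) * Λ.sobolev (p + 3) + c₁ * ζ ^ (2 * p) := by
      have s1 : (η / κ) ^ 3 ≤ θ / κ := by
        rw [div_pow, hη3]
        gcongr
        exact le_self_pow₀ hκ1 (by norm_num)
      have s2 : (p + 1) * θ ^ p * ((η / κ) ^ 3 * Λ.sobolev (p + 3)) ≤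
          1 / 8 * θ ^ (p + 1) * Λ.sobolev (p + 3) := by
        calc _ ≤ (p + 1) * θ ^ p * ((θ / κ) * Λ.sobolev (p + 3)) := by gcongr
          _ = _ := by
            rw [hκ]
            field_simp
            ring
      have s3 : (p + 1) * θ ^ p * (((η / κ) ^ p)⁻¹ * Λ.sobolev 0) ≤ c₁ * ζ ^ (2 * p) := by
        calc _ ≤ (p + 1) * θ ^ p * (((η / κ) ^ p)⁻¹ * K) := by gcongr
          _ = c₁ * η ^ (2 * p) := by
            have e : θ ^ p = η ^ (2 * p) * η ^ p := by rw [← hη3]; ring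
            rw [hc₁, e, div_pow, inv_div]
            field_simp
          _ ≤ _ := by gcongr
      calc _ ≤ (p + 1) * θ ^ p * ((η / κ) ^ 3 * Λ.sobolev (p + 3) +
            ((η / κ) ^ p)⁻¹ * Λ.sobolev 0) := by gcongr
        _ ≤ _ := by linarith
    have j2 : A * Λ.sobolev 1 ≤ 1 / 8 * Λ.sobolev (p + 3) + c₂ := by
      have s1 : A * ((8 * A + 1)⁻¹ ^ (p + 3 - 1) * Λ.sobolev (p + 3)) ≤
          1 / 8 * Λ.sobolev (p + 3) := by
        rw [← mul_assoc]
        refine mul_le_mul_of_nonneg_right ?_ hM0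
        have : (8 * A + 1)⁻¹ ^ (p + 3 - 1) ≤ (8 * A + 1)⁻¹ :=
          pow_le_of_le_one (by positivity) (inv_le_one_of_one_le₀ (by linarith)) (by omega)
        calc _ ≤ A * (8 * A + 1)⁻¹ := by gcongr
          _ ≤ 1 / 8 := by
            rw [← div_eq_mul_inv, div_le_div_iff₀ (by positivity) (by norm_num)]
            linarith
      have s2 : A * (((8 * A + 1)⁻¹ ^ 1)⁻¹ * Λ.sobolev 0) ≤ c₂ := by
        rw [pow_one, inv_inv, hc₂]
        gcongr
      calc _ ≤ _ := mul_le_mul_of_nonneg_left i2 hA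
        _ ≤ _ := by rw [mul_add]; exact add_le_add s1 s2
    have hθp : 0 ≤ θ ^ (p + 1) := by positivity
    have hθhp : θ ^ (p + 1) ≤ h ^ (p + 1) := by gcongr
    have j3 := mul_le_mul_of_nonneg_left h1 hθp
    have j4 := mul_le_mul_of_nonneg_left j2 hθp
    have j5 := mul_le_mul_of_nonneg_right hθhp hc₂0
    have e : M.sobolev p x = Λ.sobolev p := rfl
    rw [e, Nat.add_sub_cancel]
    push_cast
    linarith
  have hfin := le_of_hasDerivAt_nonpos
    (f := fun x => (x - (t - h)) ^ (p + 1) * M.sobolev p x -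
      (c₁ * ζ ^ (2 * p) + c₂ * h ^ (p + 1)) * x) (s := t - h) (t := t) (by linarith)
    (((by fun_prop : ContinuousOn (fun x => (x - (t - h)) ^ (p + 1)) _).mul
      ((M.continuousOn_integral _).mono (Icc_subset_Icc (by linarith) ht.2))).sub (by fun_prop))
    (fun x hx => ((((hasDerivAt_id x).sub_const (t - h)).pow (p + 1)).mul
      (M.hasDerivAt_integral (X p ^ 2) ⟨by linarith [hx.1], hx.2.trans_le ht.2⟩)).sub
        ((hasDerivAt_id x).const_mul _)) hE'
  simp only [sub_sub_cancel, sub_self, ne_eq, Nat.add_eq_zero_iff, one_ne_zero, and_false,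
    not_false_eq_true, zero_pow, zero_mul, zero_sub] at hfin
  have hmain : h ^ (p + 1) * M.sobolev p t ≤ h * (c₁ * ζ ^ (2 * p) + c₂ * h ^ (p + 1)) := by
    linarith
  -- Division by h^{p+1} = ζ^{3p+3} turns h ζ^{2p} = ζ^{2p+3} into ζ^{-p} = h^{-p/3}.
  have hbound : M.sobolev p t ≤ c₁ * (ζ ^ p)⁻¹ + c₂ := by
    have hpos : 0 < h ^ (p + 1) := by positivity
    refine le_of_mul_le_mul_left (hmain.trans ?_) hpos
    have e1 : h ^ (p + 1) * (c₁ * (ζ ^ p)⁻¹ + c₂) = h * (c₁ * ζ ^ (2 * p)) + h ^ (p + 1) * c₂ := by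
      rw [← hζ3]
      field_simp
      ring
    rw [e1]
    have : h * (c₂ * h ^ (p + 1)) ≤ 1 * (c₂ * h ^ (p + 1)) := by gcongr
    linarith
  have hζt : (ζ ^ p)⁻¹ ≤ 1 + t ^ (-(p : ℝ) / 3) := by
    rcases le_total t 1 with h1 | h1
    · have e : h = t := min_eq_right h1
      have : (ζ ^ p)⁻¹ = t ^ (-(p : ℝ) / 3) := by
        rw [hζ, e, ← Real.rpow_natCast, ← Real.rpow_mul ht0.le, ← Real.rpow_neg ht0.le]
        congr 1
        ring
      rw [this]; linarith
    · have e : h = 1 := min_eq_left h1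
      have : ζ = 1 := by rw [hζ, e, Real.one_rpow]
      rw [this]
      simpa using Real.rpow_nonneg ht0.le _
  have ht3 : 0 ≤ t ^ (-(p : ℝ) / 3) := Real.rpow_nonneg ht0.le _
  calc M.sobolev p t ≤ c₁ * (ζ ^ p)⁻¹ + c₂ := hbound
    _ ≤ c₁ * (1 + t ^ (-(p : ℝ) / 3)) + c₂ * (1 + t ^ (-(p : ℝ) / 3)) := by
      refine add_le_add (mul_le_mul_of_nonneg_left hζt hc₁0) ?_
      nlinarith
    _ = _ := by ring

/-- The energy estimate for the flow. -/
theorem exists_sobolev_le (p : ℕ) (hp : 1 ≤ p) (ℓ₀ K : ℝ) :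
    ∃ c : ℝ, 1 ≤ c ∧ ∀ M : LengtheningFlow, M.length 0 = ℓ₀ → M.sobolev 0 0 = K →
      ∀ t ∈ Icc 0 M.τ, 0 < t →
        M.sobolev p t ≤ c * min (M.sobolev p 0) (1 + t ^ (-(p : ℝ) / 3)) := by
  by_cases hpos : 0 < ℓ₀ ∧ 0 ≤ K
  · obtain ⟨c, hc⟩ := exists_sobolev_le_initial p hp hpos.2 hpos.1
    obtain ⟨d, hd, hd'⟩ := exists_sobolev_le_smoothing p hp hpos.2 hpos.1
    refine ⟨max 1 (max c d), le_max_left _ _, fun M hℓ hK t ht ht0 => ?_⟩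
    have h0 : 0 ≤ max 1 (max c d) := zero_le_one.trans (le_max_left _ _)
    rw [mul_min_of_nonneg _ _ h0]
    have hE : 0 ≤ M.sobolev p 0 := (M.profile M.zero_mem).sobolev_nonneg p
    have ht3 : 0 ≤ t ^ (-(p : ℝ) / 3) := Real.rpow_nonneg ht0.le _
    refine le_min ((hc M hK hℓ t ht).trans ?_) ((hd' M hK hℓ t ht ht0).trans ?_)
    · exact mul_le_mul_of_nonneg_right ((le_max_left _ _).trans (le_max_right _ _)) hE
    · exact mul_le_mul_of_nonneg_right ((le_max_right _ _).trans (le_max_right _ _))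
        (by linarith)
  -- No flow has nonpositive initial length or negative initial energy.
  · refine ⟨1, le_rfl, fun M hℓ hK t ht ht0 => absurd ⟨?_, ?_⟩ hpos⟩
    · exact hℓ ▸ (M.profile M.zero_mem).length_pos
    · exact hK ▸ (M.profile M.zero_mem).sobolev_nonneg 0

end LengtheningFlow

end Inversive

end

/-! ### From curves to invariants: the Schwarzian derivative of a lift. -/

noncomputable section

namespace Inversive

/-! ### The Schwarzian derivative of a lift -/

/-- The determinant of two vectors in the plane. -/
def det2 (v w : Fin 2 → ℂ) : ℂ := v 0 * w 1 - v 1 * w 0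

lemma det2_self (v : Fin 2 → ℂ) : det2 v v = 0 := by simp [det2]; ring

lemma det2_add_left (v v' w : Fin 2 → ℂ) : det2 (v + v') w = det2 v w + det2 v' w := by
  simp [det2]; ring

lemma det2_add_right (v w w' : Fin 2 → ℂ) : det2 v (w + w') = det2 v w + det2 v w' := by
  simp [det2]; ring

lemma det2_smul_left (c : ℂ) (v w : Fin 2 → ℂ) : det2 (c • v) w = c * det2 v w := by
  simp [det2]; ring

lemma det2_smul_right (c : ℂ) (v w : Fin 2 → ℂ) : det2 v (c • w) = c * det2 v w := by
  simp [det2]; ring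

/-- The expansion of a vector in a basis of the plane. -/
lemma eq_smul_add_smul {v w : Fin 2 → ℂ} (h : det2 v w ≠ 0) (x : Fin 2 → ℂ) :
    x = (det2 x w / det2 v w) • v + (det2 v x / det2 v w) • w := by
  ext i
  simp only [Pi.add_apply, Pi.smul_apply, smul_eq_mul]
  field_simp
  fin_cases i <;> simp [det2] <;> ring

lemma eq_of_smul_add_smul {v w : Fin 2 → ℂ} (h : det2 v w ≠ 0) {a b c d : ℂ}
    (e : a • v + b • w = c • v + d • w) : a = c ∧ b = d := by
  have h1 := congrArg (fun x => det2 x w) e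
  have h2 := congrArg (fun x => det2 v x) e
  simp only [det2_add_left, det2_add_right, det2_smul_left, det2_smul_right, det2_self, mul_zero,
    add_zero, zero_add] at h1 h2
  exact ⟨mul_right_cancel₀ h h1, mul_right_cancel₀ h h2⟩

/-- The coefficient `A` in the equation `W'' = A W + B W'`. -/
def coeffA (W : ℝ → Fin 2 → ℂ) (u : ℝ) : ℂ :=
  det2 (deriv (deriv W) u) (deriv W u) / det2 (W u) (deriv W u)

/-- The coefficient `B` in the equation `W'' = A W + B W'`. -/
def coeffB (W : ℝ → Fin 2 → ℂ) (u : ℝ) : ℂ :=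
  det2 (W u) (deriv (deriv W) u) / det2 (W u) (deriv W u)

/-- Half the Schwarzian derivative of the curve with lift `W`. -/
def halfSchwarzian (W : ℝ → Fin 2 → ℂ) (u : ℝ) : ℂ :=
  -coeffA W u + deriv (coeffB W) u / 2 - coeffB W u ^ 2 / 4

section Lifts

variable {W : ℝ → Fin 2 → ℂ}

lemma deriv_deriv_eq (h : ∀ u, det2 (W u) (deriv W u) ≠ 0) (u : ℝ) :
    deriv (deriv W) u = coeffA W u • W u + coeffB W u • deriv W u :=
  eq_smul_add_smul (h u) _

lemma coeff_eq {A B : ℂ} {u : ℝ} (h : det2 (W u) (deriv W u) ≠ 0)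
    (e : deriv (deriv W) u = A • W u + B • deriv W u) : coeffA W u = A ∧ coeffB W u = B :=
  eq_of_smul_add_smul h ((eq_smul_add_smul h _).symm.trans e)

lemma contDiff_det2 {V W : ℝ → Fin 2 → ℂ} (hV : ContDiff ℝ ∞ V) (hW : ContDiff ℝ ∞ W) :
    ContDiff ℝ ∞ fun u => det2 (V u) (W u) := by
  have hV' := contDiff_pi.1 hV
  have hW' := contDiff_pi.1 hW
  exact ((hV' 0).mul (hW' 1)).sub ((hV' 1).mul (hW' 0))

lemma contDiff_deriv {E : Type*} [NormedAddCommGroup E] [NormedSpace ℝ E] {f : ℝ → E}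
    (hf : ContDiff ℝ ∞ f) : ContDiff ℝ ∞ (deriv f) :=
  (contDiff_infty_iff_deriv.1 hf).2

lemma hasDerivAt_of_contDiff {E : Type*} [NormedAddCommGroup E] [NormedSpace ℝ E] {f : ℝ → E}
    (hf : ContDiff ℝ ∞ f) (u : ℝ) : HasDerivAt f (deriv f u) u :=
  (hf.differentiable (by simp) u).hasDerivAt

lemma contDiff_complex_div {f g : ℝ → ℂ} (hf : ContDiff ℝ ∞ f) (hg : ContDiff ℝ ∞ g)
    (h : ∀ u, g u ≠ 0) : ContDiff ℝ ∞ fun u => f u / g u := by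
  simp only [div_eq_mul_inv]
  exact hf.mul (hg.inv h)

lemma contDiff_coeffB (hW : ContDiff ℝ ∞ W) (h : ∀ u, det2 (W u) (deriv W u) ≠ 0) :
    ContDiff ℝ ∞ (coeffB W) :=
  contDiff_complex_div (contDiff_det2 hW (contDiff_deriv (contDiff_deriv hW)))
    (contDiff_det2 hW (contDiff_deriv hW)) h

lemma deriv_smul_lift {φ : ℝ → ℂ} (hφ : ContDiff ℝ ∞ φ) (hW : ContDiff ℝ ∞ W) :
    deriv (fun u => φ u • W u) = fun u => φ u • deriv W u + deriv φ u • W u :=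
  funext fun u => ((hasDerivAt_of_contDiff hφ u).smul (hasDerivAt_of_contDiff hW u)).deriv

/-- The Schwarzian derivative does not depend on the lift. -/
lemma halfSchwarzian_smul {φ : ℝ → ℂ} (hφ : ContDiff ℝ ∞ φ) (h0 : ∀ u, φ u ≠ 0)
    (hW : ContDiff ℝ ∞ W) (h : ∀ u, det2 (W u) (deriv W u) ≠ 0) :
    (∀ u, det2 (φ u • W u) (deriv (fun v => φ v • W v) u) ≠ 0) ∧
      halfSchwarzian (fun u => φ u • W u) = halfSchwarzian W := by
  have hd := deriv_smul_lift hφ hW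
  have hw : ∀ u, det2 (φ u • W u) (deriv (fun v => φ v • W v) u) ≠ 0 := by
    intro u
    rw [hd, det2_add_right, det2_smul_right, det2_smul_right, det2_smul_left, det2_smul_left,
      det2_self, mul_zero, mul_zero, add_zero]
    exact mul_ne_zero (h0 u) (mul_ne_zero (h0 u) (h u))
  refine ⟨hw, ?_⟩
  have hφ' := contDiff_deriv hφ
  have hdd : ∀ u, deriv (deriv (fun v => φ v • W v)) u =
      φ u • deriv (deriv W) u + (2 * deriv φ u) • deriv W u + deriv (deriv φ) u • W u := by
    intro u
    rw [hd]
    refine ((((hasDerivAt_of_contDiff hφ u).smul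
      (hasDerivAt_of_contDiff (contDiff_deriv hW) u)).add
        ((hasDerivAt_of_contDiff hφ' u).smul (hasDerivAt_of_contDiff hW u))).congr_deriv ?_).deriv
    rw [two_mul, add_smul]
    abel
  -- Rescaling the lift shifts B by 2φ_u/φ; the induced changes in B_u/2, B²/4 and A cancel in the
  -- half Schwarzian.
  have hAB : ∀ u, coeffA (fun v => φ v • W v) u = coeffA W u +
        deriv (deriv φ) u / φ u - 2 * (deriv φ u / φ u) ^ 2 - coeffB W u * (deriv φ u / φ u) ∧
      coeffB (fun v => φ v • W v) u = coeffB W u + 2 * (deriv φ u / φ u) := by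
    intro u
    refine coeff_eq (W := fun v => φ v • W v) (hw u) ?_
    rw [hdd, hd, deriv_deriv_eq h u]
    have := h0 u
    ext i
    simp only [Pi.add_apply, Pi.smul_apply, smul_eq_mul]
    field_simp
    ring
  funext u
  have hB : coeffB (fun v => φ v • W v) = fun v => coeffB W v + 2 * (deriv φ v / φ v) :=
    funext fun v => (hAB v).2
  have hdB : deriv (coeffB fun v => φ v • W v) u = deriv (coeffB W) u +
      2 * ((deriv (deriv φ) u * φ u - deriv φ u * deriv φ u) / φ u ^ 2) := by
    rw [hB]
    exact ((hasDerivAt_of_contDiff (contDiff_coeffB hW h) u).add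
      (((hasDerivAt_of_contDiff hφ' u).div (hasDerivAt_of_contDiff hφ u) (h0 u)).const_mul 2)).deriv
  have := h0 u
  rw [halfSchwarzian, halfSchwarzian, hdB, (hAB u).1, (hAB u).2]
  field_simp
  ring

lemma deriv_mulVec (M : Matrix (Fin 2) (Fin 2) ℂ) (hW : ContDiff ℝ ∞ W) :
    deriv (fun u => M *ᵥ W u) = fun u => M *ᵥ deriv W u := by
  funext u
  refine HasDerivAt.deriv (hasDerivAt_pi.2 fun i => ?_)
  have h := hasDerivAt_pi.1 (hasDerivAt_of_contDiff hW u)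
  simp only [Matrix.mulVec, dotProduct, Fin.sum_univ_two]
  exact ((h 0).const_mul _).add ((h 1).const_mul _)

lemma contDiff_mulVec (M : Matrix (Fin 2) (Fin 2) ℂ) (hW : ContDiff ℝ ∞ W) :
    ContDiff ℝ ∞ fun u => M *ᵥ W u := by
  have h := contDiff_pi.1 hW
  refine contDiff_pi.2 fun i => ?_
  simp only [Matrix.mulVec, dotProduct, Fin.sum_univ_two]
  exact (contDiff_const.mul (h 0)).add (contDiff_const.mul (h 1))

lemma det2_mulVec (M : Matrix (Fin 2) (Fin 2) ℂ) (v w : Fin 2 → ℂ) :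
    det2 (M *ᵥ v) (M *ᵥ w) = M.det * det2 v w := by
  simp [det2, Matrix.mulVec, dotProduct, Fin.sum_univ_two, Matrix.det_fin_two]
  ring

/-- The Schwarzian derivative is invariant under Möbius transformations. -/
lemma halfSchwarzian_mulVec {M : Matrix (Fin 2) (Fin 2) ℂ} (hM : M.det ≠ 0)
    (hW : ContDiff ℝ ∞ W) : halfSchwarzian (fun u => M *ᵥ W u) = halfSchwarzian W := by
  have hA : coeffA (fun u => M *ᵥ W u) = coeffA W := by
    funext u
    simp only [coeffA, deriv_mulVec M hW, deriv_mulVec M (contDiff_deriv hW), det2_mulVec]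
    exact mul_div_mul_left _ _ hM
  have hB : coeffB (fun u => M *ᵥ W u) = coeffB W := by
    funext u
    simp only [coeffB, deriv_mulVec M hW, deriv_mulVec M (contDiff_deriv hW), det2_mulVec]
    exact mul_div_mul_left _ _ hM
  funext u
  simp only [halfSchwarzian, hA, hB]

lemma halfSchwarzian_comp_add (W : ℝ → Fin 2 → ℂ) (a u : ℝ) :
    halfSchwarzian (fun v => W (v + a)) u = halfSchwarzian W (u + a) := by
  have h1 : deriv (fun v => W (v + a)) = fun v => deriv W (v + a) :=
    funext fun v => deriv_comp_add_const W a v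
  have h2 : deriv (fun v => deriv W (v + a)) = fun v => deriv (deriv W) (v + a) :=
    funext fun v => deriv_comp_add_const (deriv W) a v
  have hA : coeffA (fun v => W (v + a)) = fun v => coeffA W (v + a) := by
    funext v; simp only [coeffA, h1, h2]
  have hB : coeffB (fun v => W (v + a)) = fun v => coeffB W (v + a) := by
    funext v; simp only [coeffB, h1, h2]
  have h3 : deriv (fun v => coeffB W (v + a)) = fun v => deriv (coeffB W) (v + a) :=
    funext fun v => deriv_comp_add_const (coeffB W) a v
  simp only [halfSchwarzian, hA, hB, h3]

end Lifts

/-! ### Hermitian products -/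

lemma hermitian_eq (v w : Fin 2 → ℂ) :
    star v ⬝ᵥ w = star (v 0) * w 0 + star (v 1) * w 1 := by
  simp [dotProduct, Fin.sum_univ_two]

lemma contDiff_hermitian {V W : ℝ → Fin 2 → ℂ} (hV : ContDiff ℝ ∞ V) (hW : ContDiff ℝ ∞ W) :
    ContDiff ℝ ∞ fun u => star (V u) ⬝ᵥ W u := by
  have hs : ∀ i, ContDiff ℝ ∞ fun u => star (V u i) := fun i =>
    Complex.conjCLE.contDiff.comp (contDiff_pi.1 hV i)
  simp only [hermitian_eq]
  exact ((hs 0).mul (contDiff_pi.1 hW 0)).add ((hs 1).mul (contDiff_pi.1 hW 1))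

lemma hasDerivAt_hermitian {V W : ℝ → Fin 2 → ℂ} {V' W' : Fin 2 → ℂ} {u : ℝ}
    (hV : HasDerivAt V V' u) (hW : HasDerivAt W W' u) :
    HasDerivAt (fun u => star (V u) ⬝ᵥ W u) (star V' ⬝ᵥ W u + star (V u) ⬝ᵥ W') u := by
  have hs : ∀ i, HasDerivAt (fun u => star (V u i)) (star (V' i)) u := fun i =>
    (hasDerivAt_pi.1 hV i).star
  simp only [hermitian_eq]
  refine (((hs 0).mul (hasDerivAt_pi.1 hW 0)).add
    ((hs 1).mul (hasDerivAt_pi.1 hW 1))).congr_deriv ?_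
  ring

lemma hermitian_self (v : Fin 2 → ℂ) :
    star v ⬝ᵥ v = ((Complex.normSq (v 0) + Complex.normSq (v 1) : ℝ) : ℂ) := by
  rw [hermitian_eq]
  push_cast
  rw [Complex.normSq_eq_conj_mul_self, Complex.normSq_eq_conj_mul_self]
  rfl

lemma hermitian_self_ne_zero {v : Fin 2 → ℂ} (hv : v ≠ 0) : star v ⬝ᵥ v ≠ 0 := by
  rw [hermitian_self, Complex.ofReal_ne_zero]
  intro h
  have h0 := Complex.normSq_nonneg (v 0)
  have h1 := Complex.normSq_nonneg (v 1)
  refine hv (funext fun i => Complex.normSq_eq_zero.1 ?_)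
  fin_cases i
  · exact le_antisymm (by simp; linarith) h0
  · exact le_antisymm (by simp; linarith) h1

lemma hermitian_conj (v w : Fin 2 → ℂ) : star (star v ⬝ᵥ w) = star w ⬝ᵥ v := by
  simp only [hermitian_eq, star_add, star_mul', star_star]
  ring

/-- The expansion of a vector in an orthonormal basis of the plane. -/
lemma eq_hermitian_smul_add {v w : Fin 2 → ℂ} (hv : star v ⬝ᵥ v = 1) (hw : star w ⬝ᵥ w = 1)
    (hvw : star v ⬝ᵥ w = 0) (x : Fin 2 → ℂ) :
    det2 v w ≠ 0 ∧ x = (star v ⬝ᵥ x) • v + (star w ⬝ᵥ x) • w := by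
  have hwv : star w ⬝ᵥ v = 0 := by rw [← hermitian_conj, hvw, star_zero]
  -- Lagrange's identity: the squared modulus of the determinant is the Gram determinant, here 1.
  have hdet : star (det2 v w) * det2 v w = 1 := by
    rw [hermitian_eq] at hv hw hvw hwv
    have : star (det2 v w) = star (v 0) * star (w 1) - star (v 1) * star (w 0) := by
      simp [det2]
    rw [this, det2]
    linear_combination hw + hv * (star (w 0) * w 0 + star (w 1) * w 1) -
      hwv * (star (v 0) * w 0 + star (v 1) * w 1)
  have h0 : det2 v w ≠ 0 := right_ne_zero_of_mul_eq_one hdet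
  refine ⟨h0, ?_⟩
  have hx := eq_smul_add_smul h0 x
  set a := det2 x w / det2 v w
  set b := det2 v x / det2 v w
  have ha : star v ⬝ᵥ x = a := by
    rw [hx, dotProduct_add, dotProduct_smul, dotProduct_smul, hv, hvw]; simp
  have hb : star w ⬝ᵥ x = b := by
    rw [hx, dotProduct_add, dotProduct_smul, dotProduct_smul, hwv, hw]; simp
  rw [ha, hb]
  exact hx

/-! ### Lifts of curves -/

/-- Two lifts are proportional at each point, and Hermitian projection onto W expresses the factor
by a smooth formula. -/
lemma exists_smul_of_isSmoothLift {V W : ℝ → Fin 2 → ℂ} {X : ℝ → CP1} (hV : IsSmoothLift V X)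
    (hW : IsSmoothLift W X) :
    ∃ φ : ℝ → ℂ, ContDiff ℝ ∞ φ ∧ (∀ u, φ u ≠ 0) ∧ V = fun u => φ u • W u := by
  have hW0 : ∀ u, star (W u) ⬝ᵥ W u ≠ 0 := fun u => by
    obtain ⟨h, _⟩ := hW.2 u
    exact hermitian_self_ne_zero h
  have key : ∀ u, ∃ c : ℂ, c ≠ 0 ∧ V u = c • W u := by
    intro u
    obtain ⟨h1, e1⟩ := hV.2 u
    obtain ⟨h2, e2⟩ := hW.2 u
    obtain ⟨c, hc⟩ := (Projectivization.mk_eq_mk_iff ℂ _ _ h1 h2).1 (e1.symm.trans e2)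
    exact ⟨c, c.ne_zero, hc.symm⟩
  have hφ : ∀ u (c : ℂ), V u = c • W u → (star (W u) ⬝ᵥ V u) / (star (W u) ⬝ᵥ W u) = c := by
    intro u c h
    rw [h, dotProduct_smul, smul_eq_mul, mul_div_cancel_right₀ _ (hW0 u)]
  refine ⟨fun u => (star (W u) ⬝ᵥ V u) / (star (W u) ⬝ᵥ W u),
    contDiff_complex_div (contDiff_hermitian hW.1 hV.1) (contDiff_hermitian hW.1 hW.1) hW0, fun u => ?_,
    funext fun u => ?_⟩
  · obtain ⟨c, hc, h⟩ := key u
    simpa only [hφ u c h] using hc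
  · obtain ⟨c, hc, h⟩ := key u
    simpa only [hφ u c h] using h

lemma exists_isHorizontalLift {X : ℝ → CP1} (hX : IsSmoothCurve X) :
    ∃ V, IsHorizontalLift V X := by
  obtain ⟨W, hW, hWX⟩ := hX
  have hW0 : ∀ u, star (W u) ⬝ᵥ W u ≠ 0 := fun u => by
    obtain ⟨h, _⟩ := hWX u
    exact hermitian_self_ne_zero h
  -- The horizontality condition for φW is the linear equation φ_u = gφ, solved below by an
  -- exponential of a primitive.
  set g : ℝ → ℂ := fun u => -(star (W u) ⬝ᵥ deriv W u) / (star (W u) ⬝ᵥ W u) with hg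
  have hgs : ContDiff ℝ ∞ g :=
    contDiff_complex_div (contDiff_hermitian hW (contDiff_deriv hW)).neg
      (contDiff_hermitian hW hW) hW0
  have hprim : ∀ u, HasDerivAt (fun u => ∫ x in (0 : ℝ)..u, g x) (g u) u := fun u =>
    intervalIntegral.integral_hasDerivAt_right (hgs.continuous.intervalIntegrable _ _)
      (hgs.continuous.stronglyMeasurableAtFilter _ _) hgs.continuous.continuousAt
  have hps : ContDiff ℝ ∞ fun u => ∫ x in (0 : ℝ)..u, g x := by
    rw [contDiff_infty_iff_deriv]
    refine ⟨fun u => (hprim u).differentiableAt, ?_⟩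
    rwa [show deriv (fun u => ∫ x in (0 : ℝ)..u, g x) = g from funext fun u => (hprim u).deriv]
  set N : ℝ := Complex.normSq (W 0 0) + Complex.normSq (W 0 1) with hN
  have hNW : star (W 0) ⬝ᵥ W 0 = (N : ℂ) := hermitian_self _
  have hN0 : 0 < N := by
    refine lt_of_le_of_ne (add_nonneg (Complex.normSq_nonneg _) (Complex.normSq_nonneg _)) ?_
    intro h
    apply hW0 0
    rw [hNW, ← h, Complex.ofReal_zero]
  set φ : ℝ → ℂ := fun u => Complex.exp (∫ x in (0 : ℝ)..u, g x) * ((√N)⁻¹ : ℝ) with hφ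
  have hφs : ContDiff ℝ ∞ φ := hps.cexp.mul contDiff_const
  have hφd : ∀ u, HasDerivAt φ (φ u * g u) u := fun u => by
    refine ((hprim u).cexp.mul_const _).congr_deriv ?_
    simp only [hφ]; ring
  have hφ0 : ∀ u, φ u ≠ 0 := fun u => mul_ne_zero (Complex.exp_ne_zero _)
    (Complex.ofReal_ne_zero.2 (inv_ne_zero (Real.sqrt_pos.2 hN0).ne'))
  have hVs : ContDiff ℝ ∞ fun u => φ u • W u := hφs.smul hW
  have hVd : deriv (fun u => φ u • W u) = fun u => φ u • deriv W u + (φ u * g u) • W u :=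
    funext fun u => ((hφd u).smul (hasDerivAt_of_contDiff hW u)).deriv
  have horth : ∀ u, star (φ u • W u) ⬝ᵥ deriv (fun u => φ u • W u) u = 0 := by
    intro u
    rw [hVd]
    simp only [star_smul, smul_dotProduct, dotProduct_add, dotProduct_smul, smul_eq_mul, hg]
    have := hW0 u
    field_simp
    ring
  refine ⟨fun u => φ u • W u, ⟨hVs, fun u => ?_⟩, fun u => ?_, horth⟩
  · obtain ⟨h, e⟩ := hWX u
    refine ⟨smul_ne_zero (hφ0 u) h, e.trans ?_⟩
    exact ((Projectivization.mk_eq_mk_iff' ℂ _ _ _ _).2 ⟨φ u, rfl⟩).symm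
  -- Horizontality makes the norm constant, so normalizing it at u = 0 suffices.
  · have hder : ∀ u, HasDerivAt (fun u => star (φ u • W u) ⬝ᵥ (φ u • W u)) 0 u := by
      intro u
      have h := hasDerivAt_of_contDiff hVs u
      refine (hasDerivAt_hermitian h h).congr_deriv ?_
      rw [← hermitian_conj, horth u, star_zero, add_zero]
    have hconst : star (φ u • W u) ⬝ᵥ (φ u • W u) = star (φ 0 • W 0) ⬝ᵥ (φ 0 • W 0) :=
      is_const_of_deriv_eq_zero (fun u => (hder u).differentiableAt) (fun u => (hder u).deriv) u 0
    rw [hconst, star_smul, smul_dotProduct, dotProduct_smul, hNW]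
    have hs : (√N : ℂ) ^ 2 = N := by
      rw [← Complex.ofReal_pow, Real.sq_sqrt hN0.le]
    have hs0 : (√N : ℂ) ≠ 0 := Complex.ofReal_ne_zero.2 (Real.sqrt_pos.2 hN0).ne'
    simp [hφ]
    rw [← hs]
    field_simp

lemma isHorizontalLift_horizontalLift {X : ℝ → CP1} (hX : IsSmoothCurve X) :
    IsHorizontalLift (horizontalLift X) X :=
  Classical.epsilon_spec (exists_isHorizontalLift hX)

end Inversive

end

noncomputable section

namespace Inversive

/-! ### The Serret-Frenet frame of an admissible curve -/

section Frame

variable {X : ℝ → CP1}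

lemma contDiff_horizontalLift (hX : IsAdmissible X) : ContDiff ℝ ∞ (horizontalLift X) :=
  (isHorizontalLift_horizontalLift hX.1).1.1

lemma fsSpeed_sq (X : ℝ → CP1) (u : ℝ) :
    star (deriv (horizontalLift X) u) ⬝ᵥ deriv (horizontalLift X) u =
      ((fsSpeed X u ^ 2 : ℝ) : ℂ) := by
  have h : (0 : ℝ) ≤ (star (deriv (horizontalLift X) u) ⬝ᵥ deriv (horizontalLift X) u).re := by
    rw [hermitian_self, Complex.ofReal_re]
    exact add_nonneg (Complex.normSq_nonneg _) (Complex.normSq_nonneg _)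
  rw [fsSpeed, hermNorm, Real.sq_sqrt h, hermitian_self, Complex.ofReal_re]

lemma contDiff_fsSpeed (hX : IsAdmissible X) : ContDiff ℝ ∞ (fsSpeed X) := by
  have hV := contDiff_deriv (contDiff_horizontalLift hX)
  refine ContDiff.sqrt (Complex.reCLM.contDiff.comp (contDiff_hermitian hV hV)) fun u => ?_
  simp only [fsSpeed_sq X, Complex.ofReal_re]
  exact (pow_pos (hX.2.1 u) 2).ne'

lemma deriv_horizontalLift (hX : IsAdmissible X) (u : ℝ) :
    deriv (horizontalLift X) u = (fsSpeed X u : ℂ) • unitTangent X u := by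
  rw [unitTangent, Complex.coe_smul, smul_smul, mul_inv_cancel₀ (hX.2.1 u).ne', one_smul]

lemma unitTangent_eq (X : ℝ → CP1) :
    unitTangent X = fun u => (fsSpeed X u)⁻¹ • deriv (horizontalLift X) u := rfl

lemma contDiff_unitTangent (hX : IsAdmissible X) : ContDiff ℝ ∞ (unitTangent X) := by
  rw [unitTangent_eq]
  exact ((contDiff_fsSpeed hX).inv fun u => (hX.2.1 u).ne').smul
    (contDiff_deriv (contDiff_horizontalLift hX))

lemma unitTangent_self (hX : IsAdmissible X) (u : ℝ) :
    star (unitTangent X u) ⬝ᵥ unitTangent X u = 1 := by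
  have hv : (fsSpeed X u : ℂ) ≠ 0 := Complex.ofReal_ne_zero.2 (hX.2.1 u).ne'
  have h := fsSpeed_sq X u
  rw [deriv_horizontalLift hX, star_smul, smul_dotProduct, dotProduct_smul, smul_eq_mul,
    smul_eq_mul] at h
  push_cast at h
  have e : star (fsSpeed X u : ℂ) = fsSpeed X u := Complex.conj_ofReal _
  rw [e, pow_two, ← mul_assoc] at h
  exact mul_left_cancel₀ (mul_ne_zero hv hv) (h.trans (mul_one _).symm)

lemma horizontalLift_self (hX : IsAdmissible X) (u : ℝ) :
    star (horizontalLift X u) ⬝ᵥ horizontalLift X u = 1 :=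
  (isHorizontalLift_horizontalLift hX.1).2.1 u

lemma horizontalLift_unitTangent (hX : IsAdmissible X) (u : ℝ) :
    star (horizontalLift X u) ⬝ᵥ unitTangent X u = 0 := by
  rw [unitTangent, dotProduct_smul, (isHorizontalLift_horizontalLift hX.1).2.2 u, smul_zero]

/-- The Serret-Frenet equation for the unit tangent. -/
lemma hasDerivAt_unitTangent (hX : IsAdmissible X) (u : ℝ) :
    HasDerivAt (unitTangent X) (-(fsSpeed X u : ℂ) • horizontalLift X u +
      (Complex.I * geodCurv X u * fsSpeed X u) • unitTangent X u) u := by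
  have hV := hasDerivAt_of_contDiff (contDiff_horizontalLift hX) u
  have he := hasDerivAt_of_contDiff (contDiff_unitTangent hX) u
  have hv0 := (hX.2.1 u).ne'
  refine he.congr_deriv ?_
  have hexp := (eq_hermitian_smul_add (horizontalLift_self hX u) (unitTangent_self hX u)
    (horizontalLift_unitTangent hX u) (deriv (unitTangent X) u)).2
  -- From differentiating the orthogonality of lift and tangent.
  have h1 : star (horizontalLift X u) ⬝ᵥ deriv (unitTangent X) u = -(fsSpeed X u : ℂ) := by
    have h := (hasDerivAt_hermitian hV he).unique (by
      simpa only [horizontalLift_unitTangent hX] using hasDerivAt_const u (0 : ℂ))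
    rw [deriv_horizontalLift hX, star_smul, smul_dotProduct, unitTangent_self hX,
      smul_eq_mul, mul_one] at h
    have e : star (fsSpeed X u : ℂ) = fsSpeed X u := Complex.conj_ofReal _
    rw [e] at h
    linear_combination h
  -- Differentiating the unit length shows that the product is purely imaginary; its imaginary part
  -- is the curvature times the speed by definition.
  have h2 : star (unitTangent X u) ⬝ᵥ deriv (unitTangent X) u =
      Complex.I * geodCurv X u * fsSpeed X u := by
    have h := (hasDerivAt_hermitian he he).unique (by
      simpa only [unitTangent_self hX] using hasDerivAt_const u (1 : ℂ))
    rw [← hermitian_conj] at h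
    have hre : (star (unitTangent X u) ⬝ᵥ deriv (unitTangent X) u).re = 0 := by
      have := congrArg Complex.re h
      rw [Complex.add_re, Complex.star_def, Complex.conj_re, Complex.zero_re] at this
      linarith
    have hk : (star (unitTangent X u) ⬝ᵥ deriv (unitTangent X) u).im =
        geodCurv X u * fsSpeed X u := by
      rw [geodCurv, dotProduct_smul, Complex.smul_im, smul_eq_mul]
      field_simp
    apply Complex.ext
    · rw [hre]; simp
    · rw [hk]; simp
  rw [h1, h2] at hexp
  exact hexp

lemma contDiff_geodCurv (hX : IsAdmissible X) : ContDiff ℝ ∞ (geodCurv X) := by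
  have he := contDiff_unitTangent hX
  exact Complex.imCLM.contDiff.comp (contDiff_hermitian he
    (((contDiff_fsSpeed hX).inv fun u => (hX.2.1 u).ne').smul (contDiff_deriv he)))

lemma contDiff_fsDeriv (hX : IsAdmissible X) {f : ℝ → ℝ} (hf : ContDiff ℝ ∞ f) :
    ContDiff ℝ ∞ (fsDeriv X f) :=
  (contDiff_deriv hf).div (contDiff_fsSpeed hX) fun u => (hX.2.1 u).ne'

lemma det2_horizontalLift_ne_zero (hX : IsAdmissible X) (u : ℝ) :
    det2 (horizontalLift X u) (deriv (horizontalLift X) u) ≠ 0 := by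
  rw [deriv_horizontalLift hX, det2_smul_right]
  exact mul_ne_zero (Complex.ofReal_ne_zero.2 (hX.2.1 u).ne')
    (eq_hermitian_smul_add (horizontalLift_self hX u) (unitTangent_self hX u)
      (horizontalLift_unitTangent hX u) 0).1

/-- The Schwarzian derivative in terms of speed and curvature. -/
lemma halfSchwarzian_horizontalLift (hX : IsAdmissible X) (u : ℝ) :
    halfSchwarzian (horizontalLift X) u =
      ((fsSpeed X u ^ 2 * (1 + geodCurv X u ^ 2 / 4) +
        deriv (fun w => deriv (fsSpeed X) w / fsSpeed X w) u / 2 -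
          (deriv (fsSpeed X) u / fsSpeed X u) ^ 2 / 4 : ℝ) : ℂ) +
        ((deriv (geodCurv X) u * fsSpeed X u / 2 : ℝ) : ℂ) * Complex.I := by
  have hv := contDiff_fsSpeed hX
  have hk := contDiff_geodCurv hX
  have hv0 : ∀ w, (fsSpeed X w : ℂ) ≠ 0 := fun w => Complex.ofReal_ne_zero.2 (hX.2.1 w).ne'
  have hAB : ∀ w, coeffA (horizontalLift X) w = -(fsSpeed X w : ℂ) ^ 2 ∧
      coeffB (horizontalLift X) w = ((deriv (fsSpeed X) w / fsSpeed X w : ℝ) : ℂ) +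
        ((geodCurv X w * fsSpeed X w : ℝ) : ℂ) * Complex.I := by
    intro w
    refine coeff_eq (det2_horizontalLift_ne_zero hX w) ?_
    rw [show deriv (horizontalLift X) = fun w => (fsSpeed X w : ℂ) • unitTangent X w from
      funext fun w => deriv_horizontalLift hX w]
    have hd : deriv (fun w => (fsSpeed X w : ℂ) • unitTangent X w) w = _ :=
      ((hasDerivAt_of_contDiff hv w).ofReal_comp.smul (hasDerivAt_unitTangent hX w)).deriv
    rw [hd]
    have := hv0 w
    ext i
    simp only [Pi.add_apply, Pi.smul_apply, smul_eq_mul]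
    push_cast
    field_simp
    ring
  have hq : ContDiff ℝ ∞ fun w => deriv (fsSpeed X) w / fsSpeed X w :=
    (contDiff_deriv hv).div hv fun w => (hX.2.1 w).ne'
  have hB : coeffB (horizontalLift X) = fun w =>
      ((deriv (fsSpeed X) w / fsSpeed X w : ℝ) : ℂ) +
        ((geodCurv X w * fsSpeed X w : ℝ) : ℂ) * Complex.I := funext fun w => (hAB w).2
  have hdB : deriv (coeffB (horizontalLift X)) u =
      ((deriv (fun w => deriv (fsSpeed X) w / fsSpeed X w) u : ℝ) : ℂ) +
        ((deriv (geodCurv X) u * fsSpeed X u + geodCurv X u * deriv (fsSpeed X) u : ℝ) : ℂ) *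
          Complex.I := by
    rw [hB]
    exact ((hasDerivAt_of_contDiff hq u).ofReal_comp.add
      (((hasDerivAt_of_contDiff hk u).mul (hasDerivAt_of_contDiff hv u)).ofReal_comp.mul_const
        Complex.I)).deriv
  rw [halfSchwarzian, hdB, (hAB u).1, (hAB u).2]
  have := hv0 u
  have hI := Complex.I_sq
  push_cast
  field_simp
  ring_nf
  rw [hI]
  ring

/-- The fourth root of the derivative of the curvature. -/
def curvRoot (X : ℝ → CP1) (u : ℝ) : ℝ := fsDeriv X (geodCurv X) u ^ (1 / 4 : ℝ)

lemma curvRoot_pos (hX : IsAdmissible X) (u : ℝ) : 0 < curvRoot X u :=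
  Real.rpow_pos_of_pos (hX.2.2 u) _

lemma contDiff_curvRoot (hX : IsAdmissible X) : ContDiff ℝ ∞ (curvRoot X) :=
  (contDiff_fsDeriv hX (contDiff_geodCurv hX)).rpow_const_of_ne fun u => (hX.2.2 u).ne'

lemma curvRoot_pow (hX : IsAdmissible X) (u : ℝ) :
    curvRoot X u ^ 4 = fsDeriv X (geodCurv X) u := by
  rw [curvRoot, ← Real.rpow_natCast, ← Real.rpow_mul (hX.2.2 u).le]
  norm_num

lemma rpow_eq_curvRoot_pow (hX : IsAdmissible X) (u : ℝ) (j : ℕ) :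
    fsDeriv X (geodCurv X) u ^ ((j : ℝ) / 4) = curvRoot X u ^ j := by
  rw [curvRoot, ← Real.rpow_natCast, ← Real.rpow_mul (hX.2.2 u).le]
  congr 1
  ring

lemma invDensity_eq (hX : IsAdmissible X) (u : ℝ) :
    invDensity X u = curvRoot X u ^ 2 * fsSpeed X u := by
  rw [invDensity, ← curvRoot_pow hX, show curvRoot X u ^ 4 = (curvRoot X u ^ 2) ^ 2 by ring,
    Real.sqrt_sq (sq_nonneg _)]

/-- The lower left entry of the triangular factor of the Gauss map. -/
def gaussCorner (X : ℝ → CP1) (u : ℝ) : ℂ :=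
  ((-deriv (curvRoot X) u / (fsSpeed X u * curvRoot X u ^ 2) : ℝ) : ℂ) +
    ((geodCurv X u / (2 * curvRoot X u) : ℝ) : ℂ) * Complex.I

/-- In terms of n = (k')^{1/4} all fractional powers disappear, and the corner entry becomes -n_u/(v
n²) + ik/(2n), with v the speed. -/
lemma gaussMap_eq (hX : IsAdmissible X) (u : ℝ) :
    gaussMap X u = Matrix.of ![(curvRoot X u : ℂ) • star (unitTangent X u),
      gaussCorner X u • star (unitTangent X u) +
        ((curvRoot X u)⁻¹ : ℂ) • star (horizontalLift X u)] := by
  have hn := (curvRoot_pos hX u).ne'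
  have hv := (hX.2.1 u).ne'
  have h14 := rpow_eq_curvRoot_pow hX u 1
  have h54 := rpow_eq_curvRoot_pow hX u 5
  have hm14 : fsDeriv X (geodCurv X) u ^ (-1 / 4 : ℝ) = (curvRoot X u)⁻¹ := by
    rw [neg_div, Real.rpow_neg (hX.2.2 u).le]
    rfl
  push_cast at h14 h54
  rw [pow_one] at h14
  have hk'' : fsDeriv X (fsDeriv X (geodCurv X)) u =
      4 * curvRoot X u ^ 3 * deriv (curvRoot X) u / fsSpeed X u := by
    have e : fsDeriv X (geodCurv X) = fun w => curvRoot X w ^ 4 :=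
      funext fun w => (curvRoot_pow hX w).symm
    have hd : deriv (fun w => curvRoot X w ^ 4) u = _ :=
      ((hasDerivAt_of_contDiff (contDiff_curvRoot hX) u).pow 4).deriv
    rw [fsDeriv, e, hd]
    simp
  have hcorner : -fsDeriv X (fsDeriv X (geodCurv X)) u /
      (4 * fsDeriv X (geodCurv X) u ^ (5 / 4 : ℝ)) =
        -deriv (curvRoot X) u / (fsSpeed X u * curvRoot X u ^ 2) := by
    rw [hk'', h54]
    field_simp
  rw [gaussMap, gaussTriangular, gaussUnitary]
  simp only [h14, hm14, hcorner]
  ext i j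
  fin_cases i <;> simp [Matrix.mul_apply, Fin.sum_univ_two, gaussCorner]

lemma hasDerivAt_star {f : ℝ → Fin 2 → ℂ} {f' : Fin 2 → ℂ} {u : ℝ} (h : HasDerivAt f f' u)
    (j : Fin 2) : HasDerivAt (fun w => star (f w j)) (star (f' j)) u :=
  (hasDerivAt_pi.1 h j).star

lemma contDiff_gaussCorner_re (hX : IsAdmissible X) : ContDiff ℝ ∞ fun u =>
    -deriv (curvRoot X) u / (fsSpeed X u * curvRoot X u ^ 2) :=
  (contDiff_deriv (contDiff_curvRoot hX)).neg.div
    ((contDiff_fsSpeed hX).mul ((contDiff_curvRoot hX).pow 2))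
    fun u => (mul_pos (hX.2.1 u) (pow_pos (curvRoot_pos hX u) 2)).ne'

lemma contDiff_gaussCorner_im (hX : IsAdmissible X) : ContDiff ℝ ∞ fun u =>
    geodCurv X u / (2 * curvRoot X u) :=
  (contDiff_geodCurv hX).div (contDiff_const.mul (contDiff_curvRoot hX))
    fun u => (mul_pos two_pos (curvRoot_pos hX u)).ne'

lemma hasDerivAt_gaussCorner (hX : IsAdmissible X) (u : ℝ) :
    HasDerivAt (gaussCorner X)
      (((deriv (fun w => -deriv (curvRoot X) w / (fsSpeed X w * curvRoot X w ^ 2)) u : ℝ) : ℂ) +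
        ((deriv (fun w => geodCurv X w / (2 * curvRoot X w)) u : ℝ) : ℂ) * Complex.I) u :=
  (hasDerivAt_of_contDiff (contDiff_gaussCorner_re hX) u).ofReal_comp.add
    ((hasDerivAt_of_contDiff (contDiff_gaussCorner_im hX) u).ofReal_comp.mul_const Complex.I)

/-- The Serret-Frenet equation for the unnormalized Gauss map. -/
lemma deriv_gaussMap (hX : IsAdmissible X) (u : ℝ) :
    (Matrix.of fun i j => deriv (fun w => gaussMap X w i j) u) =
      !![-(Complex.I * geodCurv X u * fsSpeed X u / 2), -(curvRoot X u ^ 2 * fsSpeed X u : ℂ);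
        (deriv (gaussCorner X) u - Complex.I * geodCurv X u * fsSpeed X u / 2 * gaussCorner X u +
          fsSpeed X u / curvRoot X u) / curvRoot X u,
        -(Complex.I * geodCurv X u * fsSpeed X u / 2)] * gaussMap X u := by
  have hn : (curvRoot X u : ℂ) ≠ 0 := Complex.ofReal_ne_zero.2 (curvRoot_pos hX u).ne'
  have hv : (fsSpeed X u : ℂ) ≠ 0 := Complex.ofReal_ne_zero.2 (hX.2.1 u).ne'
  have hnd := (hasDerivAt_of_contDiff (contDiff_curvRoot hX) u).ofReal_comp
  have hcd := (hasDerivAt_gaussCorner hX u).differentiableAt.hasDerivAt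
  have hVd : HasDerivAt (horizontalLift X) ((fsSpeed X u : ℂ) • unitTangent X u) u := by
    rw [← deriv_horizontalLift hX]
    exact hasDerivAt_of_contDiff (contDiff_horizontalLift hX) u
  have hed := hasDerivAt_unitTangent hX u
  have e0 : ∀ j, (fun w => gaussMap X w 0 j) =
      fun w => (curvRoot X w : ℂ) * star (unitTangent X w j) :=
    fun j => funext fun w => by rw [gaussMap_eq hX]; rfl
  have e1 : ∀ j, (fun w => gaussMap X w 1 j) = fun w => gaussCorner X w *
      star (unitTangent X w j) + (curvRoot X w : ℂ)⁻¹ * star (horizontalLift X w j) :=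
    fun j => funext fun w => by rw [gaussMap_eq hX]; rfl
  have d0 := fun j => (congrArg (deriv · u) (e0 j)).trans
    (hnd.mul (hasDerivAt_star hed j)).deriv
  have d1 := fun j => (congrArg (deriv · u) (e1 j)).trans
    ((hcd.mul (hasDerivAt_star hed j)).add ((hnd.inv hn).mul (hasDerivAt_star hVd j))).deriv
  have hcorner : gaussCorner X u = -((deriv (curvRoot X) u : ℝ) : ℂ) / (fsSpeed X u * curvRoot X u ^ 2) +
      geodCurv X u / (2 * curvRoot X u) * Complex.I := by
    rw [gaussCorner]; push_cast; ring
  ext i j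
  rw [Matrix.mul_apply, Fin.sum_univ_two, gaussMap_eq hX u]
  fin_cases i
  · simp only [Fin.zero_eta, Matrix.of_apply, d0]
    simp [hcorner]
    field_simp
    ring
  · simp only [Fin.mk_one, Matrix.of_apply, d1]
    simp
    set c' := deriv (gaussCorner X) u
    rw [hcorner]
    field_simp
    ring

lemma gaussMap_det_ne_zero (hX : IsAdmissible X) (u : ℝ) : (gaussMap X u).det ≠ 0 := by
  have hn : (curvRoot X u : ℂ) ≠ 0 := Complex.ofReal_ne_zero.2 (curvRoot_pos hX u).ne'
  have h := (eq_hermitian_smul_add (horizontalLift_self hX u) (unitTangent_self hX u)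
      (horizontalLift_unitTangent hX u) 0).1
  have e : (gaussMap X u).det = -star (det2 (horizontalLift X u) (unitTangent X u)) := by
    rw [gaussMap_eq hX, Matrix.det_fin_two]
    simp [det2]
    field_simp
    ring
  rw [e]
  exact neg_ne_zero.2 (star_ne_zero.2 h)

/-- By `deriv_gaussMap` the matrix in the definition of Q is the coefficient matrix divided by ρ.
Its equal diagonal entries reflect the varying phase of the determinant; Q is the real part of the
corner entry. -/
lemma fundInv_eq (hX : IsAdmissible X) (u : ℝ) :
    fundInv X u = (deriv (fun w => -deriv (curvRoot X) w / (fsSpeed X w * curvRoot X w ^ 2)) u +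
      geodCurv X u ^ 2 * fsSpeed X u / (4 * curvRoot X u) + fsSpeed X u / curvRoot X u) /
        (curvRoot X u ^ 3 * fsSpeed X u) := by
  have hn := (curvRoot_pos hX u).ne'
  have hv := (hX.2.1 u).ne'
  have hG := gaussMap_det_ne_zero hX u
  set N := !![-(Complex.I * geodCurv X u * fsSpeed X u / 2), -(curvRoot X u ^ 2 * fsSpeed X u : ℂ);
        (deriv (gaussCorner X) u - Complex.I * geodCurv X u * fsSpeed X u / 2 * gaussCorner X u +
          fsSpeed X u / curvRoot X u) / curvRoot X u,
        -(Complex.I * geodCurv X u * fsSpeed X u / 2)] with hN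
  have h1 : (Matrix.of fun i j => deriv (fun v => gaussMap X v i j) u / (invDensity X u : ℂ)) =
      (invDensity X u : ℂ)⁻¹ • (N * gaussMap X u) := by
    rw [hN, ← deriv_gaussMap hX]
    ext i j
    simp [div_eq_inv_mul]
  rw [fundInv, h1, Matrix.smul_mul, Matrix.mul_assoc, Matrix.mul_nonsing_inv _ (Ne.isUnit hG),
    Matrix.mul_one, Matrix.smul_apply, smul_eq_mul, invDensity_eq hX, ← Complex.ofReal_inv,
    Complex.re_ofReal_mul]
  have h2 : N 1 0 = (((deriv (fun w => -deriv (curvRoot X) w / (fsSpeed X w * curvRoot X w ^ 2)) u +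
      geodCurv X u ^ 2 * fsSpeed X u / (4 * curvRoot X u) + fsSpeed X u / curvRoot X u) /
        curvRoot X u : ℝ) : ℂ) +
      (((deriv (fun w => geodCurv X w / (2 * curvRoot X w)) u - geodCurv X u * fsSpeed X u / 2 *
        (-deriv (curvRoot X) u / (fsSpeed X u * curvRoot X u ^ 2))) / curvRoot X u : ℝ) : ℂ) *
          Complex.I := by
    rw [hN]
    simp only [Matrix.of_apply, Matrix.cons_val', Matrix.cons_val_zero, Matrix.cons_val_one,
      Matrix.cons_val_fin_one]
    rw [(hasDerivAt_gaussCorner hX u).deriv, gaussCorner]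
    push_cast
    linear_combination (-(geodCurv X u : ℂ) * fsSpeed X u / 2 *
      (geodCurv X u / (2 * curvRoot X u)) / curvRoot X u) * Complex.I_sq
  rw [h2, Complex.add_re, Complex.ofReal_re, Complex.re_ofReal_mul, Complex.I_re, mul_zero,
    add_zero]
  field_simp

/-- The inversive length element and the fundamental invariant in terms of the Schwarzian
derivative of an arbitrary lift. -/
lemma invariants_eq (hX : IsAdmissible X) {W : ℝ → Fin 2 → ℂ} (hW : IsSmoothLift W X) :
    (∀ u, det2 (W u) (deriv W u) ≠ 0) ∧
    (∀ u, 0 < (halfSchwarzian W u).im) ∧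
    (∀ u, invDensity X u = √(2 * (halfSchwarzian W u).im)) ∧
    ∀ u, fundInv X u = ((halfSchwarzian W u).re -
      deriv (fun w => deriv (invDensity X) w / invDensity X w) u / 2 +
        (deriv (invDensity X) u / invDensity X u) ^ 2 / 4) / invDensity X u ^ 2 := by
  obtain ⟨φ, hφ, hφ0, rfl⟩ := exists_smul_of_isSmoothLift hW
    (isHorizontalLift_horizontalLift hX.1).1
  obtain ⟨hdet, hS⟩ := halfSchwarzian_smul hφ hφ0 (contDiff_horizontalLift hX)
    (det2_horizontalLift_ne_zero hX)
  -- The horizontal lift serves for the computation, the half Schwarzian being the same for all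
  -- lifts. Its imaginary part k_u v/2 equals ρ²/2.
  have him : ∀ u, (halfSchwarzian (horizontalLift X) u).im =
      deriv (geodCurv X) u * fsSpeed X u / 2 := fun u => by
    rw [halfSchwarzian_horizontalLift hX]
    simp only [Complex.add_im, Complex.ofReal_im, Complex.im_ofReal_mul, Complex.I_im]
    ring
  have hre : ∀ u, (halfSchwarzian (horizontalLift X) u).re =
      fsSpeed X u ^ 2 * (1 + geodCurv X u ^ 2 / 4) +
        deriv (fun w => deriv (fsSpeed X) w / fsSpeed X w) u / 2 -
          (deriv (fsSpeed X) u / fsSpeed X u) ^ 2 / 4 := fun u => by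
    rw [halfSchwarzian_horizontalLift hX]
    simp only [Complex.add_re, Complex.ofReal_re, Complex.re_ofReal_mul, Complex.I_re]
    ring
  have hk : ∀ u, deriv (geodCurv X) u = curvRoot X u ^ 4 * fsSpeed X u := fun u => by
    rw [curvRoot_pow hX, fsDeriv, div_mul_cancel₀ _ (hX.2.1 u).ne']
  refine ⟨hdet, ?_⟩
  rw [hS]
  refine ⟨fun u => ?_, fun u => ?_, fun u => ?_⟩
  · rw [him, hk]
    have := curvRoot_pos hX u
    have := hX.2.1 u
    positivity
  · rw [him, hk, invDensity_eq hX, eq_comm, Real.sqrt_eq_iff_mul_self_eq]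
    · ring
    · have := curvRoot_pos hX u
      have := hX.2.1 u
      positivity
    · have := curvRoot_pos hX u
      have := hX.2.1 u
      positivity
  · have hv := contDiff_fsSpeed hX
    have hn := contDiff_curvRoot hX
    have hv0 := fun w => (hX.2.1 w).ne'
    have hn0 := fun w => (curvRoot_pos hX w).ne'
    -- With ρ = n²v one has ρ_u/ρ = 2n_u/n + v_u/v, and both sides of the formula for Q become
    -- rational in n, v, k and their derivatives.
    have hρ : invDensity X = fun w => curvRoot X w ^ 2 * fsSpeed X w :=
      funext fun w => invDensity_eq hX w
    have hdv := hasDerivAt_of_contDiff (contDiff_deriv hv) u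
    have hdn := hasDerivAt_of_contDiff (contDiff_deriv hn) u
    have hv1 := hasDerivAt_of_contDiff hv u
    have hn1 := hasDerivAt_of_contDiff hn u
    have hr : ∀ w, deriv (invDensity X) w / invDensity X w =
        2 * (deriv (curvRoot X) w / curvRoot X w) + deriv (fsSpeed X) w / fsSpeed X w := by
      intro w
      have h1 := hv0 w
      have h2 := hn0 w
      have hd : deriv (fun w => curvRoot X w ^ 2 * fsSpeed X w) w = _ :=
        (((hasDerivAt_of_contDiff hn w).pow 2).mul (hasDerivAt_of_contDiff hv w)).deriv
      rw [hρ, hd]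
      simp only [Pi.pow_apply]
      field_simp
      simp
      ring
    have hr' : deriv (fun w => deriv (invDensity X) w / invDensity X w) u =
        2 * deriv (fun w => deriv (curvRoot X) w / curvRoot X w) u +
          deriv (fun w => deriv (fsSpeed X) w / fsSpeed X w) u := by
      rw [funext hr]
      exact (((hdn.div hn1 (hn0 u)).differentiableAt.hasDerivAt.const_mul 2).add
        (hdv.div hv1 (hv0 u)).differentiableAt.hasDerivAt).deriv
    have e1 : deriv (fun w => deriv (curvRoot X) w / curvRoot X w) u = _ :=
      (hdn.div hn1 (hn0 u)).deriv
    have e2 : deriv (fun w => -deriv (curvRoot X) w / (fsSpeed X w * curvRoot X w ^ 2)) u = _ :=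
      (hdn.neg.div (hv1.mul (hn1.pow 2)) (mul_ne_zero (hv0 u) (pow_ne_zero 2 (hn0 u)))).deriv
    have h1 := hv0 u
    have h2 := hn0 u
    rw [fundInv_eq hX, hre, hr', hr u, e1, e2, invDensity_eq hX]
    simp only [Pi.mul_apply, Pi.pow_apply, Pi.neg_apply]
    field_simp
    ring

end Frame

end Inversive

end

noncomputable section

namespace Inversive

open Set Filter Topology

/-! ### The evolution of the Schwarzian derivative -/

section Complex

variable {I : Set ℝ}

lemma SmoothFamily.complex_div {f g : ℝ → ℝ → ℂ} (hf : SmoothFamily I f) (hg : SmoothFamily I g)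
    (h : ∀ t ∈ I, ∀ u, g t u ≠ 0) : SmoothFamily I fun t u => f t u / g t u := by
  simp only [div_eq_mul_inv]
  exact ContDiffOn.mul hf (ContDiffOn.inv hg fun z hz => h z.1 hz.1 z.2)

lemma SmoothFamily.det2 {V W : ℝ → ℝ → Fin 2 → ℂ} (hV : SmoothFamily I V)
    (hW : SmoothFamily I W) : SmoothFamily I fun t u => det2 (V t u) (W t u) := by
  have hV' := contDiffOn_pi.1 hV
  have hW' := contDiffOn_pi.1 hW
  exact ((hV' 0).mul (hW' 1)).sub ((hV' 1).mul (hW' 0))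

variable {W : ℝ → ℝ → Fin 2 → ℂ}

lemma SmoothFamily.coeffA (hI : UniqueDiffOn ℝ I) (hW : SmoothFamily I W)
    (h : ∀ t ∈ I, ∀ u, Inversive.det2 (W t u) (deriv (W t) u) ≠ 0) :
    SmoothFamily I fun t => Inversive.coeffA (W t) :=
  (((hW.deriv_right hI).deriv_right hI).det2 (hW.deriv_right hI)).complex_div
    (hW.det2 (hW.deriv_right hI)) h

lemma SmoothFamily.coeffB (hI : UniqueDiffOn ℝ I) (hW : SmoothFamily I W)
    (h : ∀ t ∈ I, ∀ u, Inversive.det2 (W t u) (deriv (W t) u) ≠ 0) :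
    SmoothFamily I fun t => Inversive.coeffB (W t) :=
  (hW.det2 ((hW.deriv_right hI).deriv_right hI)).complex_div
    (hW.det2 (hW.deriv_right hI)) h

lemma SmoothFamily.halfSchwarzian (hI : UniqueDiffOn ℝ I) (hW : SmoothFamily I W)
    (h : ∀ t ∈ I, ∀ u, Inversive.det2 (W t u) (deriv (W t) u) ≠ 0) :
    SmoothFamily I fun t => Inversive.halfSchwarzian (W t) := by
  have hA := hW.coeffA hI h
  have hB := hW.coeffB hI h
  exact (ContDiffOn.add (ContDiffOn.neg hA)
    (ContDiffOn.div_const (hB.deriv_right hI) 2)).sub (ContDiffOn.div_const (hB.pow 2) 4)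

/-- The evolution of the Schwarzian derivative under `∂_t W = f ∂_u W` modulo `W`. -/
lemma hasDerivAt_halfSchwarzian (hI : IsOpen I) (hW : SmoothFamily I W)
    (hdet : ∀ t ∈ I, ∀ u, det2 (W t u) (deriv (W t) u) ≠ 0) {f μ : ℝ → ℝ → ℂ}
    (hf : SmoothFamily I f) (hμ : SmoothFamily I μ)
    (hev : ∀ t ∈ I, ∀ u, deriv (fun s => W s u) t = f t u • deriv (W t) u + μ t u • W t u)
    {t : ℝ} (ht : t ∈ I) (u : ℝ) :
    HasDerivAt (fun s => halfSchwarzian (W s) u)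
      (deriv (deriv (deriv (f t))) u / 2 + 2 * halfSchwarzian (W t) u * deriv (f t) u +
        deriv (halfSchwarzian (W t)) u * f t u) t := by
  have hU := hI.uniqueDiffOn (𝕜 := ℝ)
  have hA := hW.coeffA hU hdet
  have hB := hW.coeffB hU hdet
  have hft := hf.contDiff ht
  have hμt := hμ.contDiff ht
  have hAt := hA.contDiff ht
  have hBt := hB.contDiff ht
  have hWt := hW.contDiff ht
  have W2 : ∀ s ∈ I, ∀ v, deriv (deriv (W s)) v =
      coeffA (W s) v • W s v + coeffB (W s) v • deriv (W s) v :=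
    fun s hs v => deriv_deriv_eq (hdet s hs) v
  have dW := fun v => hasDerivAt_of_contDiff hWt v
  have dW' := fun v => hasDerivAt_of_contDiff (contDiff_deriv hWt) v
  set A := coeffA (W t) with hAdef
  set B := coeffB (W t) with hBdef
  set F := f t with hF
  set m := μ t with hm
  have dF := fun v => hasDerivAt_of_contDiff hft v
  have dF1 := fun v => hasDerivAt_of_contDiff (contDiff_deriv hft) v
  have dF2 := fun v => hasDerivAt_of_contDiff (contDiff_deriv (contDiff_deriv hft)) v
  have dm := fun v => hasDerivAt_of_contDiff hμt v
  have dm1 := fun v => hasDerivAt_of_contDiff (contDiff_deriv hμt) v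
  have dA := fun v => hasDerivAt_of_contDiff hAt v
  have dB := fun v => hasDerivAt_of_contDiff hBt v
  have dB1 := fun v => hasDerivAt_of_contDiff (contDiff_deriv hBt) v
  have hP : (fun v => deriv (fun s => W s v) t) = fun v => F v • deriv (W t) v + m v • W t v :=
    funext fun v => hev t ht v
  have hP1 : deriv (fun v => deriv (fun s => W s v) t) = fun v =>
      (F v * A v + deriv m v) • W t v + (deriv F v + F v * B v + m v) • deriv (W t) v := by
    funext v
    rw [hP]
    refine (((dF v).smul (dW' v)).add ((dm v).smul (dW v))).deriv.trans ?_
    rw [W2 t ht]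
    module
  have hP2 : ∀ v, deriv (deriv (fun v => deriv (fun s => W s v) t)) v =
      ((deriv F v * A v + F v * deriv A v + deriv (deriv m) v) +
        (deriv F v + F v * B v + m v) * A v) • W t v +
      ((F v * A v + deriv m v) + (deriv (deriv F) v + (deriv F v * B v + F v * deriv B v) +
        deriv m v) + (deriv F v + F v * B v + m v) * B v) • deriv (W t) v := by
    intro v
    rw [hP1]
    refine ((((((dF v).mul (dA v)).add (dm1 v)).smul (dW v)).add
      ((((dF1 v).add ((dF v).mul (dB v))).add (dm v)).smul (dW' v)))).deriv.trans ?_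
    simp only [Pi.add_apply, Pi.mul_apply]
    rw [W2 t ht]
    module
  have tW := fun v => hW.hasDerivAt_left hI ht v
  have tW1 := fun v => hW.hasDerivAt_deriv_right hI ht v
  have tW2 := fun v => (hW.deriv_right hU).hasDerivAt_deriv_right hI ht v
  have tA := fun v => hA.hasDerivAt_left hI ht v
  have tB := fun v => hB.hasDerivAt_left hI ht v
  have key : ∀ v, deriv (fun s => coeffA (W s) v) t =
        2 * deriv F v * A v + F v * deriv A v + deriv (deriv m) v - B v * deriv m v ∧
      deriv (fun s => coeffB (W s) v) t =
        2 * deriv m v + deriv (deriv F) v + deriv F v * B v + F v * deriv B v := by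
    intro v
    have e1 : deriv (fun v => deriv (fun s => deriv (W s) v) t) v =
        deriv (deriv (fun v => deriv (fun s => W s v) t)) v := by
      congr 1
      exact funext fun w => (tW1 w).deriv
    have e2 := (tW2 v).unique ((((tA v).smul (tW v)).add ((tB v).smul (tW1 v))).congr_of_eventuallyEq
      (by filter_upwards [hI.mem_nhds ht] with s hs using W2 s hs v))
    rw [e1, hP2, hP1, hev t ht v] at e2
    have e3 := eq_of_smul_add_smul (hdet t ht v) (c := deriv (fun s => coeffA (W s) v) t +
      A v * m v + B v * (F v * A v + deriv m v)) (d := A v * F v +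
        deriv (fun s => coeffB (W s) v) t + B v * (deriv F v + F v * B v + m v))
      (e2.trans (by module))
    constructor
    · linear_combination -e3.1
    · linear_combination -e3.2
  have tB1 : HasDerivAt (fun s => deriv (coeffB (W s)) u)
      (2 * deriv (deriv m) u + deriv (deriv (deriv F)) u +
        (deriv (deriv F) u * B u + deriv F u * deriv B u) +
        (deriv F u * deriv B u + F u * deriv (deriv B) u)) t := by
    refine (hB.hasDerivAt_deriv_right hI ht u).congr_deriv ?_
    rw [funext fun v => (key v).2]
    exact (((((dm1 u).const_mul 2).add (dF2 u)).add ((dF1 u).mul (dB u))).add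
      ((dF u).mul (dB1 u))).deriv
  have hS' : deriv (halfSchwarzian (W t)) u =
      -deriv A u + deriv (deriv B) u / 2 - (2 * B u * deriv B u) / 4 := by
    refine HasDerivAt.deriv ((((dA u).neg.add ((dB1 u).div_const 2)).sub
      (((dB u).pow 2).div_const 4)).congr_deriv ?_)
    simp
  refine ((((tA u).neg.add (tB1.div_const 2)).sub
    (((tB u).pow 2).div_const 4)).congr_deriv ?_)
  rw [(key u).1, (key u).2, hS', halfSchwarzian]
  push_cast
  ring

end Complex

/-! ### The evolution of the inversive invariants -/

/-- The transformation of the third order operator `g ↦ g''' / 2 + 2 R g' + R' g` under a change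
of parameter. -/
lemma projective_operator_eq (Λ : Profile) {R : ℝ → ℝ}
    (hR : ∀ u, R u = Λ.Q u * Λ.ρ u ^ 2 + deriv (fun w => deriv Λ.ρ w / Λ.ρ w) u / 2 -
      (deriv Λ.ρ u / Λ.ρ u) ^ 2 / 4) (u : ℝ) :
    deriv (deriv (deriv fun w => Λ.jet 1 w / Λ.ρ w)) u / 2 +
      2 * R u * deriv (fun w => Λ.jet 1 w / Λ.ρ w) u + deriv R u * (Λ.jet 1 u / Λ.ρ u) =
    Λ.ρ u ^ 2 * Λ.eval u lengthRate / 2 := by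
  have hρ0 := fun w => (Λ.ρ_pos w).ne'
  -- With ρ_u = rρ every derivative is polynomial in r, its derivatives, ρ and the jets. All terms
  -- in r cancel because the operator maps vector fields to quadratic differentials; in the
  -- parameter s it gives Q''''/2 + 2QQ'' + Q'² = P/2.
  set r : ℝ → ℝ := fun w => deriv Λ.ρ w / Λ.ρ w with hr
  have hrs : ContDiff ℝ ∞ r := (contDiff_deriv Λ.ρ_smooth).div Λ.ρ_smooth hρ0
  have dρ : ∀ w, HasDerivAt Λ.ρ (r w * Λ.ρ w) w := fun w => by
    rw [hr, div_mul_cancel₀ _ (hρ0 w)]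
    exact hasDerivAt_of_contDiff Λ.ρ_smooth w
  have dr := fun w => hasDerivAt_of_contDiff hrs w
  have dr1 := fun w => hasDerivAt_of_contDiff (contDiff_deriv hrs) w
  have dq : ∀ i w, HasDerivAt (Λ.jet i) (Λ.ρ w * Λ.jet (i + 1) w) w := fun i w => by
    simpa using Λ.hasDerivAt_eval (MvPolynomial.X i) w
  set g : ℝ → ℝ := fun w => Λ.jet 1 w / Λ.ρ w with hg
  have dg : ∀ w, HasDerivAt g (Λ.jet 2 w - r w * g w) w := fun w => by
    refine ((dq 1 w).div (dρ w) (hρ0 w)).congr_deriv ?_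
    have := hρ0 w
    simp only [hg]
    field_simp
  have hg1 : deriv g = fun w => Λ.jet 2 w - r w * g w := funext fun w => (dg w).deriv
  have dg1 : ∀ w, HasDerivAt (deriv g)
      (Λ.ρ w * Λ.jet 3 w - r w * Λ.jet 2 w + (r w ^ 2 - deriv r w) * g w) w := fun w => by
    rw [hg1]
    refine ((dq 2 w).sub ((dr w).mul (dg w))).congr_deriv ?_
    ring
  have hg2 : deriv (deriv g) = fun w =>
      Λ.ρ w * Λ.jet 3 w - r w * Λ.jet 2 w + (r w ^ 2 - deriv r w) * g w :=
    funext fun w => (dg1 w).deriv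
  have hg3 : deriv (deriv (deriv g)) u = Λ.ρ u ^ 2 * Λ.jet 4 u +
      (r u ^ 2 - 2 * deriv r u) * Λ.jet 2 u +
        (3 * r u * deriv r u - deriv (deriv r) u - r u ^ 3) * g u := by
    rw [hg2]
    refine HasDerivAt.deriv (((((dρ u).mul (dq 3 u)).sub ((dr u).mul (dq 2 u))).add
      ((((dr u).pow 2).sub (dr1 u)).mul (dg u))).congr_deriv ?_)
    simp
    ring
  have hR' : deriv R u = Λ.ρ u ^ 3 * Λ.jet 1 u + 2 * Λ.jet 0 u * Λ.ρ u ^ 2 * r u +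
      deriv (deriv r) u / 2 - r u * deriv r u / 2 := by
    rw [funext hR]
    refine HasDerivAt.deriv (((((dq 0 u).mul ((dρ u).pow 2)).add ((dr1 u).div_const 2)).sub
      (((dr u).pow 2).div_const 4)).congr_deriv ?_)
    simp
    ring
  have hgu : Λ.ρ u * g u = Λ.jet 1 u := by
    simp only [hg]
    rw [mul_div_cancel₀ _ (hρ0 u)]
  have h0 : Λ.Q u = Λ.jet 0 u := rfl
  rw [hg3, hR', hg1, hR, h0, ← hgu]
  simp only [lengthRate, map_add, map_mul, Profile.eval_X, Profile.eval_C, ← hgu]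
  have hru : deriv Λ.ρ u / Λ.ρ u = r u := rfl
  rw [hru, mul_div_cancel_left₀ _ (hρ0 u)]
  ring

end Inversive

end

/-! ### The system for (ρ, Q) deduced from the evolution of the Schwarzian derivative. -/

noncomputable section

namespace Inversive

open Set Filter Topology

/-- The inversive length element of a curve with Schwarzian derivative `2 S`. -/
def densityOf (S : ℝ → ℂ) (u : ℝ) : ℝ := √(2 * (S u).im)

/-- The logarithmic derivative of the inversive length element. -/
def logDensityDeriv (S : ℝ → ℂ) (u : ℝ) : ℝ := deriv (densityOf S) u / densityOf S u

/-- The fundamental invariant of a curve with Schwarzian derivative `2 S`. -/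
def invariantOf (S : ℝ → ℂ) (u : ℝ) : ℝ :=
  ((S u).re - deriv (logDensityDeriv S) u / 2 + logDensityDeriv S u ^ 2 / 4) / densityOf S u ^ 2

/-- The velocity `-i Q_s / ρ` of the flow, relative to the coordinate tangent vector. -/
def velocityOf (S : ℝ → ℂ) (u : ℝ) : ℂ :=
  -Complex.I * ((arcDeriv (densityOf S) (invariantOf S) u / densityOf S u : ℝ) : ℂ)

section

variable {I : Set ℝ} {S : ℝ → ℝ → ℂ}

lemma densityOf_pos {S : ℝ → ℂ} {u : ℝ} (h : 0 < (S u).im) : 0 < densityOf S u :=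
  Real.sqrt_pos.2 (by linarith)

lemma densityOf_sq {S : ℝ → ℂ} {u : ℝ} (h : 0 < (S u).im) : densityOf S u ^ 2 = 2 * (S u).im :=
  Real.sq_sqrt (by linarith)

lemma periodic_densityOf {S : ℝ → ℂ} {a : ℝ} (h : Function.Periodic S a) :
    Function.Periodic (densityOf S) a := fun u => by simp only [densityOf, h u]

lemma periodic_invariantOf {S : ℝ → ℂ} {a : ℝ} (h : Function.Periodic S a) :
    Function.Periodic (invariantOf S) a := by
  have h1 := periodic_densityOf h
  have h2 : Function.Periodic (logDensityDeriv S) a := fun u => by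
    simp only [logDensityDeriv, h1 u, periodic_deriv h1 u]
  intro u
  simp only [invariantOf, h u, h1 u, h2 u, periodic_deriv h2 u]

lemma SmoothFamily.densityOf (hS : SmoothFamily I S) (hpos : ∀ t ∈ I, ∀ u, 0 < (S t u).im) :
    SmoothFamily I fun t => Inversive.densityOf (S t) := by
  have h : SmoothFamily I fun t u => (S t u).im :=
    Complex.imCLM.contDiff.comp_contDiffOn hS
  exact ContDiffOn.sqrt (contDiffOn_const.mul h)
    fun z hz => (mul_pos two_pos (hpos z.1 hz.1 z.2)).ne'

lemma SmoothFamily.logDensityDeriv (hI : UniqueDiffOn ℝ I) (hS : SmoothFamily I S)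
    (hpos : ∀ t ∈ I, ∀ u, 0 < (S t u).im) :
    SmoothFamily I fun t => Inversive.logDensityDeriv (S t) :=
  ContDiffOn.div ((hS.densityOf hpos).deriv_right hI) (hS.densityOf hpos)
    fun z hz => (densityOf_pos (hpos z.1 hz.1 z.2)).ne'

lemma SmoothFamily.invariantOf (hI : UniqueDiffOn ℝ I) (hS : SmoothFamily I S)
    (hpos : ∀ t ∈ I, ∀ u, 0 < (S t u).im) :
    SmoothFamily I fun t => Inversive.invariantOf (S t) := by
  have h : SmoothFamily I fun t u => (S t u).re :=
    Complex.reCLM.contDiff.comp_contDiffOn hS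
  have hr := hS.logDensityDeriv hI hpos
  exact ContDiffOn.div ((ContDiffOn.sub h ((hr.deriv_right hI).div_const 2)).add
    ((ContDiffOn.pow hr 2).div_const 4)) (ContDiffOn.pow (hS.densityOf hpos) 2)
    fun z hz => pow_ne_zero 2 (densityOf_pos (hpos z.1 hz.1 z.2)).ne'

lemma SmoothFamily.velocityOf (hI : UniqueDiffOn ℝ I) (hS : SmoothFamily I S)
    (hpos : ∀ t ∈ I, ∀ u, 0 < (S t u).im) :
    SmoothFamily I fun t => Inversive.velocityOf (S t) := by
  have h0 : ∀ z ∈ I ×ˢ (univ : Set ℝ), Inversive.densityOf (S z.1) z.2 ≠ 0 :=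
    fun z hz => (densityOf_pos (hpos z.1 hz.1 z.2)).ne'
  have h : SmoothFamily I fun t u => arcDeriv (Inversive.densityOf (S t))
      (Inversive.invariantOf (S t)) u / Inversive.densityOf (S t) u :=
    ContDiffOn.div (ContDiffOn.div ((hS.invariantOf hI hpos).deriv_right hI)
      (hS.densityOf hpos) h0) (hS.densityOf hpos) h0
  exact contDiffOn_const.mul (Complex.ofRealCLM.contDiff.comp_contDiffOn h)

/-- The inversive profile of a curve with periodic Schwarzian derivative `2 S`. -/
def profileOf {S : ℝ → ℂ} {a : ℝ} (ha : 0 < a) (hS : ContDiff ℝ ∞ S) (hpos : ∀ u, 0 < (S u).im)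
    (hper : Function.Periodic S a) : Profile where
  a := a
  ρ := densityOf S
  Q := invariantOf S
  a_pos := ha
  ρ_smooth := SmoothFamily.contDiff (I := univ) (f := fun _ => densityOf S)
    (SmoothFamily.densityOf (hS.comp contDiff_snd).contDiffOn fun _ _ => hpos) (mem_univ 0)
  Q_smooth := SmoothFamily.contDiff (I := univ) (f := fun _ => invariantOf S)
    (SmoothFamily.invariantOf uniqueDiffOn_univ (hS.comp contDiff_snd).contDiffOn
      fun _ _ => hpos) (mem_univ 0)
  ρ_pos := fun u => densityOf_pos (hpos u)
  ρ_periodic := periodic_densityOf hper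
  Q_periodic := periodic_invariantOf hper

lemma hasDerivAt_re_im {f : ℝ → ℂ} {x y t : ℝ}
    (h : HasDerivAt f ((x : ℂ) - (y : ℂ) * Complex.I) t) :
    HasDerivAt (fun s => (f s).re) x t ∧ HasDerivAt (fun s => (f s).im) (-y) t :=
  ⟨(Complex.reCLM.hasFDerivAt.comp_hasDerivAt t h).congr_deriv (by simp),
    (Complex.imCLM.hasFDerivAt.comp_hasDerivAt t h).congr_deriv (by simp)⟩

/-- The evolution of the Schwarzian derivative in terms of the inversive invariants. -/
lemma schwarzian_rate_eq {S : ℝ → ℂ} {a : ℝ} (ha : 0 < a) (hS : ContDiff ℝ ∞ S)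
    (hpos : ∀ u, 0 < (S u).im) (hper : Function.Periodic S a) (u : ℝ) :
    deriv (deriv (deriv (velocityOf S))) u / 2 + 2 * S u * deriv (velocityOf S) u +
        deriv S u * velocityOf S u =
      ((densityOf S u ^ 2 * (profileOf ha hS hpos hper).jet 2 u : ℝ) : ℂ) -
        ((densityOf S u ^ 2 * (profileOf ha hS hpos hper).eval u lengthRate / 2 : ℝ) : ℂ) *
          Complex.I := by
  set Λ := profileOf ha hS hpos hper with hΛ
  have hρ : Λ.ρ = densityOf S := rfl
  have hρ0 : ∀ w, Λ.ρ w ≠ 0 := fun w => (Λ.ρ_pos w).ne'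
  have hq1 : ContDiff ℝ ∞ (Λ.jet 1) := Λ.contDiff_jet 1
  set g : ℝ → ℝ := fun w => Λ.jet 1 w / Λ.ρ w with hg
  have hgs : ContDiff ℝ ∞ g := hq1.div Λ.ρ_smooth hρ0
  have hf : ∀ h : ℝ → ℝ, ContDiff ℝ ∞ h → deriv (fun w => -Complex.I * ((h w : ℝ) : ℂ)) =
      fun w => -Complex.I * ((deriv h w : ℝ) : ℂ) := fun h hh => funext fun w =>
    ((hasDerivAt_of_contDiff hh w).ofReal_comp.const_mul _).deriv
  have hv : velocityOf S = fun w => -Complex.I * ((g w : ℝ) : ℂ) := rfl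
  have h1 := hf g hgs
  have h2 := hf _ (contDiff_deriv hgs)
  have h3 := hf _ (contDiff_deriv (contDiff_deriv hgs))
  -- The velocity is -ig with g = Q_s/ρ real, so Re S enters the imaginary part of the rate through
  -- this operator, and Im S enters the real part.
  have hop := projective_operator_eq Λ (R := fun w => (S w).re) (fun w => by
    have h : Λ.Q w = ((S w).re - deriv (fun w => deriv Λ.ρ w / Λ.ρ w) w / 2 +
      (deriv Λ.ρ w / Λ.ρ w) ^ 2 / 4) / Λ.ρ w ^ 2 := rfl
    rw [h, div_mul_cancel₀ _ (pow_ne_zero 2 (hρ0 w))]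
    ring) u
  have dS := hasDerivAt_of_contDiff hS u
  have dR : HasDerivAt (fun w => (S w).re) (deriv S u).re u :=
    Complex.reCLM.hasFDerivAt.comp_hasDerivAt u dS
  have dJ : HasDerivAt (fun w => (S w).im) (deriv S u).im u :=
    Complex.imCLM.hasFDerivAt.comp_hasDerivAt u dS
  have dρ := hasDerivAt_of_contDiff Λ.ρ_smooth u
  have hJ' : (deriv S u).im = Λ.ρ u * deriv Λ.ρ u := by
    have e : (fun w => (S w).im) = fun w => Λ.ρ w ^ 2 / 2 := funext fun w => by
      rw [hρ, densityOf_sq (hpos w)]; ring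
    rw [e] at dJ
    rw [dJ.unique ((dρ.pow 2).div_const 2)]
    simp
    ring
  have hJ : (S u).im = Λ.ρ u ^ 2 / 2 := by rw [hρ, densityOf_sq (hpos u)]; ring
  have dq1 : HasDerivAt (Λ.jet 1) (Λ.ρ u * Λ.jet 2 u) u := by
    simpa using Λ.hasDerivAt_eval (MvPolynomial.X 1) u
  -- This is (ρg)_u = ρQ_ss. With Im S = ρ²/2 it gives 2 Im S g_u + (Im S)_u g = ρ(ρg)_u = ρ²Q_ss.
  have hg' : Λ.ρ u * deriv g u + deriv Λ.ρ u * g u = Λ.ρ u * Λ.jet 2 u := by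
    have := hρ0 u
    rw [show deriv g u = _ from (dq1.div dρ this).deriv, hg]
    field_simp
    ring
  rw [dR.deriv] at hop
  rw [hv, h1, h2, h3]
  have e1 : S u = ((S u).re : ℂ) + ((S u).im : ℂ) * Complex.I := (Complex.re_add_im _).symm
  have e2 : deriv S u = ((deriv S u).re : ℂ) + ((deriv S u).im : ℂ) * Complex.I :=
    (Complex.re_add_im _).symm
  rw [e1, e2, hJ, hJ', ← hρ, ← hop]
  have hg'' : ((Λ.ρ u : ℝ) : ℂ) * ((deriv g u : ℝ) : ℂ) + ((deriv Λ.ρ u : ℝ) : ℂ) * ((g u : ℝ) : ℂ)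
      = ((Λ.ρ u : ℝ) : ℂ) * ((Λ.jet 2 u : ℝ) : ℂ) := by exact_mod_cast hg'
  have hgu : Λ.jet 1 u / Λ.ρ u = g u := rfl
  rw [hgu]
  push_cast
  linear_combination (Λ.ρ u : ℂ) * hg'' - (Λ.ρ u ^ 2 * ((deriv g u : ℝ) : ℂ) +
    (Λ.ρ u : ℂ) * ((deriv Λ.ρ u : ℝ) : ℂ) * (g u : ℂ)) * Complex.I_sq

end

section

variable {a τ : ℝ} {S : ℝ → ℝ → ℂ} (ha : 0 < a) (hτ : 0 < τ) (hS : SmoothFamily (Icc 0 τ) S)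
  (hpos : ∀ t ∈ Icc 0 τ, ∀ u, 0 < (S t u).im)
  (hper : ∀ t ∈ Icc 0 τ, Function.Periodic (S t) a)
  (hev : ∀ t ∈ Ioo 0 τ, ∀ u, HasDerivAt (fun s => S s u)
    (deriv (deriv (deriv (velocityOf (S t)))) u / 2 + 2 * S t u * deriv (velocityOf (S t)) u +
      deriv (S t) u * velocityOf (S t) u) t)

-- From ρ² = 2 Im S and ∂_t Im S = -½ρ²P.
include hpos hper hev in
lemma hasDerivAt_densityOf {t : ℝ} (ht : t ∈ Ioo 0 τ) (u : ℝ) :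
    HasDerivAt (fun s => densityOf (S s) u) (-(1 / 2) *
      (profileOf ha (hS.contDiff (Ioo_subset_Icc_self ht)) (hpos t (Ioo_subset_Icc_self ht))
        (hper t (Ioo_subset_Icc_self ht))).eval u lengthRate * densityOf (S t) u) t := by
  have ht' := Ioo_subset_Icc_self ht
  have h := hev t ht u
  rw [schwarzian_rate_eq ha (hS.contDiff ht') (hpos t ht') (hper t ht')] at h
  have hJ := (hasDerivAt_re_im h).2.const_mul 2
  refine (hJ.sqrt (mul_pos two_pos (hpos t ht' u)).ne').congr_deriv ?_
  have h0 := (densityOf_pos (hpos t ht' u)).ne'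
  change _ / (2 * densityOf (S t) u) = _
  field_simp

-- Differentiates Qρ² = Re S - r_u/2 + r²/4 with r = ρ_u/ρ, using ∂_t r = -½P_u. The terms in r
-- cancel and leave Q'' + ¼P'' + QP.
include hpos hper hev in
lemma hasDerivAt_invariantOf {t : ℝ} (ht : t ∈ Ioo 0 τ) (u : ℝ) :
    HasDerivAt (fun s => invariantOf (S s) u)
      ((profileOf ha (hS.contDiff (Ioo_subset_Icc_self ht)) (hpos t (Ioo_subset_Icc_self ht))
        (hper t (Ioo_subset_Icc_self ht))).eval u (jetRate 0)) t := by
  have ht' := Ioo_subset_Icc_self ht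
  have hU := isOpen_Ioo (a := (0 : ℝ)) (b := τ)
  have hS' := hS.mono (Ioo_subset_Icc_self (a := (0 : ℝ)) (b := τ))
  have hpos' : ∀ t ∈ Ioo 0 τ, ∀ u, 0 < (S t u).im := fun t ht => hpos t (Ioo_subset_Icc_self ht)
  have hρ := hS'.densityOf hpos'
  have hr := hS'.logDensityDeriv hU.uniqueDiffOn hpos'
  have dρ := fun v => hasDerivAt_densityOf ha hS hpos hper hev ht v
  have h := hev t ht u
  rw [schwarzian_rate_eq ha (hS.contDiff ht') (hpos t ht') (hper t ht')] at h
  have hR := (hasDerivAt_re_im h).1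
  set Λ := profileOf ha (hS.contDiff ht') (hpos t ht') (hper t ht') with hΛ
  have hΛρ : densityOf (S t) = Λ.ρ := rfl
  have hΛQ : invariantOf (S t) u = Λ.jet 0 u := rfl
  have hρ0 : ∀ w, Λ.ρ w ≠ 0 := fun w => (Λ.ρ_pos w).ne'
  have uρ := fun v => hasDerivAt_of_contDiff Λ.ρ_smooth v
  have dρ1 : ∀ v, HasDerivAt (fun s => deriv (densityOf (S s)) v)
      (-(1 / 2) * (Λ.ρ v * Λ.eval v (totalDeriv lengthRate)) * Λ.ρ v +
        -(1 / 2) * Λ.eval v lengthRate * deriv Λ.ρ v) t := fun v => by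
    refine (hρ.hasDerivAt_deriv_right hU ht v).congr_deriv ?_
    rw [funext fun w => (dρ w).deriv]
    exact (((Λ.hasDerivAt_eval lengthRate v).const_mul _).mul (uρ v)).deriv
  have dr : ∀ v, HasDerivAt (fun s => logDensityDeriv (S s) v)
      (-(1 / 2) * (Λ.ρ v * Λ.eval v (totalDeriv lengthRate))) t := fun v => by
    refine ((dρ1 v).div (dρ v) (hρ0 v)).congr_deriv ?_
    have := hρ0 v
    rw [hΛρ]
    field_simp
    ring
  have dr1 : HasDerivAt (fun s => deriv (logDensityDeriv (S s)) u)
      (-(1 / 2) * (deriv Λ.ρ u * Λ.eval u (totalDeriv lengthRate) +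
        Λ.ρ u * (Λ.ρ u * Λ.eval u (totalDeriv (totalDeriv lengthRate))))) t := by
    refine (hr.hasDerivAt_deriv_right hU ht u).congr_deriv ?_
    rw [funext fun w => (dr w).deriv]
    exact (((uρ u).mul (Λ.hasDerivAt_eval _ u)).const_mul _).deriv
  refine ((((hR.sub (dr1.div_const 2)).add (((dr u).pow 2).div_const 4)).div ((dρ u).pow 2)
    (pow_ne_zero 2 (hρ0 u)))).congr_deriv ?_
  have hlog : deriv Λ.ρ u = logDensityDeriv (S t) u * Λ.ρ u := by
    rw [logDensityDeriv, hΛρ, div_mul_cancel₀ _ (hρ0 u)]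
  have hre : (S t u).re - deriv (logDensityDeriv (S t)) u / 2 + logDensityDeriv (S t) u ^ 2 / 4 =
      Λ.jet 0 u * Λ.ρ u ^ 2 := by
    rw [← hΛQ, invariantOf, hΛρ, div_mul_cancel₀ _ (pow_ne_zero 2 (hρ0 u))]
  have h1 := hρ0 u
  simp only [Pi.add_apply, Pi.sub_apply, Pi.pow_apply, hre]
  simp only [hΛρ, hlog, jetRate, map_add, map_mul, Profile.eval_X, Profile.eval_C]
  generalize logDensityDeriv (S t) u = r
  generalize Λ.ρ u = x at h1
  field_simp
  ring

/-- The flow of the inversive invariants determined by an evolving Schwarzian derivative. -/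
def flowOf : LengtheningFlow where
  a := a
  τ := τ
  ρ := fun t => densityOf (S t)
  Q := fun t => invariantOf (S t)
  a_pos := ha
  τ_pos := hτ
  ρ_smooth := hS.densityOf hpos
  Q_smooth := hS.invariantOf (uniqueDiffOn_Icc hτ) hpos
  ρ_pos := fun t ht u => densityOf_pos (hpos t ht u)
  ρ_periodic := fun t ht => periodic_densityOf (hper t ht)
  Q_periodic := fun t ht => periodic_invariantOf (hper t ht)
  ρ_evolution := fun _ ht u => hasDerivAt_densityOf ha hS hpos hper hev ht u
  Q_evolution := fun _ ht u => hasDerivAt_invariantOf ha hS hpos hper hev ht u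

end

end Inversive

end

/-! ### Application to inversive curve lengthening flows. -/

noncomputable section

namespace Inversive

open Set Filter Topology

/-! ### The invariants of the curves of a flow -/

section

variable {X : ℝ → CP1} {W : ℝ → Fin 2 → ℂ}

lemma invDensity_eq_densityOf (hX : IsAdmissible X) (hW : IsSmoothLift W X) :
    invDensity X = densityOf (halfSchwarzian W) :=
  funext (invariants_eq hX hW).2.2.1

lemma fundInv_eq_invariantOf (hX : IsAdmissible X) (hW : IsSmoothLift W X) :
    fundInv X = invariantOf (halfSchwarzian W) := by
  funext u
  rw [(invariants_eq hX hW).2.2.2, invDensity_eq_densityOf hX hW]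
  rfl

lemma fundInvDeriv_eq (hX : IsAdmissible X) (hW : IsSmoothLift W X) (p : ℕ) :
    fundInvDeriv X p =
      (arcDeriv (densityOf (halfSchwarzian W)))^[p] (invariantOf (halfSchwarzian W)) := by
  rw [← invDensity_eq_densityOf hX hW, ← fundInv_eq_invariantOf hX hW]
  rfl

lemma IsSmoothLiftOn.isSmoothLift {I : Set ℝ} {W : ℝ → ℝ → Fin 2 → ℂ} {X : ℝ → ℝ → CP1}
    (hW : IsSmoothLiftOn I W X) {t : ℝ} (ht : t ∈ I) : IsSmoothLift (W t) (X t) :=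
  ⟨SmoothFamily.contDiff hW.1 ht, hW.2 t ht⟩

/-- The Schwarzian derivative of a cocompact curve is periodic. -/
lemma periodic_halfSchwarzian {L : Moebius} {a : ℝ} (hX : IsAdmissible X)
    (hW : IsSmoothLift W X) (hL : ∀ u, X (u + a) = L • X u) :
    Function.Periodic (halfSchwarzian W) a := by
  obtain ⟨g, rfl⟩ := QuotientGroup.mk_surjective L
  have hdet : (g : Matrix (Fin 2) (Fin 2) ℂ).det ≠ 0 := by simp
  have h1 : IsSmoothLift (fun u => W (u + a)) fun u => X (u + a) :=
    ⟨hW.1.comp (contDiff_id.add contDiff_const), fun u => hW.2 (u + a)⟩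
  have h2 : IsSmoothLift (fun u => (g : Matrix (Fin 2) (Fin 2) ℂ) *ᵥ W u)
      fun u => X (u + a) := by
    refine ⟨contDiff_mulVec _ hW.1, fun u => ?_⟩
    obtain ⟨h0, hu⟩ := hW.2 u
    have hne : (g : Matrix (Fin 2) (Fin 2) ℂ) *ᵥ W u ≠ 0 := fun h =>
      h0 (Matrix.eq_zero_of_mulVec_eq_zero hdet h)
    exact ⟨hne, (hL u).trans (by rw [hu]; rfl)⟩
  -- The translate W(u + a) and the image g W(u) are lifts of the same curve, so their Schwarzian
  -- derivatives agree.
  obtain ⟨φ, hφ, hφ0, e⟩ := exists_smul_of_isSmoothLift h1 h2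
  have hdetW := (invariants_eq hX hW).1
  intro u
  rw [← halfSchwarzian_comp_add, e, (halfSchwarzian_smul hφ hφ0 h2.1 fun v => ?_).2,
    halfSchwarzian_mulVec hdet hW.1]
  rw [deriv_mulVec _ hW.1, det2_mulVec]
  exact mul_ne_zero hdet (hdetW v)

/-- The velocity of the flow in terms of a lift. -/
lemma neg_invDeriv_smul_invNormalLift (hX : IsAdmissible X) (hW : IsSmoothLift W X) (u : ℝ) :
    (-(invDeriv X (fundInv X) u)) • invNormalLift X W u =
      velocityOf (halfSchwarzian W) u • deriv W u := by
  have hv : velocityOf (halfSchwarzian W) u =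
      -Complex.I * ((invDeriv X (fundInv X) u / invDensity X u : ℝ) : ℂ) := by
    rw [velocityOf, ← invDensity_eq_densityOf hX hW, ← fundInv_eq_invariantOf hX hW]
    rfl
  have hk : fsDeriv X (geodCurv X) u ^ (-1 / 2 : ℝ) =
      (√(fsDeriv X (geodCurv X) u))⁻¹ := by
    rw [neg_div, Real.rpow_neg (hX.2.2 u).le, Real.sqrt_eq_rpow]
  rw [hv, invNormalLift, hk, invDensity]
  ext i
  simp only [Pi.smul_apply, Complex.real_smul, smul_eq_mul, mul_inv, div_eq_mul_inv]
  push_cast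
  ring

end

lemma mem_timeInterval {T : EReal} {τ t : ℝ} (hτ : (τ : EReal) < T) (ht : t ∈ Icc 0 τ) :
    t ∈ timeInterval T :=
  ⟨ht.1, (EReal.coe_le_coe_iff.2 ht.2).trans_lt hτ⟩

/-- The flow of the inversive invariants of an inversive curve lengthening flow. -/
lemma IsInversiveFlow.exists_lengtheningFlow {L : Moebius} {a τ : ℝ} {T : EReal}
    {X : ℝ → ℝ → CP1} (hX : IsInversiveFlow L a T X) (ha : 0 < a) (hτ : 0 < τ)
    (hτT : (τ : EReal) < T) :
    ∃ M : LengtheningFlow, M.τ = τ ∧ ∀ t ∈ Icc 0 τ,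
      M.length t = invLength (X t) a ∧ ∀ p, M.sobolev p t = energy (X t) a p := by
  obtain ⟨W, hW, hev⟩ := hX.evolution
  have hsub : Icc 0 τ ⊆ timeInterval T := fun t ht => mem_timeInterval hτT ht
  have hsub' : Ioo 0 τ ⊆ Icc 0 τ := Ioo_subset_Icc_self
  have hlift := fun t (ht : t ∈ Icc 0 τ) => hW.isSmoothLift (hsub ht)
  have hadm := fun t (ht : t ∈ Icc 0 τ) => hX.admissible t (hsub ht)
  have hinv := fun t (ht : t ∈ Icc 0 τ) => invariants_eq (hadm t ht) (hlift t ht)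
  have hWs : SmoothFamily (Icc 0 τ) W := SmoothFamily.mono hW.1 hsub
  have hWo := hWs.mono hsub'
  have hU := uniqueDiffOn_Icc hτ
  have hO := isOpen_Ioo (a := (0 : ℝ)) (b := τ)
  have hdet := fun t ht => (hinv t ht).1
  have hpos := fun t ht => (hinv t ht).2.1
  have hS := hWs.halfSchwarzian hU hdet
  have hper : ∀ t ∈ Icc 0 τ, Function.Periodic (halfSchwarzian (W t)) a := fun t ht =>
    periodic_halfSchwarzian (hadm t ht) (hlift t ht) (hX.equivariant t (hsub ht))
  have hevS : ∀ t ∈ Ioo 0 τ, ∀ u, HasDerivAt (fun s => halfSchwarzian (W s) u)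
      (deriv (deriv (deriv (velocityOf (halfSchwarzian (W t))))) u / 2 +
        2 * halfSchwarzian (W t) u * deriv (velocityOf (halfSchwarzian (W t))) u +
        deriv (halfSchwarzian (W t)) u * velocityOf (halfSchwarzian (W t)) u) t := by
    intro t ht u
    refine hasDerivAt_halfSchwarzian hO hWo (fun t ht => hdet t (hsub' ht))
      (f := fun t => velocityOf (halfSchwarzian (W t)))
      -- The flow equation provides μ only pointwise; pairing with W_u by the determinant recovers
      -- it as a smooth function.
      (μ := fun t u => det2 (deriv (fun s => W s u) t) (deriv (W t) u) /
        det2 (W t u) (deriv (W t) u))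
      ((hS.mono hsub').velocityOf hO.uniqueDiffOn fun t ht => hpos t (hsub' ht))
      (((hWo.deriv_left hO).det2 (hWo.deriv_right hO.uniqueDiffOn)).complex_div
        (hWo.det2 (hWo.deriv_right hO.uniqueDiffOn)) fun t ht => hdet t (hsub' ht))
      (fun t ht u => ?_) ht u
    have ht' := hsub' ht
    obtain ⟨μ, hμ⟩ := hev t (hsub ht') u
    -- At interior times the one-sided derivative in the definition of the flow is an ordinary one.
    rw [derivWithin_of_mem_nhds (mem_of_superset (hO.mem_nhds ht) (hsub'.trans hsub)),
      neg_invDeriv_smul_invNormalLift (hadm t ht') (hlift t ht')] at hμ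
    rw [hμ, det2_add_left, det2_smul_left, det2_smul_left, det2_self, mul_zero, zero_add,
      mul_div_cancel_right₀ _ (hdet t ht' u)]
  refine ⟨flowOf ha hτ hS hpos hper hevS, rfl, fun t ht => ⟨?_, fun p => ?_⟩⟩
  · simp only [LengtheningFlow.length, LengtheningFlow.integral, LengtheningFlow.eval, map_one,
      one_mul, invLength, invDensity_eq_densityOf (hadm t ht) (hlift t ht)]
    rfl
  · simp only [LengtheningFlow.sobolev, LengtheningFlow.integral, LengtheningFlow.eval, map_pow,
      MvPolynomial.aeval_X, energy, invDensity_eq_densityOf (hadm t ht) (hlift t ht),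
      fundInvDeriv_eq (hadm t ht) (hlift t ht)]
    rfl

end Inversive

end

/-! ### The proposition. -/

theorem mainTheorem4 (L : Inversive.Moebius) (p : ℕ) (hp : 1 ≤ p)
    -- the homotopy class, given by one of its members
    (Y : ℝ → Inversive.CP1) (hY : Inversive.IsCocompact L Y)
    -- the values of `ℓ(X₀)` and of `∫ Q² ds` at `t = 0`
    (ℓ₀ K : ℝ) :
    ∃ c : ℝ, 1 ≤ c ∧
      ∀ (X₀ : ℝ → Inversive.CP1) (a : ℝ), 0 < a →
        Inversive.IsCocompact L X₀ →
        (∀ u, X₀ (u + a) = L • X₀ u) →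
        Inversive.Homotopic L Y X₀ →
        Inversive.invLength X₀ a = ℓ₀ →
        Inversive.energy X₀ a 0 = K →
        ∀ (T : EReal) (X : ℝ → ℝ → Inversive.CP1),
          Inversive.IsInversiveFlow L a T X → X 0 = X₀ →
          ∀ t : ℝ, 0 < t → (t : EReal) < T →
            Inversive.energy (X t) a p ≤
              c * min (Inversive.energy X₀ a p) (1 + t ^ (-(p : ℝ) / 3)) := by
  obtain ⟨c, hc, h⟩ := Inversive.LengtheningFlow.exists_sobolev_le p hp ℓ₀ K
  refine ⟨c, hc, ?_⟩
  rintro _ a ha - - - hℓ hK T X hX rfl t ht htT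
  -- A compact time interval [0, τ] inside [0, T) that contains t suffices, since the constant does
  -- not depend on τ.
  obtain ⟨τ, htτ, hτT⟩ := EReal.lt_iff_exists_real_btwn.1 htT
  have htτ' : t < τ := EReal.coe_lt_coe_iff.1 htτ
  have hτ : 0 < τ := ht.trans htτ'
  obtain ⟨M, rfl, hM⟩ := hX.exists_lengtheningFlow ha hτ hτT
  have h0 := hM 0 ⟨le_rfl, hτ.le⟩
  have htm : t ∈ Set.Icc 0 M.τ := ⟨ht.le, htτ'.le⟩
  rw [← (hM t htm).2, ← h0.2]
  exact h M (h0.1.trans hℓ) ((h0.2 0).trans hK) t htm ht
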